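/- Let $N\ge 2$, $\nu>0$, $\alpha\ge 1+\frac N2$, $s\ge 3+N$ and $T>0$. Let $g_1:(0,\infty)\to[1,\infty)$ be non-decreasing with $$\int_e^\infty \frac{d\tau}{g_1^2(\tau)\,\ln(\tau)\,\tau}=\infty .$$ For a measurable $m_1:\mathbb R^N\to\mathbb R$ let $\mathcal L_1$ be the Fourier multiplier $\widehat{\mathcal L_1 f}(\xi)=m_1(\xi)\hat f(\xi)$, where $\xi$ is the angular frequency, i.e. $\partial_j$ has the symbol $i\xi_j$, and suppose that for some $R>0$ $$m_1(\xi)\ \ge\ \frac{|\xi|^\alpha}{g_1(|\xi|)}\qquad\text{for all } |\xi|\ge R. \tag{$*$}$$ Consider on $\mathbb R^N$ the magnetohydrodynamics system with zero diffusivity $$\partial_t u+(u\cdot\nabla)u-(b\cdot\nabla)b+\nabla\pi+\nu\mathcal L_1^2u=0,\qquad \partial_t b+(u\cdot\nabla)b-(b\cdot\nabla)u=0,\qquad \nabla\cdot u=\nabla\cdot b=0 .$$ A solution on a time interval $I$ (equal to $[0,T]$ or to $[0,T')$) is a pair of real vector fields $u,b\in C(I;H^s)$, divergence free on $I$, such that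 at each interior time $t$ of $I$ the time derivatives exist in $L^2$, $\mathcal L_1^2u(t)\in L^2$, $\nabla\pi(t)\in L^2$ with $\pi(t)\in C^1$, and the equations hold in $L^2$. Write $\|\mathcal L_1\nabla u\|_{L^2}^2=\sum_j\|\mathcal L_1\partial_ju\|_{L^2}^2$. 1. Every solution $(u,b)$ on $[0,T]$ satisfies $$\sup_{t\in[0,T]}\left(\|\nabla u(t)\|_{L^2}^2+\|\nabla b(t)\|_{L^2}^2\right)+\int_0^T\|\mathcal L_1\nabla u(t)\|_{L^2}^2\,dt<\infty .$$ 2. (The a priori bound.) Suppose moreover that $g_1(r)=O(r^p)$ as $r\to\infty$ for some $p<\alpha-\frac N2$; this holds in particular if $g_1$ grows at most logarithmically. Then for all $R>0$ and $K\ge0$ there is a constant $C$, depending only on $N,\nu,\alpha,g_1,s,T,R,K$, such that for every measurable $m_1$ satisfying $(*)$ with this $R$, every $T'\in(0,T]$ and every solution $(u,b)$ on $[0,T')$ with $\|u(0)\|_{H^s}^2+\|b(0)\|_{H^s}^2\le K$, $$\sup_{t\in[0,T')}\left(\|\nabla u(t)\|_{L^2}^2+\|\nabla b(t)\|_{L^2}^2\right)+\int_0^{T'}\|\mathcal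 L_1\nabla u(t)\|_{L^2}^2\,dt\le C .$$ -/

import Mathlib

open MeasureTheory Set Filter Topology Asymptotics
open scoped ENNReal NNReal FourierTransform

noncomputable section

namespace MHD

/-- Physical and frequency space `ℝᴺ` with its Euclidean norm. -/
abbrev Sp (N : ℕ) : Type := EuclideanSpace ℝ (Fin N)

/-- The complex vectors `ℂᴺ`, in which Fourier transforms of vector fields take their values. -/
abbrev CSp (N : ℕ) : Type := EuclideanSpace ℂ (Fin N)

/-- The `j`-th standard basis vector of `ℝᴺ`. -/
def basisVec {N : ℕ} (j : Fin N) : Sp N := EuclideanSpace.single j 1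

/-- A real vector field, seen as a complex one. -/
def complexify {N : ℕ} (v : Sp N → Sp N) : Sp N → CSp N :=
  fun x => WithLp.toLp 2 (fun i => ((v x i : ℝ) : ℂ))

/-- The partial derivative `∂ⱼ v`. -/
def partialDeriv {N : ℕ} (j : Fin N) (v : Sp N → Sp N) : Sp N → Sp N :=
  fun x => fderiv ℝ v x (basisVec j)

/-- The divergence `∇ · v`. -/
def div {N : ℕ} (v : Sp N → Sp N) (x : Sp N) : ℝ := ∑ i, partialDeriv i v x i

/-- The convective term `(v · ∇) w`. -/
def convect {N : ℕ} (v w : Sp N → Sp N) : Sp N → Sp N := fun x => fderiv ℝ w x (v x)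

/-- Square integrability of a vector field. -/
def IsL2 {N : ℕ} (v : Sp N → Sp N) : Prop := MemLp (complexify v) 2 (volume : Measure (Sp N))

open Classical in
/-- The class in `L²(ℝᴺ; ℂᴺ)` of a square integrable vector field
(and `0`, by convention, for a field that is not square integrable). -/
def toL2 {N : ℕ} (v : Sp N → Sp N) : Lp (CSp N) 2 (volume : Measure (Sp N)) :=
  if h : IsL2 v then MemLp.toLp (complexify v) h else 0

/-- `‖v‖²_{Hˢ} = ∫ (1 + |ξ|²)ˢ |v̂(ξ)|² dξ` for a square integrable field `v`. Mathlib's (unitary)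
Fourier transform has the kernel `exp (- 2 π i x · ξ)`, so that its variable `ξ` stands for the
angular frequency `2 π ξ`; thus `∂ⱼ` has the symbol `i (2 π ξ)ⱼ`. -/
def sobolevNormSq {N : ℕ} (s : ℝ) (v : Sp N → Sp N) : ℝ≥0∞ :=
  ∫⁻ ξ : Sp N, ENNReal.ofReal ((1 + ‖(2 * Real.pi) • ξ‖ ^ 2) ^ s) * ‖(𝓕 (toL2 v)) ξ‖ₑ ^ 2

/-- `h = m(D) f` in `L²`: the Fourier multiplier with the real symbol `m` (a function of the
angular frequency) sends `f` to `h`. -/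
def IsMultiplierImage {N : ℕ} (m : Sp N → ℝ) (f h : Lp (CSp N) 2 (volume : Measure (Sp N))) :
    Prop :=
  ∀ᵐ ξ : Sp N, (𝓕 h) ξ = ((m ((2 * Real.pi) • ξ) : ℝ) : ℂ) • (𝓕 f) ξ

/-- `‖∇ v‖²_{L²} = ∑ⱼ ‖∂ⱼ v‖²_{L²}`. -/
def gradNormSq {N : ℕ} (v : Sp N → Sp N) : ℝ≥0∞ :=
  ∑ j, ∫⁻ x : Sp N, ‖partialDeriv j v x‖ₑ ^ 2

/-- `‖m(D) ∇ v‖²_{L²} = ∑ⱼ ‖m(D) ∂ⱼ v‖²_{L²}` for a field with square integrable first derivatives,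
computed on the Fourier side; it is `∞` if `m(D) ∇ v` is not square integrable. -/
def multGradNormSq {N : ℕ} (m : Sp N → ℝ) (v : Sp N → Sp N) : ℝ≥0∞ :=
  ∑ j, ∫⁻ ξ : Sp N, ‖((m ((2 * Real.pi) • ξ) : ℝ) : ℂ) • (𝓕 (toL2 (partialDeriv j v))) ξ‖ₑ ^ 2

/-- `v ∈ C(I; Hˢ)`. Each `v t` is the twice continuously differentiable representative of its class;
for `s > 2 + N / 2` one exists by Sobolev embedding. -/
structure IsContinuousInSobolev {N : ℕ} (s : ℝ) (I : Set ℝ) (v : ℝ → Sp N → Sp N) : Prop where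
  contDiff : ∀ t ∈ I, ContDiff ℝ 2 (v t)
  isL2 : ∀ t ∈ I, IsL2 (v t)
  sobolev : ∀ t ∈ I, sobolevNormSq s (v t) < ⊤
  continuous : ∀ t₀ ∈ I, Tendsto (fun t => sobolevNormSq s (v t - v t₀)) (𝓝[I] t₀) (𝓝 0)

/-- `(u, b)` solves, on the time interval `I`, the MHD system with viscosity `ν`, dissipation
`m(D)²` and zero diffusivity

`∂ₜ u + (u · ∇) u - (b · ∇) b + ∇ π + ν m(D)² u = 0`,
`∂ₜ b + (u · ∇) b - (b · ∇) u = 0`, `∇ · u = ∇ · b = 0`,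

in the class `C(I; Hˢ)`. For `t` inside `I` the time derivatives exist in `L²`, the field `m(D)² u`
(the one called `Lu` below) is in `L²`, and the equations hold in `L²`. -/
structure IsSolution {N : ℕ} (ν : ℝ) (m : Sp N → ℝ) (s : ℝ) (I : Set ℝ)
    (u b : ℝ → Sp N → Sp N) : Prop where
  u_sobolev : IsContinuousInSobolev s I u
  b_sobolev : IsContinuousInSobolev s I b
  u_div : ∀ t ∈ I, ∀ x, div (u t) x = 0
  b_div : ∀ t ∈ I, ∀ x, div (b t) x = 0
  momentum : ∀ t ∈ interior I,
    ∃ (P : Sp N → ℝ) (Lu : Lp (CSp N) 2 (volume : Measure (Sp N))),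
      ContDiff ℝ 1 P ∧ IsL2 (gradient P) ∧
      IsMultiplierImage (fun ξ => m ξ ^ 2) (toL2 (u t)) Lu ∧
      HasDerivAt (fun τ => toL2 (u τ))
        (-toL2 (convect (u t) (u t)) + toL2 (convect (b t) (b t)) - toL2 (gradient P)
          - (ν : ℂ) • Lu) t
  induction_eq : ∀ t ∈ interior I,
    HasDerivAt (fun τ => toL2 (b τ))
      (-toL2 (convect (u t) (b t)) + toL2 (convect (b t) (u t))) t

/-- The lower bound `m(ξ) ≥ |ξ|^α / g(|ξ|)` for all `|ξ| ≥ R`. -/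
def LowerBoundFrom {N : ℕ} (α : ℝ) (g : ℝ → ℝ) (R : ℝ) (m : Sp N → ℝ) : Prop :=
  ∀ ξ : Sp N, R ≤ ‖ξ‖ → ‖ξ‖ ^ α / g ‖ξ‖ ≤ m ξ

/-- `sup_{t ∈ I} (‖∇u(t)‖²_{L²} + ‖∇b(t)‖²_{L²}) + ∫_I ‖m(D) ∇u(t)‖²_{L²} dt`, in `[0, ∞]`. -/
def energyH1 {N : ℕ} (m : Sp N → ℝ) (I : Set ℝ) (u b : ℝ → Sp N → Sp N) : ℝ≥0∞ :=
  (⨆ t ∈ I, (gradNormSq (u t) + gradNormSq (b t))) + ∫⁻ t in I, multGradNormSq m (u t)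

end MHD

end

/-!
The kinetic energy identity bounds `∫ ‖m(D) u‖²`, because the quadratic terms cancel. In the
identity for the `H¹` energy `X = ‖∇u‖² + ‖∇b‖²` they do not cancel, but after integration by parts
every one of them contains a factor `∇u`. They are thus at most a multiple of `‖∇u‖_∞ X`, where
`‖∇u‖_∞` is controlled by the `L¹` norm of the Fourier transform of `∇u`. For a solution on a closed
time interval that norm is bounded, by continuity in `Hˢ`.

For the a priori bound the frequencies are split at `R` and at `Y = (e + X) ^ κ` with `κ` large. The
low ones are bounded by the kinetic energy, the middle ones, since `α ≥ 1 + N / 2`, by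
`g(Y) (log Y) ^ (1 / 2) ‖m(D) u‖`, and the high ones by a negative power of `Y` times `‖m(D) ∇u‖`,
which the dissipation absorbs. What remains is `X' ≤ c (1 + ‖m(D) u‖²) g(Y)² (log Y) (e + X)`, and
the growth condition on `g` is Osgood's condition for this inequality once time is replaced by
`t + ∫₀ᵗ ‖m(D) u‖²`, a clock that stays bounded.
-/

namespace MHD

open scoped SchwartzMap InnerProductSpace ContDiff

section Fourier

variable {E F : Type*} [NormedAddCommGroup E] [InnerProductSpace ℝ E] [FiniteDimensional ℝ E]
  [MeasurableSpace E] [BorelSpace E] [NormedAddCommGroup F] [InnerProductSpace ℂ F]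

lemma continuous_fourierInv {h : E → F} (hh : Integrable h) : Continuous (𝓕⁻ h) := by
  rw [Real.fourierInv_eq_fourier_comp_neg]
  exact VectorFourier.fourierIntegral_continuous Real.continuous_fourierChar continuous_inner
    hh.comp_neg

lemma norm_fourierInv_le (h : E → F) (x : E) : ‖(𝓕⁻ h) x‖ ≤ ∫ ξ, ‖h ξ‖ := by
  rw [Real.fourierInv_eq_fourier_neg]
  exact VectorFourier.norm_fourierIntegral_le_integral_norm ..

lemma fderiv_fourierInv_apply {h : E → F} (hh : Integrable h)
    (hh' : Integrable fun ξ => ‖ξ‖ * ‖h ξ‖) (x w : E) :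
    fderiv ℝ (𝓕⁻ h) x w = 𝓕⁻ (fun ξ => ((2 * Real.pi * ⟪ξ, w⟫_ℝ : ℝ) * Complex.I) • h ξ) x := by
  have hneg : Integrable fun ξ => ‖ξ‖ * ‖h (-ξ)‖ := by simpa using hh'.comp_neg
  have hsmul : Integrable (VectorFourier.fourierSMulRight (innerSL ℝ) fun ξ => h (-ξ)) := by
    refine (hneg.const_mul (2 * Real.pi * ‖(innerSL ℝ : E →L[ℝ] E →L[ℝ] ℝ)‖)).mono'
      hh.comp_neg.1.fourierSMulRight (.of_forall fun ξ => ?_)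
    simpa only [mul_assoc] using VectorFourier.norm_fourierSMulRight_le (innerSL ℝ) _ ξ
  rw [Real.fourierInv_eq_fourier_comp_neg h, Real.fderiv_fourier hh.comp_neg hneg,
    Real.fourierInv_eq_fourier_comp_neg, Real.fourier_continuousLinearMap_apply hsmul]
  refine Real.fourier_congr_ae (.of_forall fun ξ => ?_) x
  simp only [VectorFourier.fourierSMulRight_apply, inner_neg_left, neg_smul]
  change -((2 * Real.pi * Complex.I : ℂ) • ⟪ξ, w⟫_ℝ • h (-ξ)) = _
  rw [← Complex.coe_smul ⟪ξ, w⟫_ℝ, smul_smul, ← neg_smul]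
  congr 1
  push_cast
  ring

variable [CompleteSpace F]

lemma integral_fourierInv_smul_eq {f : E → ℂ} {h : E → F} (hf : Integrable f)
    (hh : Integrable h) : ∫ x, (𝓕⁻ f) x • h x = ∫ x, f x • (𝓕⁻ h) x := by
  have hf_eq : 𝓕⁻ f = VectorFourier.fourierIntegral Real.fourierChar volume (-innerₗ E) f := by
    ext x
    simp [Real.fourierInv_eq, VectorFourier.fourierIntegral]
  have hh_eq : 𝓕⁻ h = VectorFourier.fourierIntegral Real.fourierChar volume (-innerₗ E).flip h := by
    ext x
    simp [Real.fourierInv_eq, VectorFourier.fourierIntegral, real_inner_comm]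
  rw [hf_eq, hh_eq]
  refine VectorFourier.integral_fourierIntegral_smul_eq_flip Real.continuous_fourierChar ?_ hf hh
  exact (continuous_inner (𝕜 := ℝ) (E := E)).neg

lemma coeFn_fourierInv_ae_eq (H : Lp F 2 (volume : Measure E)) (hH : Integrable H) :
    (𝓕⁻ H : Lp F 2 (volume : Measure E)) =ᵐ[volume] 𝓕⁻ (H : E → F) := by
  refine ae_eq_of_integral_contDiff_smul_eq ((Lp.memLp _).locallyIntegrable (by norm_num))
    (continuous_fourierInv hH).locallyIntegrable fun g hg hgc => ?_
  have hgc' : HasCompactSupport (Complex.ofRealCLM ∘ g) := hgc.comp_left rfl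
  let G : 𝓢(E, ℂ) := hgc'.toSchwartzMap (Complex.ofRealCLM.contDiff.comp hg)
  have hG : ∀ x, G x = (g x : ℂ) := fun x => by simp [G]
  have hdistr := congrArg (fun S : 𝓢'(E, F) => S G) (Lp.fourierInv_toTemperedDistribution_eq H)
  simp only [TemperedDistribution.fourierInv_apply, Lp.toTemperedDistribution_apply, hG] at hdistr
  calc ∫ x, g x • (𝓕⁻ H) x
      = ∫ x, (g x : ℂ) • (𝓕⁻ H) x := by simp only [Complex.coe_smul]
    _ = ∫ x, (𝓕⁻ (G : E → ℂ)) x • H x := by rw [← hdistr, SchwartzMap.fourierInv_coe]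
    _ = ∫ x, G x • (𝓕⁻ (H : E → F)) x := integral_fourierInv_smul_eq G.integrable hH
    _ = _ := by simp only [hG, Complex.coe_smul]

end Fourier

section Fields

variable {N : ℕ}

/-- The inclusion of `ℝᴺ` in `ℂᴺ`, as a linear isometry. -/
def inclusion : Sp N →ₗᵢ[ℝ] CSp N where
  toFun x := WithLp.toLp 2 fun i => ((x i : ℝ) : ℂ)
  map_add' x y := by ext i; simp
  map_smul' c x := by ext i; simp
  norm_map' x := by simp [EuclideanSpace.norm_eq]

lemma inclusion_apply (x : Sp N) (i : Fin N) : inclusion x i = (x i : ℂ) := rfl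

lemma complexify_apply (v : Sp N → Sp N) (x : Sp N) : complexify v x = inclusion (v x) := rfl

lemma norm_complexify (v : Sp N → Sp N) (x : Sp N) : ‖complexify v x‖ = ‖v x‖ :=
  (inclusion (N := N)).norm_map (v x)

lemma inner_complexify (v w : Sp N → Sp N) (x : Sp N) :
    ⟪complexify v x, complexify w x⟫_ℂ = (⟪v x, w x⟫_ℝ : ℂ) := by
  simp [PiLp.inner_apply, complexify_apply, inclusion_apply]

lemma isL2_iff {v : Sp N → Sp N} : IsL2 v ↔ MemLp v 2 volume :=
  (inclusion (N := N)).lipschitz.memLp_comp_iff_of_antilipschitz (inclusion (N := N)).antilipschitz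
    (map_zero _)

lemma coeFn_toL2 {v : Sp N → Sp N} (hv : IsL2 v) : toL2 v =ᵐ[volume] complexify v := by
  rw [toL2, dif_pos hv]
  exact hv.coeFn_toLp

lemma isL2_of_ae_eq {v : Sp N → Sp N} {f : Lp (CSp N) 2 (volume : Measure (Sp N))}
    (h : complexify v =ᵐ[volume] f) : IsL2 v :=
  (memLp_congr_ae h).2 (Lp.memLp f)

lemma toL2_eq_of_ae_eq {v : Sp N → Sp N} {f : Lp (CSp N) 2 (volume : Measure (Sp N))}
    (h : complexify v =ᵐ[volume] f) : toL2 v = f :=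
  Lp.ext ((coeFn_toL2 (isL2_of_ae_eq h)).trans h)

/-- The Fourier transform `v̂` of a square integrable vector field, in the normalization with kernel
`exp (- 2 π i x · ξ)`. -/
noncomputable abbrev hat (v : Sp N → Sp N) : Sp N → CSp N :=
  (𝓕 (toL2 v) : Lp (CSp N) 2 (volume : Measure (Sp N)))

lemma aestronglyMeasurable_hat (v : Sp N → Sp N) : AEStronglyMeasurable (hat v) volume :=
  Lp.aestronglyMeasurable _

lemma complexify_eq_fourierInv {v : Sp N → Sp N} (hc : Continuous v) (hv : IsL2 v)
    (hi : Integrable (hat v)) : complexify v = 𝓕⁻ (hat v) := by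
  refine (Continuous.ae_eq_iff_eq volume ((inclusion (N := N)).continuous.comp hc)
    (continuous_fourierInv hi)).1 ?_
  refine (coeFn_toL2 hv).symm.trans (.trans ?_ (coeFn_fourierInv_ae_eq _ hi))
  rw [FourierTransform.fourierInv_fourier_eq]

lemma isL2_and_hat_ae_eq_of_eq_fourierInv {v : Sp N → Sp N} {h : Sp N → CSp N}
    (hi : Integrable h) (h2 : MemLp h 2 volume) (hv : complexify v = 𝓕⁻ h) :
    IsL2 v ∧ hat v =ᵐ[volume] h := by
  have hcoe : h2.toLp h =ᵐ[volume] h := h2.coeFn_toLp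
  have hinv : complexify v =ᵐ[volume] (𝓕⁻ (h2.toLp h) : Lp (CSp N) 2 volume) := by
    have hfun : 𝓕⁻ (h2.toLp h : Sp N → CSp N) = 𝓕⁻ h := funext (Real.fourierInv_congr_ae hcoe)
    rw [hv, ← hfun]
    exact (coeFn_fourierInv_ae_eq _ ((integrable_congr hcoe).2 hi)).symm
  refine ⟨isL2_of_ae_eq hinv, ?_⟩
  rw [hat, toL2_eq_of_ae_eq hinv, FourierTransform.fourier_fourierInv_eq]
  exact hcoe

lemma complexify_partialDeriv {v : Sp N → Sp N} (hd : Differentiable ℝ v) (j : Fin N) (x : Sp N) :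
    complexify (partialDeriv j v) x = fderiv ℝ (complexify v) x (basisVec j) := by
  have hderiv : HasFDerivAt (complexify v)
      ((inclusion (N := N)).toContinuousLinearMap.comp (fderiv ℝ v x)) x :=
    (inclusion (N := N)).toContinuousLinearMap.hasFDerivAt.comp x (hd x).hasFDerivAt
  rw [hderiv.fderiv]
  rfl

/-- The symbol `2 π i ξⱼ` of `∂ⱼ` in Mathlib's normalization of the Fourier transform. -/
noncomputable def derivSymbol (j : Fin N) (ξ : Sp N) : ℂ := (2 * Real.pi * ξ j : ℝ) * Complex.I

@[fun_prop]
lemma continuous_derivSymbol (j : Fin N) : Continuous (derivSymbol j) := by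
  unfold derivSymbol
  fun_prop

lemma norm_derivSymbol (j : Fin N) (ξ : Sp N) : ‖derivSymbol j ξ‖ = 2 * Real.pi * |ξ j| := by
  simp [derivSymbol, abs_of_pos Real.pi_pos]

lemma norm_derivSymbol_le (j : Fin N) (ξ : Sp N) : ‖derivSymbol j ξ‖ ≤ 2 * Real.pi * ‖ξ‖ := by
  rw [norm_derivSymbol]
  gcongr
  exact PiLp.norm_apply_le ξ j

/-- The class of `Cᵏ` square integrable fields whose Fourier transform has moments of order `k` both
in `L¹` and in `L²`: on it the derivatives of order up to `k` can be computed by Fourier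
inversion. -/
structure HasMoments (k : ℕ) (v : Sp N → Sp N) : Prop where
  contDiff : ContDiff ℝ k v
  isL2 : IsL2 v
  integrable : Integrable fun ξ => (1 + ‖ξ‖) ^ k * ‖hat v ξ‖
  memLp : MemLp (fun ξ => (1 + ‖ξ‖) ^ k * ‖hat v ξ‖) 2 volume

namespace HasMoments

variable {k l : ℕ} {v : Sp N → Sp N}

lemma integrable_of_le (hv : HasMoments k v) {f : Sp N → ℝ} (hf : AEStronglyMeasurable f volume)
    {C : ℝ} (h : ∀ ξ, |f ξ| ≤ C * ((1 + ‖ξ‖) ^ k * ‖hat v ξ‖)) : Integrable f :=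
  (hv.integrable.const_mul C).mono' hf (.of_forall h)

lemma memLp_of_le (hv : HasMoments k v) {f : Sp N → ℝ} (hf : AEStronglyMeasurable f volume)
    {C : ℝ} (h : ∀ ξ, |f ξ| ≤ C * ((1 + ‖ξ‖) ^ k * ‖hat v ξ‖)) : MemLp f 2 volume :=
  (hv.memLp.const_mul C).mono hf (.of_forall fun ξ => (h ξ).trans (le_abs_self _))

lemma mono (hv : HasMoments k v) (h : l ≤ k) : HasMoments l v := by
  have hmeas : AEStronglyMeasurable (fun ξ => (1 + ‖ξ‖) ^ l * ‖hat v ξ‖) volume :=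
    (Continuous.aestronglyMeasurable (by fun_prop)).mul (aestronglyMeasurable_hat v).norm
  have hle : ∀ ξ : Sp N,
      |(1 + ‖ξ‖) ^ l * ‖hat v ξ‖| ≤ 1 * ((1 + ‖ξ‖) ^ k * ‖hat v ξ‖) := fun ξ => by
    rw [abs_of_nonneg (by positivity), one_mul]
    gcongr
    exact le_add_of_nonneg_right (norm_nonneg ξ)
  exact ⟨hv.contDiff.of_le (mod_cast h), hv.isL2, hv.integrable_of_le hmeas hle,
    hv.memLp_of_le hmeas hle⟩

lemma integrable_hat (hv : HasMoments k v) : Integrable (hat v) := by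
  refine (integrable_norm_iff (aestronglyMeasurable_hat v)).1 ?_
  simpa only [pow_zero, one_mul] using (hv.mono k.zero_le).integrable

lemma complexify_eq_fourierInv (hv : HasMoments k v) : complexify v = 𝓕⁻ (hat v) :=
  MHD.complexify_eq_fourierInv hv.contDiff.continuous hv.isL2 hv.integrable_hat

lemma norm_le (hv : HasMoments k v) (x : Sp N) : ‖v x‖ ≤ ∫ ξ, ‖hat v ξ‖ := by
  rw [← norm_complexify, hv.complexify_eq_fourierInv]
  exact norm_fourierInv_le _ x

lemma memLp_two (hv : HasMoments k v) : MemLp v 2 volume := isL2_iff.1 hv.isL2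

lemma integrable_memLp_derivSymbol (hv : HasMoments (k + 1) v) (j : Fin N) :
    Integrable (fun ξ => (1 + ‖ξ‖) ^ k * ‖derivSymbol j ξ • hat v ξ‖) ∧
      MemLp (fun ξ => (1 + ‖ξ‖) ^ k * ‖derivSymbol j ξ • hat v ξ‖) 2 volume := by
  have hmeas : AEStronglyMeasurable
      (fun ξ => (1 + ‖ξ‖) ^ k * ‖derivSymbol j ξ • hat v ξ‖) volume :=
    (Continuous.aestronglyMeasurable (by fun_prop)).mul
      ((continuous_derivSymbol j).aestronglyMeasurable.smul (aestronglyMeasurable_hat v)).norm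
  have hle : ∀ ξ : Sp N, |(1 + ‖ξ‖) ^ k * ‖derivSymbol j ξ • hat v ξ‖| ≤
      2 * Real.pi * ((1 + ‖ξ‖) ^ (k + 1) * ‖hat v ξ‖) := fun ξ => by
    have hsymbol : ‖derivSymbol j ξ‖ ≤ 2 * Real.pi * (1 + ‖ξ‖) := by
      refine (norm_derivSymbol_le j ξ).trans ?_
      gcongr
      exact le_add_of_nonneg_left zero_le_one
    rw [abs_of_nonneg (by positivity), norm_smul]
    calc (1 + ‖ξ‖) ^ k * (‖derivSymbol j ξ‖ * ‖hat v ξ‖)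
        ≤ (1 + ‖ξ‖) ^ k * (2 * Real.pi * (1 + ‖ξ‖) * ‖hat v ξ‖) := by gcongr
      _ = 2 * Real.pi * ((1 + ‖ξ‖) ^ (k + 1) * ‖hat v ξ‖) := by ring
  exact ⟨hv.integrable_of_le hmeas hle, hv.memLp_of_le hmeas hle⟩

lemma isL2_and_hat_partialDeriv (hv : HasMoments 1 v) (j : Fin N) :
    IsL2 (MHD.partialDeriv j v) ∧
      hat (MHD.partialDeriv j v) =ᵐ[volume] fun ξ => derivSymbol j ξ • hat v ξ := by
  have hmeas : AEStronglyMeasurable (fun ξ => derivSymbol j ξ • hat v ξ) volume :=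
    (continuous_derivSymbol j).aestronglyMeasurable.smul (aestronglyMeasurable_hat v)
  have hmoment : Integrable fun ξ => ‖ξ‖ * ‖hat v ξ‖ :=
    hv.integrable_of_le (C := 1) (continuous_norm.aestronglyMeasurable.mul
      (aestronglyMeasurable_hat v).norm) fun ξ => by
        rw [abs_of_nonneg (by positivity), one_mul, pow_one]
        gcongr
        exact le_add_of_nonneg_left zero_le_one
  obtain ⟨hint, hmem⟩ := hv.integrable_memLp_derivSymbol j
  simp only [pow_zero, one_mul] at hint hmem
  refine isL2_and_hat_ae_eq_of_eq_fourierInv ((integrable_norm_iff hmeas).1 hint)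
    ((memLp_norm_iff hmeas).1 hmem) (funext fun x => ?_)
  rw [complexify_partialDeriv (hv.contDiff.differentiable one_ne_zero),
    hv.complexify_eq_fourierInv, fderiv_fourierInv_apply hv.integrable_hat hmoment]
  simp only [derivSymbol, basisVec, EuclideanSpace.inner_single_right, one_mul, conj_trivial]

lemma hat_partialDeriv (hv : HasMoments (k + 1) v) (j : Fin N) :
    hat (MHD.partialDeriv j v) =ᵐ[volume] fun ξ => derivSymbol j ξ • hat v ξ :=
  ((hv.mono (Nat.le_add_left 1 k)).isL2_and_hat_partialDeriv j).2

lemma partialDeriv (hv : HasMoments (k + 1) v) (j : Fin N) :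
    HasMoments k (partialDeriv j v) := by
  have hae : (fun ξ => (1 + ‖ξ‖) ^ k * ‖derivSymbol j ξ • hat v ξ‖) =ᵐ[volume]
      fun ξ => (1 + ‖ξ‖) ^ k * ‖hat (MHD.partialDeriv j v) ξ‖ := by
    filter_upwards [hv.hat_partialDeriv j] with ξ hξ
    rw [hξ]
  obtain ⟨hint, hmem⟩ := hv.integrable_memLp_derivSymbol j
  have hfderiv : ContDiff ℝ k (fderiv ℝ v) := hv.contDiff.fderiv_right (by norm_cast)
  exact ⟨hfderiv.clm_apply contDiff_const,
    ((hv.mono (Nat.le_add_left 1 k)).isL2_and_hat_partialDeriv j).1,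
    (integrable_congr hae).1 hint, (memLp_congr_ae hae).1 hmem⟩

end HasMoments

end Fields

section Physical

variable {N : ℕ}

lemma inner_toL2 {v w : Sp N → Sp N} (hv : IsL2 v) (hw : IsL2 w) :
    ⟪toL2 v, toL2 w⟫_ℂ = ((∫ x, ⟪v x, w x⟫_ℝ : ℝ) : ℂ) := by
  rw [L2.inner_def, ← integral_complex_ofReal]
  refine integral_congr_ae ?_
  filter_upwards [coeFn_toL2 hv, coeFn_toL2 hw] with x hvx hwx
  rw [hvx, hwx, inner_complexify]

lemma integrable_inner_of_memLp {v w : Sp N → Sp N} (hv : MemLp v 2 volume)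
    (hw : MemLp w 2 volume) : Integrable fun x => ⟪v x, w x⟫_ℝ := by
  refine (integrable_congr ?_).1 (L2.integrable_inner (𝕜 := ℝ) (hv.toLp v) (hw.toLp w))
  filter_upwards [hv.coeFn_toLp, hw.coeFn_toLp] with x hvx hwx
  rw [hvx, hwx]

lemma integral_inner_partialDeriv {f z : Sp N → Sp N} (hf : Differentiable ℝ f)
    (hz : Differentiable ℝ z) (k : Fin N) (hf2 : MemLp f 2 volume) (hz2 : MemLp z 2 volume)
    (hf' : MemLp (partialDeriv k f) 2 volume) (hz' : MemLp (partialDeriv k z) 2 volume) :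
    ∫ x, ⟪f x, partialDeriv k z x⟫_ℝ = -∫ x, ⟪partialDeriv k f x, z x⟫_ℝ :=
  integral_bilinear_fderiv_right_eq_neg_left_of_integrable (B := innerSL ℝ)
    (integrable_inner_of_memLp hf' hz2) (integrable_inner_of_memLp hf2 hz')
    (integrable_inner_of_memLp hf2 hz2) (fun x _ => hf x) (fun x _ => hz x)

lemma sum_smul_basisVec (y : Sp N) : ∑ j, y j • basisVec j = y := by
  simpa [basisVec] using (EuclideanSpace.basisFun (Fin N) ℝ).sum_repr y

lemma convect_eq_sum (v w : Sp N → Sp N) (x : Sp N) :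
    convect v w x = ∑ j, v x j • partialDeriv j w x := by
  conv_lhs => rw [convect, ← sum_smul_basisVec (v x)]
  simp only [map_sum, map_smul, partialDeriv]

/-- The pointwise Hilbert–Schmidt norm `|∇ w|(x)`. -/
noncomputable def gradNorm (w : Sp N → Sp N) (x : Sp N) : ℝ := √(∑ k, ‖partialDeriv k w x‖ ^ 2)

lemma gradNorm_nonneg (w : Sp N → Sp N) (x : Sp N) : 0 ≤ gradNorm w x := Real.sqrt_nonneg _

lemma gradNorm_sq (w : Sp N → Sp N) (x : Sp N) :
    gradNorm w x ^ 2 = ∑ k, ‖partialDeriv k w x‖ ^ 2 :=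
  Real.sq_sqrt (Finset.sum_nonneg fun _ _ => sq_nonneg _)

lemma norm_convect_le (v w : Sp N → Sp N) (x : Sp N) :
    ‖convect v w x‖ ≤ ‖v x‖ * gradNorm w x := by
  rw [convect_eq_sum]
  calc ‖∑ j, v x j • partialDeriv j w x‖
      ≤ ∑ j, ‖v x j‖ * ‖partialDeriv j w x‖ :=
        (norm_sum_le _ _).trans (Finset.sum_le_sum fun j _ => (norm_smul _ _).le)
    _ ≤ √(∑ j, ‖v x j‖ ^ 2) * √(∑ j, ‖partialDeriv j w x‖ ^ 2) :=
        Real.sum_mul_le_sqrt_mul_sqrt _ _ _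
    _ = ‖v x‖ * gradNorm w x := by rw [EuclideanSpace.norm_eq, gradNorm]

lemma contDiff_convect {n : WithTop ℕ∞} {v w : Sp N → Sp N} (hv : ContDiff ℝ n v)
    (hw : ContDiff ℝ (n + 1) w) : ContDiff ℝ n (convect v w) :=
  (hw.fderiv_right le_rfl).clm_apply hv

lemma partialDeriv_smul_coord {v c : Sp N → Sp N} (hv : Differentiable ℝ v)
    (hc : Differentiable ℝ c) (j : Fin N) (x : Sp N) :
    partialDeriv j (fun y => v y j • c y) x =
      v x j • partialDeriv j c x + partialDeriv j v x j • c x := by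
  have hcoord := (EuclideanSpace.proj (𝕜 := ℝ) j).hasFDerivAt.comp x (hv x).hasFDerivAt
  have hprod : fderiv ℝ (fun y => v y j • c y) x = _ := (hcoord.smul (hc x).hasFDerivAt).fderiv
  rw [partialDeriv, hprod]
  simp [partialDeriv]

lemma convect_eq_sum_partialDeriv_of_div_eq_zero {v c : Sp N → Sp N} (hv : Differentiable ℝ v)
    (hdiv : ∀ x, div v x = 0) (hc : Differentiable ℝ c) (x : Sp N) :
    convect v c x = ∑ j, partialDeriv j (fun y => v y j • c y) x := by
  simp only [partialDeriv_smul_coord hv hc, Finset.sum_add_distrib, ← Finset.sum_smul]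
  rw [show ∑ j, partialDeriv j v x j = 0 from hdiv x, zero_smul, add_zero, convect_eq_sum]

lemma partialDeriv_convect {v w : Sp N → Sp N} (hv : Differentiable ℝ v) (hw : ContDiff ℝ 2 w)
    (k : Fin N) (x : Sp N) : partialDeriv k (convect v w) x =
      convect (partialDeriv k v) w x + convect v (partialDeriv k w) x := by
  have hw' : ContDiff ℝ 1 (fderiv ℝ w) := hw.fderiv_right (by norm_num)
  have hww : HasFDerivAt (fderiv ℝ w) (fderiv ℝ (fderiv ℝ w) x) x :=
    (hw'.differentiable one_ne_zero x).hasFDerivAt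
  have hsymm : IsSymmSndFDerivAt ℝ w x := hw.contDiffAt.isSymmSndFDerivAt (by simp)
  have hconvect : fderiv ℝ (convect v w) x = _ := (hww.clm_apply (hv x).hasFDerivAt).fderiv
  have hpartial : fderiv ℝ (partialDeriv k w) x = _ :=
    (hww.clm_apply (hasFDerivAt_const (basisVec k) x)).fderiv
  rw [partialDeriv, hconvect, convect, convect, hpartial]
  simp [hsymm.eq (basisVec k) (v x), partialDeriv]

/-- The componentwise Laplacian of a vector field. -/
noncomputable def lap (w : Sp N → Sp N) (x : Sp N) : Sp N :=
  ∑ k, partialDeriv k (partialDeriv k w) x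

/-- The density `∑ₖ ((∂ₖ v · ∇) w) · ∂ₖ z` of the part of `-∫ (v · ∇) w · Δ z` in which a derivative
falls on `v`. -/
noncomputable def stretch (v w z : Sp N → Sp N) (x : Sp N) : ℝ :=
  ∑ k, ⟪convect (partialDeriv k v) w x, partialDeriv k z x⟫_ℝ

/-- The part `∑ₖ ∫ ((v · ∇) ∂ₖ w) · ∂ₖ z` of `-∫ (v · ∇) w · Δ z` in which all derivatives fall on
`w` and `z`. -/
noncomputable def transport (v w z : Sp N → Sp N) : ℝ :=
  ∑ k, ∫ x, ⟪convect v (partialDeriv k w) x, partialDeriv k z x⟫_ℝ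

/-- `‖∇ v‖²_{L²}` as a real number. -/
noncomputable def gradSq (v : Sp N → Sp N) : ℝ := ∫ x, gradNorm v x ^ 2

lemma gradSq_nonneg (v : Sp N → Sp N) : 0 ≤ gradSq v := integral_nonneg fun _ => sq_nonneg _

/-- The contribution of the nonlinear terms to the time derivative of `(‖∇ u‖² + ‖∇ b‖²) / 2`. -/
noncomputable def nonlinearGradPower (u b : Sp N → Sp N) : ℝ :=
  (∫ x, ⟪convect u u x, lap u x⟫_ℝ) - (∫ x, ⟪convect b b x, lap u x⟫_ℝ)
    + (∫ x, ⟪convect u b x, lap b x⟫_ℝ) - ∫ x, ⟪convect b u x, lap b x⟫_ℝ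

lemma abs_stretch_le (v w z : Sp N → Sp N) (x : Sp N) :
    |stretch v w z x| ≤ gradNorm v x * gradNorm w x * gradNorm z x := by
  calc |stretch v w z x|
      ≤ ∑ k, ‖convect (partialDeriv k v) w x‖ * ‖partialDeriv k z x‖ :=
        (Finset.abs_sum_le_sum_abs _ _).trans
          (Finset.sum_le_sum fun k _ => abs_real_inner_le_norm _ _)
    _ ≤ ∑ k, ‖partialDeriv k v x‖ * gradNorm w x * ‖partialDeriv k z x‖ := by
        gcongr
        exact norm_convect_le _ _ _
    _ = (∑ k, ‖partialDeriv k v x‖ * ‖partialDeriv k z x‖) * gradNorm w x := by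
        rw [Finset.sum_mul]
        exact Finset.sum_congr rfl fun k _ => by ring
    _ ≤ gradNorm v x * gradNorm z x * gradNorm w x := by
        gcongr
        · exact gradNorm_nonneg _ _
        · exact Real.sum_mul_le_sqrt_mul_sqrt _ _ _
    _ = gradNorm v x * gradNorm w x * gradNorm z x := by ring

namespace HasMoments

variable {k l : ℕ} {u v w z b : Sp N → Sp N}

lemma differentiable (hv : HasMoments (k + 1) v) : Differentiable ℝ v :=
  hv.contDiff.differentiable (by norm_cast)

lemma memLp_partialDeriv (hv : HasMoments (k + 1) v) (j : Fin N) :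
    MemLp (MHD.partialDeriv j v) 2 volume :=
  (hv.partialDeriv j).memLp_two

lemma memLp_gradNorm (hw : HasMoments (k + 1) w) : MemLp (gradNorm w) 2 volume := by
  have hcont : Continuous (gradNorm w) := Real.continuous_sqrt.comp
    (continuous_finsetSum _ fun j _ => (hw.partialDeriv j).contDiff.continuous.norm.pow 2)
  refine MemLp.mono (g := fun x => ∑ j, ‖MHD.partialDeriv j w x‖)
    (memLp_finsetSum _ fun (j : Fin N) _ => (hw.memLp_partialDeriv j).norm)
    hcont.aestronglyMeasurable (.of_forall fun x => ?_)
  rw [Real.norm_of_nonneg (gradNorm_nonneg _ _), Real.norm_of_nonneg (by positivity)]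
  exact Real.sqrt_le_iff.2
    ⟨by positivity, Finset.sum_sq_le_sq_sum_of_nonneg fun _ _ => norm_nonneg _⟩

lemma memLp_convect (hv : HasMoments k v) (hw : HasMoments (l + 1) w) :
    MemLp (convect v w) 2 volume := by
  have hcont : Continuous (convect v w) :=
    (contDiff_convect (hv.mono k.zero_le).contDiff
      (by simpa using (hw.mono (Nat.le_add_left 1 l)).contDiff)).continuous
  refine (hw.memLp_gradNorm.const_mul (∫ ξ, ‖hat v ξ‖)).mono hcont.aestronglyMeasurable
    (.of_forall fun x => (norm_convect_le v w x).trans (le_trans ?_ (le_abs_self _)))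
  exact mul_le_mul_of_nonneg_right (hv.norm_le x) (gradNorm_nonneg _ _)

lemma isL2_convect (hv : HasMoments k v) (hw : HasMoments (l + 1) w) : IsL2 (convect v w) :=
  isL2_iff.2 (hv.memLp_convect hw)

lemma memLp_coord_smul (hv : HasMoments k v) {c : Sp N → Sp N} (hc : MemLp c 2 volume)
    (j : Fin N) : MemLp (fun x => v x j • c x) 2 volume := by
  have hcoord : Continuous fun x => v x j :=
    (EuclideanSpace.proj (𝕜 := ℝ) j).continuous.comp hv.contDiff.continuous
  refine hc.of_le_mul (c := ∫ ξ, ‖hat v ξ‖) (hcoord.aestronglyMeasurable.smul hc.1)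
    (.of_forall fun x => ?_)
  rw [norm_smul]
  gcongr
  exact (PiLp.norm_apply_le (v x) j).trans (hv.norm_le x)

lemma integral_inner_convect (hv : HasMoments 1 v) (hdiv : ∀ x, div v x = 0)
    (hw : HasMoments 1 w) (hz : HasMoments 1 z) :
    ∫ x, ⟪w x, convect v z x⟫_ℝ = -∫ x, ⟪convect v w x, z x⟫_ℝ := by
  have hflux : ∀ j, MemLp (MHD.partialDeriv j fun y => v y j • z y) 2 volume := fun j => by
    rw [funext (partialDeriv_smul_coord hv.differentiable hz.differentiable j)]
    exact (hv.memLp_coord_smul (hz.memLp_partialDeriv j) j).add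
      ((hv.partialDeriv j).memLp_coord_smul hz.memLp_two j)
  have hparts : ∀ j, ∫ x, ⟪w x, MHD.partialDeriv j (fun y => v y j • z y) x⟫_ℝ =
      -∫ x, ⟪MHD.partialDeriv j w x, v x j • z x⟫_ℝ := fun j => by
    have hcoord : Differentiable ℝ fun x => v x j :=
      (EuclideanSpace.proj (𝕜 := ℝ) j).differentiable.comp hv.differentiable
    exact integral_inner_partialDeriv hw.differentiable (hcoord.smul hz.differentiable) j
      hw.memLp_two (hv.memLp_coord_smul hz.memLp_two j) (hw.memLp_partialDeriv j) (hflux j)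
  calc ∫ x, ⟪w x, convect v z x⟫_ℝ
      = ∑ j, ∫ x, ⟪w x, MHD.partialDeriv j (fun y => v y j • z y) x⟫_ℝ := by
        rw [← integral_finsetSum _ fun j _ => integrable_inner_of_memLp hw.memLp_two (hflux j)]
        simp only [convect_eq_sum_partialDeriv_of_div_eq_zero hv.differentiable hdiv
          hz.differentiable, inner_sum]
    _ = -∑ j, ∫ x, ⟪MHD.partialDeriv j w x, v x j • z x⟫_ℝ := by
        simp only [hparts, Finset.sum_neg_distrib]
    _ = -∫ x, ⟪convect v w x, z x⟫_ℝ := by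
        rw [← integral_finsetSum _ fun j _ => integrable_inner_of_memLp
          (hw.memLp_partialDeriv j) (hv.memLp_coord_smul hz.memLp_two j)]
        simp only [convect_eq_sum, sum_inner, inner_smul_left, inner_smul_right, conj_trivial]

lemma memLp_lap (hw : HasMoments 2 w) : MemLp (lap w) 2 volume :=
  memLp_finsetSum _ fun k _ => ((hw.partialDeriv k).partialDeriv k).memLp_two

lemma isL2_lap (hw : HasMoments 2 w) : IsL2 (lap w) := isL2_iff.2 hw.memLp_lap

lemma integral_inner_lap (hz : HasMoments 2 z) {f : Sp N → Sp N} (hf : Differentiable ℝ f)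
    (hf2 : MemLp f 2 volume) (hf' : ∀ k, MemLp (MHD.partialDeriv k f) 2 volume) :
    ∫ x, ⟪f x, lap z x⟫_ℝ =
      -∑ k, ∫ x, ⟪MHD.partialDeriv k f x, MHD.partialDeriv k z x⟫_ℝ := by
  simp only [lap, inner_sum]
  rw [integral_finsetSum _ fun k _ => integrable_inner_of_memLp hf2
    ((hz.partialDeriv k).memLp_partialDeriv k), ← Finset.sum_neg_distrib]
  exact Finset.sum_congr rfl fun k _ => integral_inner_partialDeriv hf
    (hz.partialDeriv k).differentiable k hf2 (hz.memLp_partialDeriv k) (hf' k)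
    ((hz.partialDeriv k).memLp_partialDeriv k)

lemma integral_convect_lap (hv : HasMoments 2 v) (hw : HasMoments 2 w) (hz : HasMoments 2 z) :
    ∫ x, ⟪convect v w x, lap z x⟫_ℝ = -(∫ x, stretch v w z x) - transport v w z := by
  have hstretch : ∀ k, MemLp (convect (MHD.partialDeriv k v) w) 2 volume := fun k =>
    (hv.partialDeriv k).memLp_convect hw
  have htransport : ∀ k, MemLp (convect v (MHD.partialDeriv k w)) 2 volume := fun k =>
    hv.memLp_convect (hw.partialDeriv k)
  have hleibniz : ∀ k, MHD.partialDeriv k (convect v w) =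
      convect (MHD.partialDeriv k v) w + convect v (MHD.partialDeriv k w) := fun k =>
    funext (partialDeriv_convect hv.differentiable hw.contDiff k)
  have hdiff : Differentiable ℝ (convect v w) :=
    (contDiff_convect (hv.mono one_le_two).contDiff
      (by simpa [one_add_one_eq_two] using hw.contDiff)).differentiable one_ne_zero
  rw [hz.integral_inner_lap hdiff (hv.memLp_convect hw)
    fun k => hleibniz k ▸ (hstretch k).add (htransport k)]
  simp only [stretch, transport]
  rw [integral_finsetSum _ fun k _ => integrable_inner_of_memLp (hstretch k)
    (hz.memLp_partialDeriv k), ← neg_add', ← Finset.sum_add_distrib]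
  refine congrArg Neg.neg (Finset.sum_congr rfl fun k _ => ?_)
  rw [← integral_add (integrable_inner_of_memLp (hstretch k) (hz.memLp_partialDeriv k))
    (integrable_inner_of_memLp (htransport k) (hz.memLp_partialDeriv k))]
  simp only [hleibniz, Pi.add_apply, inner_add_left]

lemma transport_add_transport_eq_zero (hv : HasMoments 1 v) (hdiv : ∀ x, div v x = 0)
    (hw : HasMoments 2 w) (hz : HasMoments 2 z) : transport v w z + transport v z w = 0 := by
  rw [transport, transport, ← Finset.sum_add_distrib]
  refine Finset.sum_eq_zero fun k _ => ?_
  have hskew := hv.integral_inner_convect hdiv (hw.partialDeriv k) (hz.partialDeriv k)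
  simp only [real_inner_comm (convect v (MHD.partialDeriv k z) _)] at hskew ⊢
  rw [hskew, add_neg_cancel]

lemma abs_integral_le_of_abs_le (hv : HasMoments 1 v) {f : Sp N → ℝ} {B : ℝ}
    (hf : ∀ x, |f x| ≤ B * gradNorm v x ^ 2) : |∫ x, f x| ≤ B * gradSq v := by
  rw [gradSq, ← integral_const_mul]
  exact norm_integral_le_of_norm_le (f := f) (hv.memLp_gradNorm.integrable_sq.const_mul B)
    (.of_forall hf)

lemma nonlinearGradPower_eq (hu : HasMoments 2 u) (hb : HasMoments 2 b)
    (hdu : ∀ x, div u x = 0) (hdb : ∀ x, div b x = 0) :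
    nonlinearGradPower u b = -(∫ x, stretch u u u x) + (∫ x, stretch b b u x)
      - (∫ x, stretch u b b x) + ∫ x, stretch b u b x := by
  rw [nonlinearGradPower, hu.integral_convect_lap hu hu, hb.integral_convect_lap hb hu,
    hu.integral_convect_lap hb hb, hb.integral_convect_lap hu hb]
  linarith [(hu.mono one_le_two).transport_add_transport_eq_zero hdu hu hu,
    (hb.mono one_le_two).transport_add_transport_eq_zero hdb hb hu,
    (hu.mono one_le_two).transport_add_transport_eq_zero hdu hb hb]

lemma abs_nonlinearGradPower_le (hu : HasMoments 2 u) (hb : HasMoments 2 b)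
    (hdu : ∀ x, div u x = 0) (hdb : ∀ x, div b x = 0) {B : ℝ} (hB : ∀ x, gradNorm u x ≤ B) :
    |nonlinearGradPower u b| ≤ 3 * B * (gradSq u + gradSq b) := by
  have hB' : ∀ (y : Sp N → Sp N) (x : Sp N),
      gradNorm u x * gradNorm y x ^ 2 ≤ B * gradNorm y x ^ 2 := fun y x =>
    mul_le_mul_of_nonneg_right (hB x) (sq_nonneg _)
  have huuu : |∫ x, stretch u u u x| ≤ B * gradSq u :=
    (hu.mono one_le_two).abs_integral_le_of_abs_le fun x =>
      (abs_stretch_le _ _ _ x).trans ((hB' u x).trans' (by linarith))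
  have hbbu : |∫ x, stretch b b u x| ≤ B * gradSq b :=
    (hb.mono one_le_two).abs_integral_le_of_abs_le fun x =>
      (abs_stretch_le _ _ _ x).trans ((hB' b x).trans' (by linarith))
  have hubb : |∫ x, stretch u b b x| ≤ B * gradSq b :=
    (hb.mono one_le_two).abs_integral_le_of_abs_le fun x =>
      (abs_stretch_le _ _ _ x).trans ((hB' b x).trans' (by linarith))
  have hbub : |∫ x, stretch b u b x| ≤ B * gradSq b :=
    (hb.mono one_le_two).abs_integral_le_of_abs_le fun x =>
      (abs_stretch_le _ _ _ x).trans ((hB' b x).trans' (by linarith))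
  have hpos : 0 ≤ B * gradSq u := (abs_nonneg _).trans huuu
  rw [hu.nonlinearGradPower_eq hb hdu hdb]
  rw [abs_le] at *
  constructor <;> linarith [huuu.1, huuu.2, hbbu.1, hbbu.2, hubb.1, hubb.2, hbub.1, hbub.2]

end HasMoments

end Physical

section Pressure

section Cutoff

variable {E : Type*} [NormedAddCommGroup E] [InnerProductSpace ℝ E] [FiniteDimensional ℝ E]

/-- Complex valued smooth cut-offs which exhaust the space and whose gradients tend to `0`
uniformly. -/
noncomputable def cutoff (n : ℕ) (x : E) : ℂ :=
  ((⟨1, 2, one_pos, one_lt_two⟩ : ContDiffBump (0 : E)) ((n + 1 : ℝ)⁻¹ • x) : ℝ)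

lemma contDiff_cutoff (n : ℕ) : ContDiff ℝ 2 (cutoff n : E → ℂ) :=
  Complex.ofRealCLM.contDiff.comp ((ContDiffBump.contDiff _).comp (contDiff_const_smul _))

lemma differentiable_cutoff (n : ℕ) : Differentiable ℝ (cutoff n : E → ℂ) :=
  (contDiff_cutoff n).differentiable two_ne_zero

lemma hasCompactSupport_cutoff (n : ℕ) : HasCompactSupport (cutoff n : E → ℂ) :=
  ((ContDiffBump.hasCompactSupport _).comp_left (g := Complex.ofReal)
    Complex.ofReal_zero).comp_homeomorph
      (Homeomorph.smulOfNeZero ((n + 1 : ℝ)⁻¹) (by positivity))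

lemma norm_cutoff_le_one (n : ℕ) (x : E) : ‖cutoff n x‖ ≤ 1 := by
  rw [cutoff, Complex.norm_real, Real.norm_of_nonneg (ContDiffBump.nonneg _)]
  exact ContDiffBump.le_one _

lemma tendsto_inv_natCast_add_one : Tendsto (fun n : ℕ => (n + 1 : ℝ)⁻¹) atTop (𝓝 0) := by
  simpa only [one_div] using tendsto_one_div_add_atTop_nhds_zero_nat (𝕜 := ℝ)

lemma tendsto_cutoff (x : E) : Tendsto (fun n => cutoff n x) atTop (𝓝 1) := by
  have hscale : Tendsto (fun n : ℕ => (n + 1 : ℝ)⁻¹ • x) atTop (𝓝 0) := by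
    simpa only [zero_smul] using tendsto_inv_natCast_add_one.smul_const x
  refine tendsto_nhds_of_eventually_eq
    ((hscale.eventually (Metric.closedBall_mem_nhds 0 one_pos)).mono fun n hn => ?_)
  rw [cutoff, ContDiffBump.one_of_mem_closedBall _ hn, Complex.ofReal_one]

variable (E) in
lemma exists_norm_fderiv_cutoff_le :
    ∃ C : ℝ, ∀ (n : ℕ) (x : E), ‖fderiv ℝ (cutoff n) x‖ ≤ (n + 1 : ℝ)⁻¹ * C := by
  have hcutoff : ∀ n, (cutoff n : E → ℂ) = fun x => cutoff 0 ((n + 1 : ℝ)⁻¹ • x) := fun n => by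
    ext x
    simp [cutoff]
  obtain ⟨C, hC⟩ := ((hasCompactSupport_cutoff (E := E) 0).fderiv ℝ).exists_bound_of_continuous
    ((contDiff_cutoff 0).continuous_fderiv two_ne_zero)
  refine ⟨C, fun n x => ?_⟩
  rw [hcutoff, fderiv_comp_smul, norm_smul, Real.norm_of_nonneg (by positivity)]
  gcongr
  exact hC _

variable [MeasurableSpace E] [BorelSpace E]

lemma integral_fderiv_mul_fderiv_symm_of_hasCompactSupport {φ p : E → ℂ} (hφ : ContDiff ℝ 2 φ)
    (hc : HasCompactSupport φ) (hp : ContDiff ℝ 1 p) (y z : E) :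
    ∫ x, fderiv ℝ φ x y * fderiv ℝ p x z = ∫ x, fderiv ℝ φ x z * fderiv ℝ p x y := by
  have hφ' : ContDiff ℝ 1 (fderiv ℝ φ) := hφ.fderiv_right (by norm_num)
  have hparts : ∀ y z, ∫ x, fderiv ℝ φ x y * fderiv ℝ p x z =
      -∫ x, fderiv ℝ (fun x => fderiv ℝ φ x y) x z * p x := fun y z => by
    have hφy : ContDiff ℝ 1 fun x => fderiv ℝ φ x y := hφ'.clm_apply contDiff_const
    have hcy : HasCompactSupport fun x => fderiv ℝ φ x y := hc.fderiv_apply ℝ y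
    have hpz : Continuous fun x => fderiv ℝ p x z :=
      (hp.continuous_fderiv one_ne_zero).clm_apply continuous_const
    have hφyz : Continuous fun x => fderiv ℝ (fun x => fderiv ℝ φ x y) x z :=
      (hφy.continuous_fderiv one_ne_zero).clm_apply continuous_const
    exact integral_mul_fderiv_eq_neg_fderiv_mul_of_integrable
      ((hφyz.mul hp.continuous).integrable_of_hasCompactSupport (hcy.fderiv_apply ℝ z).mul_right)
      ((hφy.continuous.mul hpz).integrable_of_hasCompactSupport hcy.mul_right)
      ((hφy.continuous.mul hp.continuous).integrable_of_hasCompactSupport hcy.mul_right)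
      (fun x _ => hφy.differentiable one_ne_zero x) fun x _ => hp.differentiable one_ne_zero x
  have hsecond : ∀ x y z, fderiv ℝ (fun x => fderiv ℝ φ x y) x z =
      fderiv ℝ (fderiv ℝ φ) x z y := fun x y z => by
    have h : fderiv ℝ (fun x => fderiv ℝ φ x y) x = _ :=
      ((hφ'.differentiable one_ne_zero x).hasFDerivAt.clm_apply (hasFDerivAt_const y x)).fderiv
    simp [h]
  simp only [hparts, hsecond, fun x => (hφ.contDiffAt.isSymmSndFDerivAt (x := x) (by simp)).eq y z]

/-- `p` itself need not be integrable in any sense, so that the integrations by parts are performed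
under a cut-off of `φ`. -/
lemma integral_fderiv_mul_fderiv_symm {φ p : E → ℂ} (hφ : ContDiff ℝ 2 φ)
    (hp : ContDiff ℝ 1 p) (hφ2 : MemLp φ 2 volume)
    (hφ' : ∀ y, MemLp (fun x => fderiv ℝ φ x y) 2 volume)
    (hp' : ∀ y, MemLp (fun x => fderiv ℝ p x y) 2 volume) (y z : E) :
    ∫ x, fderiv ℝ φ x y * fderiv ℝ p x z = ∫ x, fderiv ℝ φ x z * fderiv ℝ p x y := by
  obtain ⟨C, hC⟩ := exists_norm_fderiv_cutoff_le E
  have hfderiv : ∀ n x w, fderiv ℝ (fun x => cutoff n x * φ x) x w =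
      cutoff n x * fderiv ℝ φ x w + φ x * fderiv ℝ (cutoff n) x w := fun n x w => by
    rw [fderiv_fun_mul (differentiable_cutoff n x) (hφ.differentiable two_ne_zero x)]
    rfl
  have hgrad : ∀ n x w, ‖fderiv ℝ (cutoff n) x w‖ ≤ (n + 1 : ℝ)⁻¹ * (C * ‖w‖) := fun n x w => by
    rw [← mul_assoc]
    exact (fderiv ℝ (cutoff n) x).le_of_opNorm_le (hC n x) w
  have hC0 : 0 ≤ C := by simpa using (norm_nonneg _).trans (hC 0 0)
  have hgrad0 : ∀ x w, Tendsto (fun n => fderiv ℝ (cutoff n) x w) atTop (𝓝 0) := fun x w => by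
    refine squeeze_zero_norm (hgrad · x w) ?_
    simpa only [zero_mul] using tendsto_inv_natCast_add_one.mul_const (C * ‖w‖)
  have hlim : ∀ y z, Tendsto
      (fun n => ∫ x, fderiv ℝ (fun x => cutoff n x * φ x) x y * fderiv ℝ p x z) atTop
      (𝓝 (∫ x, fderiv ℝ φ x y * fderiv ℝ p x z)) := fun y z => by
    refine tendsto_integral_of_dominated_convergence
      (fun x => ‖fderiv ℝ φ x y * fderiv ℝ p x z‖ + C * ‖y‖ * ‖φ x * fderiv ℝ p x z‖)
      (fun n => ?_) (((hφ' y).integrable_mul (hp' z)).norm.add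
        ((hφ2.integrable_mul (hp' z)).norm.const_mul _))
      (fun n => .of_forall fun x => ?_) (.of_forall fun x => ?_)
    · exact (((((contDiff_cutoff n).mul hφ).continuous_fderiv two_ne_zero).clm_apply
        continuous_const).mul ((hp.continuous_fderiv one_ne_zero).clm_apply
          continuous_const)).aestronglyMeasurable
    · have hn : ‖fderiv ℝ (cutoff n) x y‖ ≤ C * ‖y‖ := (hgrad n x y).trans
        (mul_le_of_le_one_left (by positivity) (inv_le_one_of_one_le₀ (by simp)))
      rw [hfderiv, add_mul, mul_assoc, mul_comm (φ x), mul_assoc]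
      refine (norm_add_le _ _).trans ?_
      rw [norm_mul, norm_mul (fderiv ℝ (cutoff n) x y)]
      gcongr
      exact mul_le_of_le_one_left (norm_nonneg _) (norm_cutoff_le_one n x)
    · simp only [hfderiv]
      simpa using (((tendsto_cutoff x).mul_const (fderiv ℝ φ x y)).add
        ((hgrad0 x y).const_mul (φ x))).mul_const (fderiv ℝ p x z)
  refine tendsto_nhds_unique (hlim y z) ((hlim z y).congr fun n => ?_)
  exact integral_fderiv_mul_fderiv_symm_of_hasCompactSupport ((contDiff_cutoff n).mul hφ)
    (hasCompactSupport_cutoff n).mul_right hp z y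

lemma ae_eq_zero_of_integral_schwartz {f : E → ℂ} (hf : LocallyIntegrable f)
    (h : ∀ ψ : 𝓢(E, ℂ), ∫ x, ψ x * f x = 0) : f =ᵐ[volume] 0 := by
  refine ae_eq_zero_of_integral_contDiff_smul_eq_zero hf fun g hg hgc => ?_
  have hgc' : HasCompactSupport (Complex.ofRealCLM ∘ g) := hgc.comp_left rfl
  simpa using h (hgc'.toSchwartzMap (Complex.ofRealCLM.contDiff.comp hg))

end Cutoff

variable {N : ℕ}

lemma memLp_hat_apply (v : Sp N → Sp N) (i : Fin N) : MemLp (fun ξ => hat v ξ i) 2 volume :=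
  (Lp.memLp _).continuousLinearMap_comp (EuclideanSpace.proj (𝕜 := ℂ) i)

lemma memLp_ofReal_apply {v : Sp N → Sp N} (hv : IsL2 v) (i : Fin N) :
    MemLp (fun x => ((v x i : ℝ) : ℂ)) 2 volume :=
  hv.continuousLinearMap_comp (EuclideanSpace.proj (𝕜 := ℂ) i)

lemma integrable_schwartz_mul {f : Sp N → ℂ} (hf : MemLp f 2 volume) (ψ : 𝓢(Sp N, ℂ)) :
    Integrable fun x => ψ x * f x :=
  (ψ.memLp 2 volume).integrable_mul hf

lemma integral_schwartz_mul_hat {v : Sp N → Sp N} (hv : IsL2 v) (ψ : 𝓢(Sp N, ℂ)) (i : Fin N) :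
    ∫ ξ, ψ ξ * hat v ξ i = ∫ x, (𝓕 ψ : 𝓢(Sp N, ℂ)) x * ((v x i : ℝ) : ℂ) := by
  have happly : ∀ (f : Lp (CSp N) 2 (volume : Measure (Sp N))) (χ : 𝓢(Sp N, ℂ)),
      (∫ x, χ x • f x) i = ∫ x, χ x * f x i := fun f χ =>
    ((EuclideanSpace.proj (𝕜 := ℂ) i).integral_comp_comm
      (memLp_one_iff_integrable.1 ((Lp.memLp f).smul (χ.memLp 2 volume)))).symm
  have hdual := congrArg (fun S : 𝓢'(Sp N, CSp N) => S ψ i)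
    (Lp.fourier_toTemperedDistribution_eq (toL2 v))
  simp only [TemperedDistribution.fourier_apply, Lp.toTemperedDistribution_apply, happly] at hdual
  refine hdual.symm.trans (integral_congr_ae ?_)
  filter_upwards [coeFn_toL2 hv] with x hx
  rw [hx, complexify_apply, inclusion_apply]

lemma hat_div {u : Sp N → Sp N} (hu : HasMoments 1 u) (hdiv : ∀ x, div u x = 0) :
    ∀ᵐ ξ, ∑ i, derivSymbol i ξ * hat u ξ i = 0 := by
  have hL2 : ∀ i, IsL2 (partialDeriv i u) := fun i => (hu.partialDeriv i).isL2
  have hsum : (fun ξ => ∑ i, hat (partialDeriv i u) ξ i) =ᵐ[volume] 0 := by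
    refine ae_eq_zero_of_integral_schwartz
      ((memLp_finsetSum _ fun i _ => memLp_hat_apply _ i).locallyIntegrable (by norm_num))
      fun ψ => ?_
    calc ∫ ξ, ψ ξ * ∑ i, hat (partialDeriv i u) ξ i
        = ∑ i, ∫ x, (𝓕 ψ : 𝓢(Sp N, ℂ)) x * ((partialDeriv i u x i : ℝ) : ℂ) := by
          simp only [Finset.mul_sum, ← integral_schwartz_mul_hat (hL2 _)]
          exact integral_finsetSum _ fun i _ => integrable_schwartz_mul (memLp_hat_apply _ i) ψ
      _ = ∫ x, (𝓕 ψ : 𝓢(Sp N, ℂ)) x * ((div u x : ℝ) : ℂ) := by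
          rw [← integral_finsetSum _ fun i _ =>
            integrable_schwartz_mul (memLp_ofReal_apply (hL2 i) i) _]
          simp only [div, Complex.ofReal_sum, Finset.mul_sum]
      _ = 0 := by simp [hdiv]
  filter_upwards [hsum, ae_all_iff.2 hu.hat_partialDeriv] with ξ hsumξ hξ
  simpa only [hξ, PiLp.smul_apply, smul_eq_mul, Pi.zero_apply] using hsumξ

lemma gradient_apply (P : Sp N → ℝ) (x : Sp N) (i : Fin N) :
    gradient P x i = fderiv ℝ P x (basisVec i) := by
  have hdual : ⟪gradient P x, basisVec i⟫_ℝ = fderiv ℝ P x (basisVec i) := by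
    rw [gradient, InnerProductSpace.toDual_symm_apply]
  rw [← hdual, basisVec, EuclideanSpace.inner_single_right]
  simp

lemma fderiv_ofReal_apply {P : Sp N → ℝ} (hP : Differentiable ℝ P) (x y : Sp N) :
    fderiv ℝ (fun x => (P x : ℂ)) x y = ∑ k, (y k : ℂ) * ((gradient P x k : ℝ) : ℂ) := by
  have hfderiv : fderiv ℝ (fun x => (P x : ℂ)) x = _ :=
    (Complex.ofRealCLM.hasFDerivAt.comp x (hP x).hasFDerivAt).fderiv
  conv_lhs => rw [hfderiv, ← sum_smul_basisVec y]
  simp [gradient_apply]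

open scoped LineDeriv in
lemma exists_schwartz_fourier_eq_fderiv (ψ : 𝓢(Sp N, ℂ)) (j : Fin N) :
    ∃ Θ : 𝓢(Sp N, ℂ), (∀ ξ, Θ ξ = -(ψ ξ * derivSymbol j ξ)) ∧
      ∀ x, (𝓕 Θ : 𝓢(Sp N, ℂ)) x = fderiv ℝ (𝓕 ψ : 𝓢(Sp N, ℂ)) x (basisVec j) := by
  have hcoord : (inner ℝ · (basisVec j : Sp N)).HasTemperateGrowth := by fun_prop
  refine ⟨-(2 * Real.pi * Complex.I) • SchwartzMap.smulLeftCLM ℂ (inner ℝ · (basisVec j : Sp N)) ψ,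
    fun ξ => ?_, fun x => ?_⟩
  · rw [smul_apply, SchwartzMap.smulLeftCLM_apply_apply hcoord, basisVec,
      EuclideanSpace.inner_single_right, derivSymbol]
    simp
    ring
  · rw [← SchwartzMap.lineDerivOp_fourier_eq, SchwartzMap.lineDerivOp_apply_eq_fderiv]

lemma integrable_and_integral_schwartz_mul_hat {v : Sp N → Sp N} (hv : IsL2 v)
    (ψ : 𝓢(Sp N, ℂ)) (i j : Fin N) :
    (Integrable fun ξ => ψ ξ * (derivSymbol j ξ * hat v ξ i)) ∧
    ∫ ξ, ψ ξ * (derivSymbol j ξ * hat v ξ i) =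
      -∫ x, fderiv ℝ (𝓕 ψ : 𝓢(Sp N, ℂ)) x (basisVec j) * ((v x i : ℝ) : ℂ) := by
  obtain ⟨Θ, hΘ, hΘ'⟩ := exists_schwartz_fourier_eq_fderiv ψ j
  have heq : (fun ξ => ψ ξ * (derivSymbol j ξ * hat v ξ i)) = fun ξ => -(Θ ξ * hat v ξ i) := by
    ext ξ
    rw [hΘ]
    ring
  simp only [heq, ← hΘ']
  exact ⟨(integrable_schwartz_mul (memLp_hat_apply v i) Θ).neg, by
    rw [integral_neg, integral_schwartz_mul_hat hv]⟩

open scoped LineDeriv in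
lemma hat_gradient {P : Sp N → ℝ} (hP : ContDiff ℝ 1 P) (hL : IsL2 (gradient P)) (i j : Fin N) :
    ∀ᵐ ξ, derivSymbol j ξ * hat (gradient P) ξ i = derivSymbol i ξ * hat (gradient P) ξ j := by
  have hloc : ∀ i j, LocallyIntegrable fun ξ => derivSymbol j ξ * hat (gradient P) ξ i :=
    fun i j => ((memLp_hat_apply _ i).locallyIntegrable (by norm_num)).continuous_mul
      (continuous_derivSymbol j)
  have hfderiv := fderiv_ofReal_apply (hP.differentiable one_ne_zero)
  have hmemLp : ∀ y, MemLp (fun x => fderiv ℝ (fun x => (P x : ℂ)) x y) 2 volume := fun y => by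
    simp only [hfderiv]
    exact memLp_finsetSum _ fun k _ => (memLp_ofReal_apply hL k).const_mul _
  have hzero : (fun ξ => derivSymbol j ξ * hat (gradient P) ξ i -
      derivSymbol i ξ * hat (gradient P) ξ j) =ᵐ[volume] 0 := by
    refine ae_eq_zero_of_integral_schwartz ((hloc i j).sub (hloc j i)) fun ψ => ?_
    have hij := integrable_and_integral_schwartz_mul_hat hL ψ i j
    have hji := integrable_and_integral_schwartz_mul_hat hL ψ j i
    have hsymm := integral_fderiv_mul_fderiv_symm ((𝓕 ψ : 𝓢(Sp N, ℂ)).smooth 2)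
      (p := fun x => (P x : ℂ)) (Complex.ofRealCLM.contDiff.comp hP)
      ((𝓕 ψ : 𝓢(Sp N, ℂ)).memLp 2 volume)
      (fun y => (∂_{y} (𝓕 ψ : 𝓢(Sp N, ℂ))).memLp 2 volume)
      hmemLp (basisVec j) (basisVec i)
    have hcoord : ∀ x k, fderiv ℝ (fun x => (P x : ℂ)) x (basisVec k) = (gradient P x k : ℂ) :=
      fun x k => by simp [hfderiv, basisVec, PiLp.single_apply, apply_ite Complex.ofReal]
    simp only [mul_sub]
    rw [integral_sub hij.1 hji.1, hij.2, hji.2, sub_eq_zero, neg_inj]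
    simpa only [← hcoord] using hsymm
  filter_upwards [hzero] with ξ hξ using sub_eq_zero.1 hξ

lemma inner_hat_gradient {u : Sp N → Sp N} (hu : HasMoments 1 u) (hdiv : ∀ x, div u x = 0)
    {P : Sp N → ℝ} (hP : ContDiff ℝ 1 P) (hL : IsL2 (gradient P)) :
    ∀ᵐ ξ, ⟪hat u ξ, hat (gradient P) ξ⟫_ℂ = 0 := by
  rcases Nat.eq_zero_or_pos N with rfl | hN
  · exact .of_forall fun ξ => by simp [PiLp.inner_apply]
  have : Nonempty (Fin N) := ⟨⟨0, hN⟩⟩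
  filter_upwards [Measure.ae_ne volume 0, hat_div hu hdiv,
    ae_all_iff.2 fun i => ae_all_iff.2 fun j => hat_gradient hP hL i j] with ξ hξ hdivξ hcurl
  obtain ⟨j, hj⟩ : ∃ j, derivSymbol j ξ ≠ 0 := by
    contrapose! hξ
    ext j
    simpa [derivSymbol, Real.pi_ne_zero] using hξ j
  have hconj : ∀ i, star (derivSymbol i ξ) = -derivSymbol i ξ := fun i => by simp [derivSymbol]
  refine (mul_eq_zero.1 ?_).resolve_left hj
  calc derivSymbol j ξ * ⟪hat u ξ, hat (gradient P) ξ⟫_ℂ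
      = ∑ i, star (hat u ξ i) * (derivSymbol j ξ * hat (gradient P) ξ i) := by
        rw [PiLp.inner_apply, Finset.mul_sum]
        refine Finset.sum_congr rfl fun i _ => ?_
        rw [RCLike.inner_apply]
        simp only [starRingEnd_apply]
        ring
    _ = -star (∑ i, derivSymbol i ξ * hat u ξ i) * hat (gradient P) ξ j := by
        rw [star_sum, ← Finset.sum_neg_distrib, Finset.sum_mul]
        refine Finset.sum_congr rfl fun i _ => ?_
        rw [hcurl i j, star_mul, hconj]
        ring
    _ = 0 := by rw [hdivξ, star_zero, neg_zero, zero_mul]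

end Pressure

section Sobolev

variable {N : ℕ}

lemma toL2_sub {v w : Sp N → Sp N} (hv : IsL2 v) (hw : IsL2 w) :
    toL2 (v - w) = toL2 v - toL2 w := by
  refine toL2_eq_of_ae_eq ?_
  filter_upwards [Lp.coeFn_sub (toL2 v) (toL2 w), coeFn_toL2 hv, coeFn_toL2 hw] with x hsub hv hw
  rw [hsub, Pi.sub_apply, hv, hw]
  simp only [complexify_apply, Pi.sub_apply, map_sub]

lemma toL2_finsetSum {ι : Type*} (s : Finset ι) {v : ι → Sp N → Sp N} (hv : ∀ i ∈ s, IsL2 (v i)) :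
    toL2 (fun x => ∑ i ∈ s, v i x) = ∑ i ∈ s, toL2 (v i) := by
  refine toL2_eq_of_ae_eq ?_
  have hcoe : ∀ᵐ x, ∀ i ∈ s, toL2 (v i) x = complexify (v i) x :=
    (ae_ball_iff s.countable_toSet).2 fun i hi => coeFn_toL2 (hv i hi)
  filter_upwards [Lp.coeFn_finsetSum s fun i => toL2 (v i), hcoe] with x hsum hcoe
  rw [hsum, Finset.sum_apply, Finset.sum_congr rfl hcoe]
  simp only [complexify_apply, map_sum]

lemma hat_sub {v w : Sp N → Sp N} (hv : IsL2 v) (hw : IsL2 w) :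
    hat (v - w) =ᵐ[volume] fun ξ => hat v ξ - hat w ξ := by
  have hsub : 𝓕 (toL2 v - toL2 w) = 𝓕 (toL2 v) - 𝓕 (toL2 w) :=
    map_sub (Lp.fourierTransformₗᵢ (Sp N) (CSp N)) _ _
  rw [hat, toL2_sub hv hw, hsub]
  exact Lp.coeFn_sub _ _

lemma hat_finsetSum {ι : Type*} (s : Finset ι) {v : ι → Sp N → Sp N} (hv : ∀ i ∈ s, IsL2 (v i)) :
    hat (fun x => ∑ i ∈ s, v i x) =ᵐ[volume] fun ξ => ∑ i ∈ s, hat (v i) ξ := by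
  have hsum : 𝓕 (∑ i ∈ s, toL2 (v i)) = ∑ i ∈ s, 𝓕 (toL2 (v i)) :=
    map_sum (Lp.fourierTransformₗᵢ (Sp N) (CSp N)) _ _
  rw [hat, toL2_finsetSum s hv, hsum]
  filter_upwards [Lp.coeFn_finsetSum s fun i => 𝓕 (toL2 (v i))] with ξ hξ
  rw [hξ, Finset.sum_apply]

lemma sum_derivSymbol_sq (ξ : Sp N) :
    ∑ k, derivSymbol k ξ ^ 2 = ((-‖(2 * Real.pi) • ξ‖ ^ 2 : ℝ) : ℂ) := by
  rw [norm_smul, mul_pow, EuclideanSpace.real_norm_sq_eq, Real.norm_of_nonneg Real.two_pi_pos.le]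
  push_cast
  rw [Finset.mul_sum, ← Finset.sum_neg_distrib]
  refine Finset.sum_congr rfl fun k _ => ?_
  rw [derivSymbol, mul_pow, Complex.I_sq]
  push_cast
  ring

lemma HasMoments.hat_lap {w : Sp N → Sp N} (hw : HasMoments 2 w) :
    hat (lap w) =ᵐ[volume] fun ξ => ((-‖(2 * Real.pi) • ξ‖ ^ 2 : ℝ) : ℂ) • hat w ξ := by
  filter_upwards [hat_finsetSum Finset.univ fun k _ => ((hw.partialDeriv k).partialDeriv k).isL2,
    ae_all_iff.2 hw.hat_partialDeriv, ae_all_iff.2 fun k => (hw.partialDeriv k).hat_partialDeriv k]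
    with ξ hsum hfirst hsecond
  rw [show hat (lap w) ξ = _ from hsum]
  simp only [hsecond, hfirst, smul_smul, ← pow_two]
  rw [← Finset.sum_smul, sum_derivSymbol_sq]

/-- The weight `(1 + |2 π ξ|²)ˢ` of the Sobolev norm `‖·‖²_{Hˢ}`. -/
noncomputable def weight (s : ℝ) (ξ : Sp N) : ℝ := (1 + ‖(2 * Real.pi) • ξ‖ ^ 2) ^ s

lemma continuous_weight (s : ℝ) : Continuous (weight (N := N) s) :=
  Continuous.rpow_const (by fun_prop) fun ξ => .inl (by positivity)

lemma weight_pos (s : ℝ) (ξ : Sp N) : 0 < weight s ξ := Real.rpow_pos_of_pos (by positivity) _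

lemma weight_two (ξ : Sp N) : weight 2 ξ = (1 + ‖(2 * Real.pi) • ξ‖ ^ 2) ^ 2 :=
  Real.rpow_two _

lemma weight_le_weight {r s : ℝ} (h : r ≤ s) (ξ : Sp N) : weight r ξ ≤ weight s ξ :=
  Real.rpow_le_rpow_of_exponent_le (le_add_of_nonneg_right (sq_nonneg _)) h

lemma one_le_weight {s : ℝ} (hs : 0 ≤ s) (ξ : Sp N) : 1 ≤ weight s ξ := by
  simpa [weight] using weight_le_weight hs ξ

lemma norm_sq_le_weight {s : ℝ} (hs : 1 ≤ s) (ξ : Sp N) :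
    ‖(2 * Real.pi) • ξ‖ ^ 2 ≤ weight s ξ := by
  refine le_trans ?_ (weight_le_weight hs ξ)
  simp [weight]

lemma norm_pow_four_le_weight {s : ℝ} (hs : 2 ≤ s) (ξ : Sp N) :
    (‖(2 * Real.pi) • ξ‖ ^ 2) ^ 2 ≤ weight s ξ := by
  refine le_trans ?_ (weight_le_weight hs ξ)
  rw [weight_two]
  gcongr
  exact le_add_of_nonneg_left zero_le_one

lemma half_sq_le_one_add_sq (ξ : Sp N) : (1 + ‖ξ‖) ^ 2 / 2 ≤ 1 + ‖(2 * Real.pi) • ξ‖ ^ 2 := by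
  have hξ : ‖ξ‖ ≤ ‖(2 * Real.pi) • ξ‖ := by
    rw [norm_smul, Real.norm_of_nonneg Real.two_pi_pos.le]
    exact le_mul_of_one_le_left (norm_nonneg _) (by linarith [Real.pi_gt_three])
  nlinarith [sq_nonneg (1 - ‖ξ‖), mul_self_le_mul_self (norm_nonneg ξ) hξ]

lemma pow_four_le_weight {s : ℝ} (hs : 2 ≤ s) (ξ : Sp N) :
    ((1 + ‖ξ‖) ^ 2) ^ 2 ≤ 4 * weight s ξ := by
  have hsq := pow_le_pow_left₀ (by positivity) (half_sq_le_one_add_sq ξ) 2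
  rw [← weight_two] at hsq
  linarith [weight_le_weight hs ξ]

lemma sobolevNormSq_eq (s : ℝ) (v : Sp N → Sp N) :
    sobolevNormSq s v = ∫⁻ ξ, ENNReal.ofReal (weight s ξ) * ‖hat v ξ‖ₑ ^ 2 := rfl

lemma lintegral_le_sobolevNormSq {s : ℝ} {v : Sp N → Sp N} {f : Sp N → ℝ≥0∞}
    (h : ∀ ξ, f ξ ≤ ENNReal.ofReal (weight s ξ)) :
    ∫⁻ ξ, f ξ * ‖hat v ξ‖ₑ ^ 2 ≤ sobolevNormSq s v := by
  rw [sobolevNormSq_eq]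
  gcongr with ξ
  exact h ξ

lemma lintegral_mul_sq_le {α : Type*} [MeasurableSpace α] {μ : Measure α} {f g : α → ℝ≥0∞}
    (hf : AEMeasurable f μ) (hg : AEMeasurable g μ) :
    (∫⁻ x, f x * g x ∂μ) ^ 2 ≤ (∫⁻ x, f x ^ 2 ∂μ) * ∫⁻ x, g x ^ 2 ∂μ := by
  have hhoelder := ENNReal.lintegral_mul_le_Lp_mul_Lq μ Real.HolderConjugate.two_two hf hg
  simp only [Pi.mul_apply, ENNReal.rpow_two] at hhoelder
  refine (pow_le_pow_left₀ zero_le hhoelder 2).trans_eq ?_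
  rw [mul_pow, ← ENNReal.rpow_two, ← ENNReal.rpow_two, ← ENNReal.rpow_mul, ← ENNReal.rpow_mul]
  norm_num

lemma lintegral_pow_four_div_weight_lt_top {s : ℝ} (hs : 2 + (N : ℝ) / 2 < s) :
    ∫⁻ ξ : Sp N, ENNReal.ofReal ((1 + ‖ξ‖) ^ 4 / weight s ξ) < ⊤ := by
  have hs0 : 0 ≤ s := (by positivity : (0 : ℝ) ≤ 2 + N / 2).trans hs.le
  have hint : Integrable fun ξ : Sp N => (2 : ℝ) ^ s * (1 + ‖ξ‖) ^ (-(2 * s - 4)) := by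
    refine (integrable_one_add_norm ?_).const_mul _
    simp only [finrank_euclideanSpace, Fintype.card_fin]
    linarith
  refine lt_of_le_of_lt (lintegral_mono fun ξ => ENNReal.ofReal_le_ofReal ?_) hint.lintegral_lt_top
  have hpos : 0 < 1 + ‖ξ‖ := by positivity
  have hweight : (1 + ‖ξ‖) ^ (2 * s) / 2 ^ s ≤ weight s ξ := by
    rw [Real.rpow_mul hpos.le, ← Real.div_rpow (by positivity) zero_le_two, Real.rpow_two]
    exact Real.rpow_le_rpow (by positivity) (half_sq_le_one_add_sq ξ) hs0
  rw [div_le_iff₀ (weight_pos s ξ)]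
  calc (1 + ‖ξ‖) ^ 4 = (2 : ℝ) ^ s * (1 + ‖ξ‖) ^ (-(2 * s - 4)) *
        ((1 + ‖ξ‖) ^ (2 * s) / 2 ^ s) := by
        rw [mul_assoc, mul_div_assoc', ← Real.rpow_add hpos, mul_div_cancel₀ _ (by positivity),
          ← Real.rpow_natCast]
        congr 1
        push_cast
        ring
    _ ≤ _ := by gcongr

lemma sq_lintegral_one_add_norm_sq_mul_hat_le (s : ℝ) (v : Sp N → Sp N) :
    (∫⁻ ξ, ENNReal.ofReal ((1 + ‖ξ‖) ^ 2) * ‖hat v ξ‖ₑ) ^ 2 ≤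
      (∫⁻ ξ : Sp N, ENNReal.ofReal ((1 + ‖ξ‖) ^ 4 / weight s ξ)) * sobolevNormSq s v := by
  have hcont : Continuous fun ξ : Sp N => √(weight s ξ) := (continuous_weight s).sqrt
  have hpos : ∀ ξ : Sp N, 0 < √(weight s ξ) := fun ξ => Real.sqrt_pos.2 (weight_pos s ξ)
  have hquot : Continuous fun ξ : Sp N => (1 + ‖ξ‖) ^ 2 / √(weight s ξ) :=
    Continuous.div (by fun_prop) hcont fun ξ => (hpos ξ).ne'
  calc (∫⁻ ξ, ENNReal.ofReal ((1 + ‖ξ‖) ^ 2) * ‖hat v ξ‖ₑ) ^ 2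
      = (∫⁻ ξ, ENNReal.ofReal ((1 + ‖ξ‖) ^ 2 / √(weight s ξ)) *
          (ENNReal.ofReal √(weight s ξ) * ‖hat v ξ‖ₑ)) ^ 2 := by
        congr! 3 with ξ
        rw [← mul_assoc, ← ENNReal.ofReal_mul (by positivity), div_mul_cancel₀ _ (hpos ξ).ne']
    _ ≤ _ := lintegral_mul_sq_le hquot.measurable.ennreal_ofReal.aemeasurable
        (hcont.measurable.ennreal_ofReal.aemeasurable.mul (aestronglyMeasurable_hat v).enorm)
    _ = _ := by
        rw [sobolevNormSq_eq]
        congr! 3 with ξ ξ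
        · rw [← ENNReal.ofReal_pow (by positivity), div_pow, Real.sq_sqrt (weight_pos s ξ).le,
            ← pow_mul]
        · rw [mul_pow, ← ENNReal.ofReal_pow (by positivity), Real.sq_sqrt (weight_pos s ξ).le]

lemma hasMoments_of_sobolev {s : ℝ} (hs : 2 + (N : ℝ) / 2 < s) {v : Sp N → Sp N}
    (hc : ContDiff ℝ 2 v) (hv : IsL2 v) (hf : sobolevNormSq s v < ⊤) : HasMoments 2 v := by
  have hs2 : 2 ≤ s := (le_add_of_nonneg_right (by positivity)).trans hs.le
  have hmeas : AEStronglyMeasurable (fun ξ => (1 + ‖ξ‖) ^ 2 * ‖hat v ξ‖) volume :=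
    (Continuous.aestronglyMeasurable (by fun_prop)).mul (aestronglyMeasurable_hat v).norm
  have henorm : ∀ ξ, ‖(1 + ‖ξ‖) ^ 2 * ‖hat v ξ‖‖ₑ =
      ENNReal.ofReal ((1 + ‖ξ‖) ^ 2) * ‖hat v ξ‖ₑ := fun ξ => by
    rw [enorm_mul, enorm_norm, Real.enorm_of_nonneg (by positivity)]
  have hL1 : ∫⁻ ξ, ENNReal.ofReal ((1 + ‖ξ‖) ^ 2) * ‖hat v ξ‖ₑ < ⊤ :=
    (ENNReal.pow_lt_top_iff.1 ((sq_lintegral_one_add_norm_sq_mul_hat_le s v).trans_lt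
      (ENNReal.mul_lt_top (lintegral_pow_four_div_weight_lt_top hs) hf))).resolve_right two_ne_zero
  have hL2 : ∫⁻ ξ, (ENNReal.ofReal ((1 + ‖ξ‖) ^ 2) * ‖hat v ξ‖ₑ) ^ 2 < ⊤ := by
    refine lt_of_le_of_lt ?_ (ENNReal.mul_lt_top (ENNReal.ofReal_lt_top (r := 4)) hf)
    rw [sobolevNormSq_eq, ← lintegral_const_mul' _ _ ENNReal.ofReal_ne_top]
    refine lintegral_mono fun ξ => ?_
    simp only [mul_pow]
    rw [← ENNReal.ofReal_pow (by positivity), ← mul_assoc, ← ENNReal.ofReal_mul zero_le_four]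
    gcongr
    exact pow_four_le_weight hs2 ξ
  refine ⟨hc, hv, ⟨hmeas, ?_⟩, hmeas, ?_⟩
  · simpa only [HasFiniteIntegral, henorm] using hL1
  · rw [eLpNorm_lt_top_iff_lintegral_rpow_enorm_lt_top two_ne_zero ENNReal.ofNat_ne_top]
    simpa only [henorm, ENNReal.toReal_ofNat, ENNReal.rpow_two] using hL2

end Sobolev

section Energy

variable {N : ℕ}

lemma enorm_sq_eq_ofReal {E : Type*} [SeminormedAddGroup E] (z : E) :
    ‖z‖ₑ ^ 2 = ENNReal.ofReal (‖z‖ ^ 2) := by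
  rw [← ofReal_norm, ENNReal.ofReal_pow (norm_nonneg _)]

/-- `∫ |ξ| |v̂(ξ)| dξ`, with `ξ` the angular frequency: a bound for `|∇ v|` that can be estimated
separately on low, intermediate and high frequencies. -/
noncomputable def freqL1 (v : Sp N → Sp N) : ℝ≥0∞ := ∫⁻ ξ, ‖(2 * Real.pi) • ξ‖ₑ * ‖hat v ξ‖ₑ

/-- The dissipation `‖m(D) v‖²_{L²}`, computed on the Fourier side. -/
noncomputable def dissip (m : Sp N → ℝ) (v : Sp N → Sp N) : ℝ≥0∞ :=
  ∫⁻ ξ, ‖m ((2 * Real.pi) • ξ)‖ₑ ^ 2 * ‖hat v ξ‖ₑ ^ 2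

lemma freqL1_le (v : Sp N → Sp N) : freqL1 v ≤
    ENNReal.ofReal (2 * Real.pi) * ∫⁻ ξ, ENNReal.ofReal ((1 + ‖ξ‖) ^ 2) * ‖hat v ξ‖ₑ := by
  rw [← lintegral_const_mul' _ _ ENNReal.ofReal_ne_top]
  refine lintegral_mono fun ξ => ?_
  simp only
  rw [← mul_assoc, ← ENNReal.ofReal_mul Real.two_pi_pos.le, ← ofReal_norm, norm_smul,
    Real.norm_of_nonneg Real.two_pi_pos.le]
  gcongr
  nlinarith [norm_nonneg ξ]

lemma freqL1_sq_le (s : ℝ) (v : Sp N → Sp N) : freqL1 v ^ 2 ≤ ENNReal.ofReal (2 * Real.pi) ^ 2 *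
    ((∫⁻ ξ : Sp N, ENNReal.ofReal ((1 + ‖ξ‖) ^ 4 / weight s ξ)) * sobolevNormSq s v) := by
  refine (pow_le_pow_left₀ zero_le (freqL1_le v) 2).trans ?_
  rw [mul_pow]
  gcongr
  exact sq_lintegral_one_add_norm_sq_mul_hat_le s v

lemma freqL1_lt_top {s : ℝ} (hs : 2 + (N : ℝ) / 2 < s) {v : Sp N → Sp N}
    (hv : sobolevNormSq s v < ⊤) : freqL1 v < ⊤ :=
  (ENNReal.pow_lt_top_iff.1 ((freqL1_sq_le s v).trans_lt (ENNReal.mul_lt_top (by finiteness)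
    (ENNReal.mul_lt_top (lintegral_pow_four_div_weight_lt_top hs) hv)))).resolve_right two_ne_zero

lemma HasMoments.norm_partialDeriv_le {v : Sp N → Sp N} (hv : HasMoments 1 v) (h : freqL1 v < ⊤)
    (k : Fin N) (x : Sp N) : ‖MHD.partialDeriv k v x‖ ≤ (freqL1 v).toReal := by
  refine ((hv.partialDeriv k).norm_le x).trans ?_
  rw [integral_norm_eq_lintegral_enorm (aestronglyMeasurable_hat _)]
  refine ENNReal.toReal_mono h.ne (lintegral_mono_ae ?_)
  filter_upwards [hv.hat_partialDeriv k] with ξ hξ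
  rw [hξ, enorm_smul, ← ofReal_norm (derivSymbol k ξ), ← ofReal_norm ((2 * Real.pi) • ξ),
    norm_smul (2 * Real.pi), Real.norm_of_nonneg Real.two_pi_pos.le]
  gcongr
  exact norm_derivSymbol_le k ξ

lemma HasMoments.gradNorm_le {v : Sp N → Sp N} (hv : HasMoments 1 v) (h : freqL1 v < ⊤)
    (x : Sp N) : gradNorm v x ≤ N * (freqL1 v).toReal :=
  calc gradNorm v x ≤ ∑ k, ‖MHD.partialDeriv k v x‖ := Real.sqrt_le_iff.2
        ⟨by positivity, Finset.sum_sq_le_sq_sum_of_nonneg fun _ _ => norm_nonneg _⟩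
    _ ≤ ∑ _k : Fin N, (freqL1 v).toReal :=
        Finset.sum_le_sum fun k _ => hv.norm_partialDeriv_le h k x
    _ = _ := by simp

lemma lintegral_enorm_sq_eq_norm_sq (f : Lp (CSp N) 2 (volume : Measure (Sp N))) :
    ∫⁻ x, ‖f x‖ₑ ^ 2 = ENNReal.ofReal (‖f‖ ^ 2) := by
  rw [← enorm_sq_eq_ofReal, Lp.enorm_def]
  simpa using (eLpNorm_nnreal_pow_eq_lintegral (p := 2) (f := f) (μ := volume) two_ne_zero).symm

lemma lintegral_enorm_sq_fourier (f : Lp (CSp N) 2 (volume : Measure (Sp N))) :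
    ∫⁻ ξ, ‖(𝓕 f) ξ‖ₑ ^ 2 = ∫⁻ x, ‖f x‖ₑ ^ 2 := by
  rw [lintegral_enorm_sq_eq_norm_sq, lintegral_enorm_sq_eq_norm_sq, Lp.norm_fourier_eq]

lemma lintegral_enorm_sq_hat {v : Sp N → Sp N} (hv : IsL2 v) :
    ∫⁻ ξ, ‖hat v ξ‖ₑ ^ 2 = ∫⁻ x, ‖v x‖ₑ ^ 2 := by
  rw [lintegral_enorm_sq_fourier]
  refine lintegral_congr_ae ?_
  filter_upwards [coeFn_toL2 hv] with x hx
  rw [hx, ← ofReal_norm, norm_complexify, ofReal_norm]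

lemma sum_enorm_derivSymbol_sq (ξ : Sp N) :
    ∑ j, ‖derivSymbol j ξ‖ₑ ^ 2 = ‖(2 * Real.pi) • ξ‖ₑ ^ 2 := by
  simp only [enorm_sq_eq_ofReal]
  rw [← ENNReal.ofReal_sum_of_nonneg fun _ _ => sq_nonneg _, norm_smul, mul_pow,
    EuclideanSpace.real_norm_sq_eq, Finset.mul_sum]
  simp only [norm_derivSymbol, mul_pow, sq_abs, Real.norm_eq_abs]

lemma HasMoments.sum_enorm_hat_partialDeriv_sq {v : Sp N → Sp N} (hv : HasMoments 1 v) :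
    ∀ᵐ ξ, ∑ j, ‖hat (MHD.partialDeriv j v) ξ‖ₑ ^ 2 =
      ‖(2 * Real.pi) • ξ‖ₑ ^ 2 * ‖hat v ξ‖ₑ ^ 2 := by
  filter_upwards [ae_all_iff.2 hv.hat_partialDeriv] with ξ hξ
  simp only [hξ, enorm_smul, mul_pow, ← Finset.sum_mul, sum_enorm_derivSymbol_sq]

lemma HasMoments.multGradNormSq_eq {v : Sp N → Sp N} (hv : HasMoments 1 v)
    {m : Sp N → ℝ} (hm : Measurable m) : multGradNormSq m v =
      ∫⁻ ξ, ‖m ((2 * Real.pi) • ξ)‖ₑ ^ 2 * (‖(2 * Real.pi) • ξ‖ₑ ^ 2 * ‖hat v ξ‖ₑ ^ 2) := by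
  have hsymbol : Measurable fun ξ : Sp N => (m ((2 * Real.pi) • ξ) : ℂ) :=
    Complex.measurable_ofReal.comp (hm.comp (measurable_const_smul _))
  have hmeas : ∀ j, AEMeasurable fun ξ =>
      ‖(m ((2 * Real.pi) • ξ) : ℂ) • hat (MHD.partialDeriv j v) ξ‖ₑ ^ 2 := fun j =>
    (hsymbol.aestronglyMeasurable.smul (aestronglyMeasurable_hat _)).enorm.pow_const 2
  rw [multGradNormSq, ← lintegral_finsetSum' _ fun j _ => hmeas j]
  refine lintegral_congr_ae ?_
  filter_upwards [hv.sum_enorm_hat_partialDeriv_sq] with ξ hξ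
  simp only [enorm_smul (m ((2 * Real.pi) • ξ) : ℂ), mul_pow, ← Finset.mul_sum]
  rw [hξ, ← ofReal_norm ((m _ : ℝ) : ℂ), Complex.norm_real, ofReal_norm]

lemma HasMoments.gradNormSq_eq {v : Sp N → Sp N} (hv : HasMoments 1 v) :
    gradNormSq v = ENNReal.ofReal (gradSq v) := by
  rw [gradSq, ofReal_integral_eq_lintegral_ofReal hv.memLp_gradNorm.integrable_sq
    (.of_forall fun x => sq_nonneg _), gradNormSq, ← lintegral_finsetSum _ fun j _ =>
    (hv.partialDeriv j).contDiff.continuous.measurable.enorm.pow_const 2]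
  refine lintegral_congr fun x => ?_
  rw [gradNorm_sq, ENNReal.ofReal_sum_of_nonneg fun _ _ => sq_nonneg _]
  simp only [enorm_sq_eq_ofReal]

lemma HasMoments.gradSq_le_sobolev {v : Sp N → Sp N} (hv : HasMoments 1 v) {s : ℝ} (hs : 1 ≤ s) :
    ENNReal.ofReal (gradSq v) ≤ sobolevNormSq s v := by
  rw [← hv.gradNormSq_eq, gradNormSq]
  simp only [← lintegral_enorm_sq_hat (hv.partialDeriv _).isL2]
  rw [← lintegral_finsetSum' _ fun j _ => (aestronglyMeasurable_hat _).enorm.pow_const 2,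
    lintegral_congr_ae hv.sum_enorm_hat_partialDeriv_sq]
  refine lintegral_le_sobolevNormSq fun ξ => ?_
  rw [enorm_sq_eq_ofReal]
  exact ENNReal.ofReal_le_ofReal (norm_sq_le_weight hs ξ)

lemma HasMoments.re_inner_lap {v w : Sp N → Sp N} (hv : HasMoments 2 v) (hw : HasMoments 2 w) :
    (⟪toL2 v, toL2 (lap w)⟫_ℂ).re =
      -∑ k, ∫ x, ⟪MHD.partialDeriv k v x, MHD.partialDeriv k w x⟫_ℝ := by
  rw [inner_toL2 hv.isL2 hw.isL2_lap, Complex.ofReal_re, hw.integral_inner_lap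
    hv.differentiable hv.memLp_two hv.memLp_partialDeriv]

lemma HasMoments.gradSq_eq {v : Sp N → Sp N} (hv : HasMoments 2 v) :
    gradSq v = -(⟪toL2 v, toL2 (lap v)⟫_ℂ).re := by
  rw [hv.re_inner_lap hv, neg_neg, ← integral_finsetSum _ fun k _ =>
    integrable_inner_of_memLp (hv.memLp_partialDeriv k) (hv.memLp_partialDeriv k)]
  simp only [gradSq, gradNorm_sq, real_inner_self_eq_norm_sq]

lemma inner_eq_integral_fourier (f g : Lp (CSp N) 2 (volume : Measure (Sp N))) :
    ⟪f, g⟫_ℂ = ∫ ξ, ⟪(𝓕 f) ξ, (𝓕 g) ξ⟫_ℂ := by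
  rw [← Lp.inner_fourier_eq, L2.inner_def]

lemma re_inner_nonneg_and_eq_lintegral {f g : Lp (CSp N) 2 (volume : Measure (Sp N))}
    {h : Sp N → ℝ} (hnonneg : ∀ ξ, 0 ≤ h ξ) (hfg : ∀ᵐ ξ, ⟪(𝓕 f) ξ, (𝓕 g) ξ⟫_ℂ = (h ξ : ℂ)) :
    0 ≤ (⟪f, g⟫_ℂ).re ∧ ENNReal.ofReal (⟪f, g⟫_ℂ).re = ∫⁻ ξ, ENNReal.ofReal (h ξ) := by
  have hint : Integrable h := by
    simpa using ((integrable_congr hfg).1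
      (L2.integrable_inner (𝕜 := ℂ) (𝓕 f) (𝓕 g))).re
  have hre : (⟪f, g⟫_ℂ).re = ∫ ξ, h ξ := by
    rw [inner_eq_integral_fourier, integral_congr_ae hfg, integral_complex_ofReal,
      Complex.ofReal_re]
  rw [hre]
  exact ⟨integral_nonneg hnonneg, ofReal_integral_eq_lintegral_ofReal hint (.of_forall hnonneg)⟩

lemma re_inner_multiplierImage {m : Sp N → ℝ} {u : Sp N → Sp N}
    {Lu : Lp (CSp N) 2 (volume : Measure (Sp N))}
    (h : IsMultiplierImage (fun ξ => m ξ ^ 2) (toL2 u) Lu) :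
    0 ≤ (⟪Lu, toL2 u⟫_ℂ).re ∧ ENNReal.ofReal (⟪Lu, toL2 u⟫_ℂ).re = dissip m u := by
  have hinner : ∀ᵐ ξ, ⟪(𝓕 Lu) ξ, (𝓕 (toL2 u)) ξ⟫_ℂ =
      ((‖m ((2 * Real.pi) • ξ)‖ ^ 2 * ‖hat u ξ‖ ^ 2 : ℝ) : ℂ) := by
    filter_upwards [h] with ξ hξ
    rw [hξ, inner_smul_left, Complex.conj_ofReal, inner_self_eq_norm_sq_to_K, Real.norm_eq_abs,
      sq_abs, ← Complex.coe_algebraMap, ← map_pow, ← map_mul]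
  obtain ⟨hnonneg, heq⟩ := re_inner_nonneg_and_eq_lintegral (fun ξ => by positivity) hinner
  refine ⟨hnonneg, heq.trans (lintegral_congr fun ξ => ?_)⟩
  rw [ENNReal.ofReal_mul (by positivity), ← enorm_sq_eq_ofReal, ← enorm_sq_eq_ofReal]

lemma HasMoments.re_inner_multiplierImage_lap {m : Sp N → ℝ} (hm : Measurable m)
    {u : Sp N → Sp N} (hu : HasMoments 2 u) {Lu : Lp (CSp N) 2 (volume : Measure (Sp N))}
    (h : IsMultiplierImage (fun ξ => m ξ ^ 2) (toL2 u) Lu) :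
    0 ≤ -(⟪Lu, toL2 (lap u)⟫_ℂ).re ∧
      ENNReal.ofReal (-(⟪Lu, toL2 (lap u)⟫_ℂ).re) = multGradNormSq m u := by
  have hneg : 𝓕 (-toL2 (lap u)) = -𝓕 (toL2 (lap u)) :=
    map_neg (Lp.fourierTransformₗᵢ (Sp N) (CSp N)) _
  have hinner : ∀ᵐ ξ, ⟪(𝓕 Lu) ξ, (𝓕 (-toL2 (lap u))) ξ⟫_ℂ =
      ((‖m ((2 * Real.pi) • ξ)‖ ^ 2 * (‖(2 * Real.pi) • ξ‖ ^ 2 * ‖hat u ξ‖ ^ 2) : ℝ) : ℂ) := by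
    rw [hneg]
    filter_upwards [h, hu.hat_lap, Lp.coeFn_neg (𝓕 (toL2 (lap u)))] with ξ hξ hlap hcoe
    simp only [hat] at hlap
    rw [hξ, hcoe, Pi.neg_apply, hlap, ← neg_smul, inner_smul_left, inner_smul_right,
      Complex.conj_ofReal, inner_self_eq_norm_sq_to_K, Real.norm_eq_abs (m _), sq_abs]
    push_cast
    norm_num
  obtain ⟨hnonneg, heq⟩ := re_inner_nonneg_and_eq_lintegral (fun ξ => by positivity) hinner
  rw [inner_neg_right, Complex.neg_re] at hnonneg heq
  refine ⟨hnonneg, heq.trans ?_⟩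
  rw [(hu.mono one_le_two).multGradNormSq_eq hm]
  refine lintegral_congr fun ξ => ?_
  rw [ENNReal.ofReal_mul (by positivity), ENNReal.ofReal_mul (by positivity)]
  simp only [← enorm_sq_eq_ofReal]

lemma inner_gradient_eq_zero {u : Sp N → Sp N} (hu : HasMoments 1 u) (hdiv : ∀ x, div u x = 0)
    {P : Sp N → ℝ} (hP : ContDiff ℝ 1 P) (hL : IsL2 (gradient P)) :
    ⟪toL2 u, toL2 (gradient P)⟫_ℂ = 0 := by
  rw [inner_eq_integral_fourier]
  refine integral_eq_zero_of_ae ?_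
  filter_upwards [inner_hat_gradient hu hdiv hP hL] with ξ hξ using hξ

lemma inner_lap_gradient_eq_zero {u : Sp N → Sp N} (hu : HasMoments 2 u)
    (hdiv : ∀ x, div u x = 0) {P : Sp N → ℝ} (hP : ContDiff ℝ 1 P) (hL : IsL2 (gradient P)) :
    ⟪toL2 (lap u), toL2 (gradient P)⟫_ℂ = 0 := by
  rw [inner_eq_integral_fourier]
  refine integral_eq_zero_of_ae ?_
  filter_upwards [inner_hat_gradient (hu.mono one_le_two) hdiv hP hL, hu.hat_lap] with ξ hξ hlap
  simp only [hat] at hξ hlap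
  rw [hlap, inner_smul_left, hξ, mul_zero, Pi.zero_apply]

end Energy

section TimeDerivative

variable {N : ℕ}

lemma hasDerivAt_re_inner {H : Type*} [NormedAddCommGroup H] [InnerProductSpace ℂ H]
    [NormedSpace ℝ H] [IsScalarTower ℝ ℂ H] {f L : ℝ → H} {f' : H} {t : ℝ} (hf : HasDerivAt f f' t)
    (hL : ContinuousAt L t) (hsymm : ∀ᶠ τ in 𝓝 t, (⟪f t, L τ⟫_ℂ).re = (⟪f τ, L t⟫_ℂ).re) :
    HasDerivAt (fun τ => (⟪f τ, L τ⟫_ℂ).re) (2 * (⟪f', L t⟫_ℂ).re) t := by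
  rw [hasDerivAt_iff_tendsto_slope] at hf ⊢
  have hsum : Tendsto (fun τ => L τ + L t) (𝓝[≠] t) (𝓝 (L t + L t)) :=
    (hL.tendsto.mono_left nhdsWithin_le_nhds).add_const _
  have hinner : Tendsto (fun τ => (⟪slope f t τ, L τ + L t⟫_ℂ).re) (𝓝[≠] t)
      (𝓝 (⟪f', L t + L t⟫_ℂ).re) :=
    (Complex.continuous_re.tendsto _).comp (hf.inner hsum)
  rw [inner_add_right, Complex.add_re, ← two_mul] at hinner
  refine hinner.congr' ?_
  filter_upwards [nhdsWithin_le_nhds hsymm] with τ hτ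
  have hpolar : (⟪f τ - f t, L τ + L t⟫_ℂ).re = (⟪f τ, L τ⟫_ℂ).re - (⟪f t, L t⟫_ℂ).re := by
    simp only [inner_sub_left, inner_add_right, Complex.add_re, Complex.sub_re]
    linarith
  rw [slope, slope, RCLike.real_smul_eq_coe_smul (K := ℂ), inner_smul_left, vsub_eq_sub,
    vsub_eq_sub, ← hpolar, RCLike.conj_ofReal, smul_eq_mul]
  exact RCLike.re_ofReal_mul (K := ℂ) _ _

lemma tendsto_of_enorm_sq_sub_le {H ι : Type*} [SeminormedAddCommGroup H] {l : Filter ι}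
    {f : ι → H} {a : H} {φ : ι → ℝ≥0∞} (hφ : Tendsto φ l (𝓝 0))
    (h : ∀ᶠ i in l, ‖f i - a‖ₑ ^ 2 ≤ φ i) : Tendsto f l (𝓝 a) := by
  have hsq : Tendsto (fun i => ‖f i - a‖ₑ ^ 2) l (𝓝 0) :=
    tendsto_of_tendsto_of_tendsto_of_le_of_le' tendsto_const_nhds hφ
      (.of_forall fun _ => zero_le) h
  rw [tendsto_iff_edist_tendsto_0]
  have hsqrt := (ENNReal.continuous_rpow_const (y := 1 / 2)).tendsto 0 |>.comp hsq
  rw [ENNReal.zero_rpow_of_pos one_half_pos] at hsqrt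
  refine hsqrt.congr fun i => ?_
  rw [Function.comp_apply, edist_eq_enorm_sub, ← ENNReal.rpow_two, ← ENNReal.rpow_mul,
    mul_one_div_cancel two_ne_zero, ENNReal.rpow_one]

lemma enorm_sq_toL2 (v : Sp N → Sp N) : ‖toL2 v‖ₑ ^ 2 = ∫⁻ ξ, ‖hat v ξ‖ₑ ^ 2 := by
  rw [lintegral_enorm_sq_fourier, lintegral_enorm_sq_eq_norm_sq, enorm_sq_eq_ofReal]

lemma re_inner_toL2 {v w : Sp N → Sp N} (hv : IsL2 v) (hw : IsL2 w) :
    (⟪toL2 v, toL2 w⟫_ℂ).re = ∫ x, ⟪v x, w x⟫_ℝ := by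
  rw [inner_toL2 hv hw, Complex.ofReal_re]

/-- Twice the total energy, kinetic and magnetic, of a velocity `u` and a magnetic field `b`. -/
noncomputable def kinetic (u b : Sp N → Sp N) : ℝ := ‖toL2 u‖ ^ 2 + ‖toL2 b‖ ^ 2

lemma kinetic_nonneg (u b : Sp N → Sp N) : 0 ≤ kinetic u b := by
  rw [kinetic]
  positivity

variable {s : ℝ} {I : Set ℝ} {v : ℝ → Sp N → Sp N} {t : ℝ}

lemma IsContinuousInSobolev.hasMoments (hv : IsContinuousInSobolev s I v)
    (hs : 2 + (N : ℝ) / 2 < s) (ht : t ∈ I) : HasMoments 2 (v t) :=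
  hasMoments_of_sobolev hs (hv.contDiff t ht) (hv.isL2 t ht) (hv.sobolev t ht)

lemma IsContinuousInSobolev.continuousOn_toL2 (hv : IsContinuousInSobolev s I v) (hs : 0 ≤ s) :
    ContinuousOn (fun t => toL2 (v t)) I := by
  refine fun t ht => tendsto_of_enorm_sq_sub_le (hv.continuous t ht) ?_
  filter_upwards [self_mem_nhdsWithin] with τ hτ
  rw [← toL2_sub (hv.isL2 τ hτ) (hv.isL2 t ht), enorm_sq_toL2]
  simpa only [one_mul] using lintegral_le_sobolevNormSq (f := fun _ => 1) fun ξ =>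
    ENNReal.one_le_ofReal.2 (one_le_weight hs ξ)

lemma IsContinuousInSobolev.continuousOn_lap (hv : IsContinuousInSobolev s I v)
    (hs : 2 + (N : ℝ) / 2 < s) : ContinuousOn (fun t => toL2 (lap (v t))) I := by
  have hs2 : 2 ≤ s := (le_add_of_nonneg_right (by positivity)).trans hs.le
  refine fun t ht => tendsto_of_enorm_sq_sub_le (hv.continuous t ht) ?_
  filter_upwards [self_mem_nhdsWithin] with τ hτ
  have hvτ := hv.hasMoments hs hτ
  have hvt := hv.hasMoments hs ht
  rw [← toL2_sub hvτ.isL2_lap hvt.isL2_lap, enorm_sq_toL2]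
  refine le_trans (le_of_eq (lintegral_congr_ae ?_)) (lintegral_le_sobolevNormSq
    (f := fun ξ => ENNReal.ofReal ((‖(2 * Real.pi) • ξ‖ ^ 2) ^ 2))
    fun ξ => ENNReal.ofReal_le_ofReal (norm_pow_four_le_weight hs2 ξ))
  filter_upwards [hat_sub hvτ.isL2_lap hvt.isL2_lap, hat_sub hvτ.isL2 hvt.isL2, hvτ.hat_lap,
    hvt.hat_lap] with ξ hlapsub hsub hlapτ hlapt
  rw [hlapsub, hsub, hlapτ, hlapt, ← smul_sub, enorm_smul, mul_pow, enorm_sq_eq_ofReal,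
    Complex.norm_real, norm_neg, Real.norm_of_nonneg (sq_nonneg _)]

lemma IsContinuousInSobolev.continuousOn_gradSq (hv : IsContinuousInSobolev s I v)
    (hs : 2 + (N : ℝ) / 2 < s) : ContinuousOn (fun t => gradSq (v t)) I := by
  have hs0 : 0 ≤ s := (by positivity : (0 : ℝ) ≤ 2 + N / 2).trans hs.le
  refine (Complex.continuous_re.comp_continuousOn
    ((hv.continuousOn_toL2 hs0).inner (hv.continuousOn_lap hs))).neg.congr fun t ht => ?_
  rw [(hv.hasMoments hs ht).gradSq_eq]
  rfl

lemma IsContinuousInSobolev.hasDerivAt_gradSq (hv : IsContinuousInSobolev s I v)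
    (hs : 2 + (N : ℝ) / 2 < s) (ht : t ∈ interior I)
    {v' : Lp (CSp N) 2 (volume : Measure (Sp N))} (hv' : HasDerivAt (fun τ => toL2 (v τ)) v' t) :
    HasDerivAt (fun τ => gradSq (v τ)) (-(2 * (⟪v', toL2 (lap (v t))⟫_ℂ).re)) t := by
  have hI : ∀ᶠ τ in 𝓝 t, τ ∈ I := mem_interior_iff_mem_nhds.1 ht
  have hvt := hv.hasMoments hs (interior_subset ht)
  have hsymm : ∀ᶠ τ in 𝓝 t,
      (⟪toL2 (v t), toL2 (lap (v τ))⟫_ℂ).re = (⟪toL2 (v τ), toL2 (lap (v t))⟫_ℂ).re := by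
    filter_upwards [hI] with τ hτ
    rw [hvt.re_inner_lap (hv.hasMoments hs hτ), (hv.hasMoments hs hτ).re_inner_lap hvt]
    simp only [real_inner_comm]
  refine (hasDerivAt_re_inner hv' ((hv.continuousOn_lap hs).continuousAt hI)
    hsymm).neg.congr_of_eventuallyEq ?_
  filter_upwards [hI] with τ hτ
  exact (hv.hasMoments hs hτ).gradSq_eq

lemma hasDerivAt_norm_sq {H : Type*} [NormedAddCommGroup H] [InnerProductSpace ℂ H]
    [NormedSpace ℝ H] [IsScalarTower ℝ ℂ H] {f : ℝ → H} {f' : H} {t : ℝ} (hf : HasDerivAt f f' t) :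
    HasDerivAt (fun τ => ‖f τ‖ ^ 2) (2 * (⟪f', f t⟫_ℂ).re) t :=
  (hasDerivAt_re_inner hf hf.continuousAt
    (.of_forall fun _ => inner_re_symm (𝕜 := ℂ) _ _)).congr_of_eventuallyEq
    (.of_forall fun _ => norm_sq_eq_re_inner (𝕜 := ℂ) _)

namespace IsSolution

variable {ν : ℝ} {m : Sp N → ℝ} {u b : ℝ → Sp N → Sp N}

lemma continuousOn_kinetic (h : IsSolution ν m s I u b) (hs : 0 ≤ s) :
    ContinuousOn (fun t => kinetic (u t) (b t)) I :=
  ((h.u_sobolev.continuousOn_toL2 hs).norm.pow 2).add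
    ((h.b_sobolev.continuousOn_toL2 hs).norm.pow 2)

lemma dissip_lt_top (h : IsSolution ν m s I u b) (ht : t ∈ interior I) :
    dissip m (u t) < ⊤ := by
  obtain ⟨-, Lu, -, -, hLu, -⟩ := h.momentum t ht
  exact (re_inner_multiplierImage hLu).2 ▸ ENNReal.ofReal_lt_top

lemma multGradNormSq_lt_top (h : IsSolution ν m s I u b) (hs : 2 + (N : ℝ) / 2 < s)
    (hm : Measurable m) (ht : t ∈ interior I) : multGradNormSq m (u t) < ⊤ := by
  obtain ⟨-, Lu, -, -, hLu, -⟩ := h.momentum t ht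
  exact ((h.u_sobolev.hasMoments hs (interior_subset ht)).re_inner_multiplierImage_lap hm hLu).2 ▸
    ENNReal.ofReal_lt_top

lemma hasDerivAt_kinetic (h : IsSolution ν m s I u b) (hs : 2 + (N : ℝ) / 2 < s)
    (ht : t ∈ interior I) :
    HasDerivAt (fun τ => kinetic (u τ) (b τ)) (-2 * ν * (dissip m (u t)).toReal) t := by
  have htI := interior_subset ht
  have hu := h.u_sobolev.hasMoments hs htI
  have hb := h.b_sobolev.hasMoments hs htI
  have hu1 := hu.mono one_le_two
  have hb1 := hb.mono one_le_two
  obtain ⟨P, Lu, hP, hPL, hLu, hu'⟩ := h.momentum t ht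
  have hdissip : (⟪Lu, toL2 (u t)⟫_ℂ).re = (dissip m (u t)).toReal := by
    obtain ⟨hnonneg, heq⟩ := re_inner_multiplierImage hLu
    rw [← heq, ENNReal.toReal_ofReal hnonneg]
  have hpressure : ⟪toL2 (gradient P), toL2 (u t)⟫_ℂ = 0 :=
    inner_eq_zero_symm.1 (inner_gradient_eq_zero hu1 (h.u_div t htI) hP hPL)
  have huuu := hu1.integral_inner_convect (h.u_div t htI) hu1 hu1
  have hbbu := hb1.integral_inner_convect (h.b_div t htI) hb1 hu1
  have hubb := hu1.integral_inner_convect (h.u_div t htI) hb1 hb1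
  refine ((hasDerivAt_norm_sq hu').add
    (hasDerivAt_norm_sq (h.induction_eq t ht))).congr_deriv ?_
  simp only [inner_sub_left, inner_add_left, inner_neg_left, inner_smul_left, Complex.sub_re,
    Complex.add_re, Complex.neg_re, Complex.conj_ofReal, Complex.re_ofReal_mul, hpressure,
    Complex.zero_re, hdissip, re_inner_toL2 (hu.isL2_convect hu) hu.isL2,
    re_inner_toL2 (hb.isL2_convect hb) hu.isL2, re_inner_toL2 (hu.isL2_convect hb) hb.isL2,
    re_inner_toL2 (hb.isL2_convect hu) hb.isL2]
  simp only [real_inner_comm] at huuu hbbu hubb ⊢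
  linarith

lemma hasDerivAt_gradSq (h : IsSolution ν m s I u b) (hs : 2 + (N : ℝ) / 2 < s)
    (hm : Measurable m) (ht : t ∈ interior I) :
    HasDerivAt (fun τ => gradSq (u τ) + gradSq (b τ))
      (2 * (nonlinearGradPower (u t) (b t) - ν * (multGradNormSq m (u t)).toReal)) t := by
  have htI := interior_subset ht
  have hu := h.u_sobolev.hasMoments hs htI
  have hb := h.b_sobolev.hasMoments hs htI
  obtain ⟨P, Lu, hP, hPL, hLu, hu'⟩ := h.momentum t ht
  have hdissip : (⟪Lu, toL2 (lap (u t))⟫_ℂ).re = -(multGradNormSq m (u t)).toReal := by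
    obtain ⟨hnonneg, heq⟩ := hu.re_inner_multiplierImage_lap hm hLu
    rw [← heq, ENNReal.toReal_ofReal hnonneg, neg_neg]
  have hpressure : ⟪toL2 (gradient P), toL2 (lap (u t))⟫_ℂ = 0 :=
    inner_eq_zero_symm.1 (inner_lap_gradient_eq_zero hu (h.u_div t htI) hP hPL)
  refine ((h.u_sobolev.hasDerivAt_gradSq hs ht hu').add
    (h.b_sobolev.hasDerivAt_gradSq hs ht (h.induction_eq t ht))).congr_deriv ?_
  simp only [inner_sub_left, inner_add_left, inner_neg_left, inner_smul_left, Complex.sub_re,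
    Complex.add_re, Complex.neg_re, Complex.conj_ofReal, Complex.re_ofReal_mul, hpressure,
    Complex.zero_re, hdissip, nonlinearGradPower,
    re_inner_toL2 (hu.isL2_convect hu) hu.isL2_lap, re_inner_toL2 (hb.isL2_convect hb) hu.isL2_lap,
    re_inner_toL2 (hu.isL2_convect hb) hb.isL2_lap, re_inner_toL2 (hb.isL2_convect hu) hb.isL2_lap]
  ring

end IsSolution

end TimeDerivative

section Frequency

lemma integrableOn_Ico_inv {a c : ℝ} (ha : 0 < a) : IntegrableOn (fun y : ℝ => y⁻¹) (Ico a c) :=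
  ((continuousOn_inv₀.mono fun _ hy => (ha.trans_le hy.1).ne').integrableOn_compact
    isCompact_Icc).mono_set Ico_subset_Icc_self

open Module in
lemma lintegral_annulus_inv_norm_pow {E : Type*} [NormedAddCommGroup E] [NormedSpace ℝ E]
    [FiniteDimensional ℝ E] [Nontrivial E] [MeasurableSpace E] [BorelSpace E] (μ : Measure E)
    [μ.IsAddHaarMeasure] {a c : ℝ} (ha : 0 < a) (hac : a ≤ c) :
    ∫⁻ x in {x : E | ‖x‖ ∈ Ico a c}, ENNReal.ofReal ((‖x‖ ^ finrank ℝ E)⁻¹) ∂μ =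
      ENNReal.ofReal (finrank ℝ E * μ.real (Metric.ball 0 1) * Real.log (c / a)) := by
  have hannulus : MeasurableSet {x : E | ‖x‖ ∈ Ico a c} :=
    measurableSet_Ico.preimage measurable_norm
  set F : ℝ → ℝ := (Ico a c).indicator fun r => (r ^ finrank ℝ E)⁻¹ with hF
  have hF_nonneg : ∀ x : E, 0 ≤ F ‖x‖ := fun x => indicator_nonneg
    (fun r hr => inv_nonneg.2 (pow_nonneg (ha.le.trans hr.1) _)) _
  have hradial : ∀ y ∈ Ioi (0 : ℝ),
      y ^ (finrank ℝ E - 1) • F y = (Ico a c).indicator (fun r => r⁻¹) y := fun y hy => by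
    by_cases hmem : y ∈ Ico a c
    · rw [hF, indicator_of_mem hmem, indicator_of_mem hmem, smul_eq_mul,
        ← mul_pow_sub_one finrank_pos.ne', mul_inv_rev, mul_inv_cancel_left₀]
      exact pow_ne_zero _ (ne_of_gt hy)
    · rw [hF, indicator_of_notMem hmem, indicator_of_notMem hmem, smul_zero]
  have hpos : Ico a c ⊆ Ioi 0 := fun y hy => ha.trans_le hy.1
  have hint : Integrable (fun x : E => F ‖x‖) μ := by
    rw [integrable_fun_norm_addHaar, integrableOn_congr_fun hradial measurableSet_Ioi]
    exact ((integrableOn_Ico_inv ha).integrable_indicator measurableSet_Ico).integrableOn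
  have hintegral : ∫ x, F ‖x‖ ∂μ =
      finrank ℝ E * μ.real (Metric.ball 0 1) * Real.log (c / a) := by
    rw [integral_fun_norm_addHaar, setIntegral_congr_fun measurableSet_Ioi hradial,
      setIntegral_indicator measurableSet_Ico, inter_eq_right.2 hpos,
      integral_Ico_eq_integral_Ioc, ← intervalIntegral.integral_of_le hac,
      integral_inv_of_pos ha (ha.trans_le hac), nsmul_eq_mul, smul_eq_mul, mul_assoc]
  rw [← hintegral, ofReal_integral_eq_lintegral_ofReal hint (.of_forall hF_nonneg),
    ← lintegral_indicator hannulus]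
  refine lintegral_congr fun x => ?_
  by_cases hx : ‖x‖ ∈ Ico a c
  · rw [hF, indicator_of_mem hx, indicator_of_mem (by exact hx)]
  · rw [hF, indicator_of_notMem hx, indicator_of_notMem (by exact hx), ENNReal.ofReal_zero]

variable {N : ℕ}

/-- The set of Fourier variables `ξ` whose angular frequency `2 π ξ` has its modulus in `S`. -/
def freqBand (N : ℕ) (S : Set ℝ) : Set (Sp N) := {ξ | ‖(2 * Real.pi) • ξ‖ ∈ S}

lemma measurableSet_freqBand {S : Set ℝ} (hS : MeasurableSet S) : MeasurableSet (freqBand N S) :=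
  hS.preimage (by fun_prop : Measurable fun ξ : Sp N => ‖(2 * Real.pi) • ξ‖)

lemma norm_two_pi_smul (ξ : Sp N) : ‖(2 * Real.pi) • ξ‖ = 2 * Real.pi * ‖ξ‖ := by
  rw [norm_smul, Real.norm_of_nonneg Real.two_pi_pos.le]

variable (N) in
lemma exists_lintegral_freqBand_Ico_le : ∃ C : ℝ, 0 ≤ C ∧ ∀ Y : ℝ, 1 ≤ Y →
    ∫⁻ ξ in freqBand N (Ico 1 Y), ENNReal.ofReal ((‖(2 * Real.pi) • ξ‖ ^ N)⁻¹) ≤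
      ENNReal.ofReal (C * Real.log Y) := by
  have hpi := Real.two_pi_pos
  rcases N.eq_zero_or_pos with rfl | hN
  · refine ⟨0, le_rfl, fun Y _ => ?_⟩
    have hempty : freqBand 0 (Ico 1 Y) = ∅ := by
      ext ξ
      simp [freqBand, Subsingleton.elim ξ 0]
    simp [hempty]
  have : Nonempty (Fin N) := ⟨⟨0, hN⟩⟩
  refine ⟨((2 * Real.pi) ^ N)⁻¹ * (N * volume.real (Metric.ball (0 : Sp N) 1)), by positivity,
    fun Y hY => ?_⟩
  have hband : freqBand N (Ico 1 Y) =
      {ξ | ‖ξ‖ ∈ Ico (1 / (2 * Real.pi)) (Y / (2 * Real.pi))} := by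
    ext ξ
    simp only [freqBand, norm_two_pi_smul, mem_ofPred_eq, mem_Ico, div_le_iff₀' hpi,
      lt_div_iff₀' hpi]
  have hannulus := lintegral_annulus_inv_norm_pow (volume : Measure (Sp N))
    (one_div_pos.2 hpi) (div_le_div_of_nonneg_right hY hpi.le)
  rw [finrank_euclideanSpace, Fintype.card_fin, div_div_div_cancel_right₀ hpi.ne', div_one]
    at hannulus
  have hscale : (0 : ℝ) ≤ ((2 * Real.pi) ^ N)⁻¹ := by positivity
  simp only [norm_two_pi_smul, mul_pow (2 * Real.pi), mul_inv ((2 * Real.pi) ^ N),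
    ENNReal.ofReal_mul hscale]
  rw [lintegral_const_mul' _ _ ENNReal.ofReal_ne_top, hband, hannulus,
    ← ENNReal.ofReal_mul hscale, ← mul_assoc]

lemma lintegral_freqBand_Ici_lt_top {q : ℝ} (hq : (N : ℝ) < q) :
    ∫⁻ ξ in freqBand N (Ici 1), ENNReal.ofReal (‖(2 * Real.pi) • ξ‖ ^ (-q)) < ⊤ := by
  have hq0 : 0 ≤ q := (Nat.cast_nonneg N).trans hq.le
  have hint : Integrable fun ξ : Sp N => (2 : ℝ) ^ q * (1 + ‖ξ‖) ^ (-q) :=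
    (integrable_one_add_norm (by simpa using hq)).const_mul _
  refine lt_of_le_of_lt ((setLIntegral_mono' (measurableSet_freqBand measurableSet_Ici)
    fun ξ hξ => ENNReal.ofReal_le_ofReal ?_).trans (setLIntegral_le_lintegral _ _))
    hint.lintegral_lt_top
  have hle : (1 + ‖ξ‖) / 2 ≤ ‖(2 * Real.pi) • ξ‖ := by
    have hone : 1 ≤ ‖(2 * Real.pi) • ξ‖ := hξ
    rw [norm_two_pi_smul] at hone ⊢
    nlinarith [Real.pi_gt_three, norm_nonneg ξ]
  calc ‖(2 * Real.pi) • ξ‖ ^ (-q) ≤ ((1 + ‖ξ‖) / 2) ^ (-q) :=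
        Real.rpow_le_rpow_of_nonpos (by positivity) hle (neg_nonpos.2 hq0)
    _ = _ := by
      rw [Real.div_rpow (by positivity) zero_le_two, Real.rpow_neg zero_le_two, div_inv_eq_mul,
        mul_comm]

lemma lintegral_freqBand_Iio_lt_top (R : ℝ) :
    ∫⁻ ξ in freqBand N (Iio R), ‖(2 * Real.pi) • ξ‖ₑ ^ 2 < ⊤ := by
  have hsub : freqBand N (Iio R) ⊆ Metric.ball 0 R := fun ξ hξ => by
    have hlt : 2 * Real.pi * ‖ξ‖ < R := norm_two_pi_smul ξ ▸ hξ
    rw [mem_ball_zero_iff]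
    nlinarith [Real.pi_gt_three, norm_nonneg ξ]
  calc _ ≤ ∫⁻ _ξ in freqBand N (Iio R), ENNReal.ofReal R ^ 2 := by
        refine setLIntegral_mono' (measurableSet_freqBand measurableSet_Iio) fun ξ hξ => ?_
        rw [← ofReal_norm]
        gcongr
        exact le_of_lt hξ
    _ ≤ ENNReal.ofReal R ^ 2 * volume (Metric.ball (0 : Sp N) R) := by
        rw [setLIntegral_const]
        gcongr
    _ < ⊤ := ENNReal.mul_lt_top (by finiteness) measure_ball_lt_top

/-- The part of `freqL1 v` that comes from the frequencies with modulus in `S`. -/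
noncomputable def freqL1On (S : Set ℝ) (v : Sp N → Sp N) : ℝ≥0∞ :=
  ∫⁻ ξ in freqBand N S, ‖(2 * Real.pi) • ξ‖ₑ * ‖hat v ξ‖ₑ

lemma freqL1_le_freqL1On (v : Sp N → Sp N) (R Y : ℝ) :
    freqL1 v ≤ freqL1On (Iio R) v + freqL1On (Ico R Y) v + freqL1On (Ici (max R Y)) v := by
  have hcover : freqBand N (Iio R) ∪ freqBand N (Ico R Y) ∪ freqBand N (Ici (max R Y)) = univ := by
    ext ξ
    simp only [freqBand, mem_union, mem_ofPred_eq, mem_Iio, mem_Ico, mem_Ici, max_le_iff, mem_univ,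
      iff_true]
    grind
  rw [freqL1, ← setLIntegral_univ, ← hcover]
  exact (lintegral_union_le _ _ _).trans (add_le_add_left (lintegral_union_le _ _ _) _)

lemma freqL1On_sq_le {S : Set ℝ} (hS : MeasurableSet S) {v : Sp N → Sp N} {f h : Sp N → ℝ≥0∞}
    (hf : Measurable f) (hh : AEMeasurable h)
    (hle : ∀ ξ ∈ freqBand N S, ‖(2 * Real.pi) • ξ‖ₑ * ‖hat v ξ‖ₑ ≤ f ξ * h ξ) :
    freqL1On S v ^ 2 ≤ (∫⁻ ξ in freqBand N S, f ξ ^ 2) * ∫⁻ ξ, h ξ ^ 2 :=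
  calc freqL1On S v ^ 2 ≤ (∫⁻ ξ in freqBand N S, f ξ * h ξ) ^ 2 := by
        gcongr ?_ ^ 2
        exact setLIntegral_mono' (measurableSet_freqBand hS) hle
    _ ≤ (∫⁻ ξ in freqBand N S, f ξ ^ 2) * ∫⁻ ξ in freqBand N S, h ξ ^ 2 :=
        lintegral_mul_sq_le hf.aemeasurable hh.restrict
    _ ≤ _ := by
        gcongr
        exact Measure.restrict_le_self

lemma freqL1On_Iio_sq_le (R : ℝ) (v : Sp N → Sp N) : freqL1On (Iio R) v ^ 2 ≤
    (∫⁻ ξ in freqBand N (Iio R), ‖(2 * Real.pi) • ξ‖ₑ ^ 2) * ‖toL2 v‖ₑ ^ 2 := by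
  rw [enorm_sq_toL2]
  exact freqL1On_sq_le measurableSet_Iio (by fun_prop) (aestronglyMeasurable_hat v).enorm
    fun _ _ => le_rfl

variable {α : ℝ} {g : ℝ → ℝ} {R : ℝ} {m : Sp N → ℝ}

lemma LowerBoundFrom.rpow_le (hlow : LowerBoundFrom α g R m) (hg_one : ∀ r, 0 < r → 1 ≤ g r)
    {ξ : Sp N} (hR : R ≤ ‖ξ‖) (hξ : 0 < ‖ξ‖) : 0 ≤ m ξ ∧ ‖ξ‖ ^ α ≤ g ‖ξ‖ * m ξ := by
  have hg := one_pos.trans_le (hg_one _ hξ)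
  have hle := hlow ξ hR
  exact ⟨(by positivity : 0 ≤ ‖ξ‖ ^ α / g ‖ξ‖).trans hle, (div_le_iff₀' hg).1 hle⟩

lemma LowerBoundFrom.enorm_le (hlow : LowerBoundFrom α g R m) (hα : 1 + (N : ℝ) / 2 ≤ α)
    (hg_mono : MonotoneOn g (Ioi 0)) (hg_one : ∀ r, 0 < r → 1 ≤ g r) {ξ : Sp N} (hR : R ≤ ‖ξ‖)
    (hξ : 1 ≤ ‖ξ‖) {Y : ℝ} (hY : ‖ξ‖ ≤ Y) :
    ‖ξ‖ₑ ≤ ENNReal.ofReal (g Y * ‖ξ‖ ^ (-((N : ℝ) / 2))) * ‖m ξ‖ₑ := by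
  have hpos : 0 < ‖ξ‖ := one_pos.trans_le hξ
  have hY_pos : 0 < Y := hpos.trans_le hY
  have hgY : 0 ≤ g Y := zero_le_one.trans (hg_one Y hY_pos)
  obtain ⟨hm_nonneg, hpow⟩ := hlow.rpow_le hg_one hR hpos
  rw [Real.enorm_of_nonneg hm_nonneg, ← ENNReal.ofReal_mul (by positivity), ← ofReal_norm]
  gcongr
  calc ‖ξ‖ = ‖ξ‖ ^ (1 : ℝ) := (Real.rpow_one _).symm
    _ ≤ ‖ξ‖ ^ (-((N : ℝ) / 2) + α) := Real.rpow_le_rpow_of_exponent_le hξ (by linarith)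
    _ = ‖ξ‖ ^ (-((N : ℝ) / 2)) * ‖ξ‖ ^ α := Real.rpow_add hpos _ _
    _ ≤ ‖ξ‖ ^ (-((N : ℝ) / 2)) * (g Y * m ξ) := by
        gcongr
        exact hpow.trans (mul_le_mul_of_nonneg_right (hg_mono hpos hY_pos hY) hm_nonneg)
    _ = g Y * ‖ξ‖ ^ (-((N : ℝ) / 2)) * m ξ := by ring

lemma nonneg_of_le_mul_rpow (hg_one : ∀ r, 0 < r → 1 ≤ g r) {p G : ℝ}
    (hG : ∀ r, 1 ≤ r → g r ≤ G * r ^ p) : 0 ≤ G := by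
  simpa using zero_le_one.trans ((hg_one 1 one_pos).trans (hG 1 le_rfl))

lemma LowerBoundFrom.one_le_mul_enorm (hlow : LowerBoundFrom α g R m)
    (hg_one : ∀ r, 0 < r → 1 ≤ g r) {p G : ℝ} (hG : ∀ r, 1 ≤ r → g r ≤ G * r ^ p) {ξ : Sp N}
    (hR : R ≤ ‖ξ‖) (hξ : 1 ≤ ‖ξ‖) : 1 ≤ ENNReal.ofReal (G * ‖ξ‖ ^ (p - α)) * ‖m ξ‖ₑ := by
  have hpos : 0 < ‖ξ‖ := one_pos.trans_le hξ
  have hG_nonneg := nonneg_of_le_mul_rpow hg_one hG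
  obtain ⟨hm_nonneg, hpow⟩ := hlow.rpow_le hg_one hR hpos
  rw [Real.enorm_of_nonneg hm_nonneg, ← ENNReal.ofReal_mul (by positivity), ENNReal.one_le_ofReal,
    Real.rpow_sub hpos, ← mul_div_assoc, div_mul_eq_mul_div, one_le_div (by positivity)]
  exact hpow.trans (mul_le_mul_of_nonneg_right (hG _ hξ) hm_nonneg)

lemma aemeasurable_enorm_mul_hat (hm : Measurable m) (v : Sp N → Sp N) :
    AEMeasurable fun ξ => ‖m ((2 * Real.pi) • ξ)‖ₑ * ‖hat v ξ‖ₑ :=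
  (hm.comp (measurable_const_smul _)).enorm.aemeasurable.mul (aestronglyMeasurable_hat v).enorm

lemma freqL1On_Ico_sq_le (hα : 1 + (N : ℝ) / 2 ≤ α) (hg_mono : MonotoneOn g (Ioi 0))
    (hg_one : ∀ r, 0 < r → 1 ≤ g r) (hm : Measurable m) (hR : 1 ≤ R)
    (hlow : LowerBoundFrom α g R m) (Y : ℝ) (v : Sp N → Sp N) :
    freqL1On (Ico R Y) v ^ 2 ≤ ENNReal.ofReal (g Y ^ 2) *
      (∫⁻ ξ in freqBand N (Ico 1 Y), ENNReal.ofReal ((‖(2 * Real.pi) • ξ‖ ^ N)⁻¹)) *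
      dissip m v := by
  have hpointwise : ∀ ξ ∈ freqBand N (Ico R Y), ‖(2 * Real.pi) • ξ‖ₑ * ‖hat v ξ‖ₑ ≤
      ENNReal.ofReal (g Y * ‖(2 * Real.pi) • ξ‖ ^ (-((N : ℝ) / 2))) *
        (‖m ((2 * Real.pi) • ξ)‖ₑ * ‖hat v ξ‖ₑ) := fun ξ hξ => by
    rw [← mul_assoc]
    gcongr
    exact hlow.enorm_le hα hg_mono hg_one hξ.1 (hR.trans hξ.1) hξ.2.le
  have hsq : ∀ ξ ∈ freqBand N (Ico R Y),
      ENNReal.ofReal (g Y * ‖(2 * Real.pi) • ξ‖ ^ (-((N : ℝ) / 2))) ^ 2 =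
        ENNReal.ofReal (g Y ^ 2) * ENNReal.ofReal ((‖(2 * Real.pi) • ξ‖ ^ N)⁻¹) := fun ξ hξ => by
    have hY : 0 < Y := one_pos.trans_le ((hR.trans hξ.1).trans hξ.2.le)
    have hgY : 0 ≤ g Y := zero_le_one.trans (hg_one Y hY)
    rw [← ENNReal.ofReal_pow (by positivity), ← ENNReal.ofReal_mul (by positivity), mul_pow,
      ← Real.rpow_natCast (_ ^ _), ← Real.rpow_mul (norm_nonneg _), ← Real.rpow_natCast _ N,
      ← Real.rpow_neg (norm_nonneg _)]
    congr! 3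
    push_cast
    ring
  refine (freqL1On_sq_le measurableSet_Ico (by fun_prop) (aemeasurable_enorm_mul_hat hm v)
    hpointwise).trans ?_
  rw [setLIntegral_congr_fun (measurableSet_freqBand measurableSet_Ico) hsq,
    lintegral_const_mul' _ _ ENNReal.ofReal_ne_top]
  simp only [dissip, mul_pow]
  gcongr
  exact fun ξ hξ => ⟨hR.trans hξ.1, hξ.2⟩

lemma freqL1On_Ici_sq_le (hg_one : ∀ r, 0 < r → 1 ≤ g r) {p G δ : ℝ}
    (hG : ∀ r, 1 ≤ r → g r ≤ G * r ^ p) (hδ : 0 ≤ δ) (hpδ : 4 * δ = 2 * α - 2 * p - N)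
    (hm : Measurable m) (hR : 1 ≤ R) (hlow : LowerBoundFrom α g R m) {v : Sp N → Sp N}
    (hv : HasMoments 1 v) {Y : ℝ} (hY : 0 < Y) :
    freqL1On (Ici (max R Y)) v ^ 2 ≤ ENNReal.ofReal (G ^ 2 * Y ^ (-2 * δ)) *
      (∫⁻ ξ in freqBand N (Ici 1), ENNReal.ofReal (‖(2 * Real.pi) • ξ‖ ^ (-(N + 2 * δ)))) *
      multGradNormSq m v := by
  have hG_nonneg := nonneg_of_le_mul_rpow hg_one hG
  have hband : ∀ ξ ∈ freqBand N (Ici (max R Y)),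
      R ≤ ‖(2 * Real.pi) • ξ‖ ∧ Y ≤ ‖(2 * Real.pi) • ξ‖ := fun ξ hξ => max_le_iff.1 hξ
  have hpointwise : ∀ ξ ∈ freqBand N (Ici (max R Y)), ‖(2 * Real.pi) • ξ‖ₑ * ‖hat v ξ‖ₑ ≤
      ENNReal.ofReal (G * ‖(2 * Real.pi) • ξ‖ ^ (p - α)) *
        (‖(2 * Real.pi) • ξ‖ₑ * (‖m ((2 * Real.pi) • ξ)‖ₑ * ‖hat v ξ‖ₑ)) := fun ξ hξ => by
    rw [mul_left_comm, ← mul_assoc (ENNReal.ofReal _), ← mul_assoc]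
    exact mul_le_mul_left (le_mul_of_one_le_right zero_le (hlow.one_le_mul_enorm hg_one hG
      (hband ξ hξ).1 (hR.trans (hband ξ hξ).1))) _
  have hsq : ∀ ξ ∈ freqBand N (Ici (max R Y)),
      ENNReal.ofReal (G * ‖(2 * Real.pi) • ξ‖ ^ (p - α)) ^ 2 ≤
        ENNReal.ofReal (G ^ 2 * Y ^ (-2 * δ)) *
          ENNReal.ofReal (‖(2 * Real.pi) • ξ‖ ^ (-(N + 2 * δ))) := fun ξ hξ => by
    have hexp : (p - α) * (2 : ℕ) = -2 * δ + -(N + 2 * δ) := by push_cast; linarith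
    rw [← ENNReal.ofReal_pow (by positivity), ← ENNReal.ofReal_mul (by positivity), mul_pow,
      mul_assoc, ← Real.rpow_natCast (_ ^ _), ← Real.rpow_mul (norm_nonneg _), hexp,
      Real.rpow_add (hY.trans_le (hband ξ hξ).2)]
    gcongr ENNReal.ofReal (_ * (?_ * _))
    exact Real.rpow_le_rpow_of_nonpos hY (hband ξ hξ).2 (by linarith)
  have hmeas : AEMeasurable fun ξ : Sp N =>
      ‖(2 * Real.pi) • ξ‖ₑ * (‖m ((2 * Real.pi) • ξ)‖ₑ * ‖hat v ξ‖ₑ) :=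
    (by fun_prop : AEMeasurable fun ξ : Sp N => ‖(2 * Real.pi) • ξ‖ₑ).mul
      (aemeasurable_enorm_mul_hat hm v)
  refine (freqL1On_sq_le measurableSet_Ici (by fun_prop) hmeas hpointwise).trans ?_
  rw [hv.multGradNormSq_eq hm, ← lintegral_const_mul' _ _ ENNReal.ofReal_ne_top]
  simp only [mul_pow, mul_left_comm]
  gcongr ?_ * _
  exact (setLIntegral_mono' (measurableSet_freqBand measurableSet_Ici) hsq).trans
    (lintegral_mono_set fun ξ hξ => hR.trans (hband ξ hξ).1)

lemma toReal_sq_le_of_le_add {x a b c : ℝ≥0∞} {A B C : ℝ} (hx : x ≤ a + b + c)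
    (ha : a ^ 2 ≤ ENNReal.ofReal A) (hb : b ^ 2 ≤ ENNReal.ofReal B)
    (hc : c ^ 2 ≤ ENNReal.ofReal C) (hA : 0 ≤ A) (hB : 0 ≤ B) (hC : 0 ≤ C) :
    x.toReal ^ 2 ≤ 3 * (A + B + C) := by
  have hsq : ∀ {y : ℝ≥0∞} {r : ℝ}, y ^ 2 ≤ ENNReal.ofReal r → 0 ≤ r →
      y ≠ ⊤ ∧ y.toReal ^ 2 ≤ r := fun hle hr => by
    have hfin := ne_top_of_le_ne_top ENNReal.ofReal_ne_top hle
    refine ⟨by simpa using hfin, ?_⟩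
    rwa [← ENNReal.toReal_pow, ← ENNReal.le_ofReal_iff_toReal_le hfin hr]
  obtain ⟨ha_fin, ha_sq⟩ := hsq ha hA
  obtain ⟨hb_fin, hb_sq⟩ := hsq hb hB
  obtain ⟨hc_fin, hc_sq⟩ := hsq hc hC
  have hx_le : x.toReal ≤ a.toReal + b.toReal + c.toReal := by
    rw [← ENNReal.toReal_add ha_fin hb_fin, ← ENNReal.toReal_add (by finiteness) hc_fin]
    exact ENNReal.toReal_mono (by finiteness) hx
  calc x.toReal ^ 2 ≤ (a.toReal + b.toReal + c.toReal) ^ 2 := by gcongr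
    _ ≤ 3 * (a.toReal ^ 2 + b.toReal ^ 2 + c.toReal ^ 2) := by
        nlinarith [sq_nonneg (a.toReal - b.toReal), sq_nonneg (b.toReal - c.toReal),
          sq_nonneg (a.toReal - c.toReal)]
    _ ≤ 3 * (A + B + C) := by gcongr

lemma exists_freqL1_sq_le (hα : 1 + (N : ℝ) / 2 ≤ α) (hg_mono : MonotoneOn g (Ioi 0))
    (hg_one : ∀ r, 0 < r → 1 ≤ g r) {p G δ : ℝ} (hG : ∀ r, 1 ≤ r → g r ≤ G * r ^ p)
    (hδ : 0 < δ) (hpδ : 4 * δ = 2 * α - 2 * p - N) (R : ℝ) :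
    ∃ C : ℝ, 0 < C ∧ ∀ m : Sp N → ℝ, Measurable m → LowerBoundFrom α g R m →
      ∀ v : Sp N → Sp N, HasMoments 1 v → dissip m v < ⊤ → multGradNormSq m v < ⊤ →
        ∀ Y : ℝ, 1 ≤ Y → (freqL1 v).toReal ^ 2 ≤
          C * (‖toL2 v‖ ^ 2 + g Y ^ 2 * Real.log Y * (dissip m v).toReal +
            Y ^ (-2 * δ) * (multGradNormSq m v).toReal) := by
  obtain ⟨c, hc, hband⟩ := exists_lintegral_freqBand_Ico_le N
  have hlow_fin := (lintegral_freqBand_Iio_lt_top (N := N) (max R 1)).ne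
  have hhigh_fin := (lintegral_freqBand_Ici_lt_top (N := N)
    (lt_add_of_pos_right _ (mul_pos two_pos hδ))).ne
  set low := ∫⁻ ξ in freqBand N (Iio (max R 1)), ‖(2 * Real.pi) • ξ‖ₑ ^ 2
  set high := ∫⁻ ξ in freqBand N (Ici 1), ENNReal.ofReal (‖(2 * Real.pi) • ξ‖ ^ (-(N + 2 * δ)))
  refine ⟨3 * (low.toReal + c + G ^ 2 * high.toReal) + 1, by positivity,
    fun m hm hlow v hv hD hM Y hY => ?_⟩
  have hR : 1 ≤ max R 1 := le_max_right _ _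
  have hlow' : LowerBoundFrom α g (max R 1) m := fun ξ hξ => hlow ξ ((le_max_left _ _).trans hξ)
  have hlog := Real.log_nonneg hY
  have hlow_sq : freqL1On (Iio (max R 1)) v ^ 2 ≤
      ENNReal.ofReal (low.toReal * ‖toL2 v‖ ^ 2) := by
    rw [ENNReal.ofReal_mul ENNReal.toReal_nonneg, ENNReal.ofReal_toReal hlow_fin,
      ← enorm_sq_eq_ofReal]
    exact freqL1On_Iio_sq_le _ v
  have hmid_sq : freqL1On (Ico (max R 1) Y) v ^ 2 ≤
      ENNReal.ofReal (g Y ^ 2 * (c * Real.log Y) * (dissip m v).toReal) := by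
    rw [ENNReal.ofReal_mul (by positivity), ENNReal.ofReal_mul (by positivity),
      ENNReal.ofReal_toReal hD.ne]
    refine (freqL1On_Ico_sq_le hα hg_mono hg_one hm hR hlow' Y v).trans ?_
    gcongr
    exact hband Y hY
  have hhigh_sq : freqL1On (Ici (max (max R 1) Y)) v ^ 2 ≤
      ENNReal.ofReal (G ^ 2 * Y ^ (-2 * δ) * high.toReal * (multGradNormSq m v).toReal) := by
    rw [ENNReal.ofReal_mul (by positivity), ENNReal.ofReal_mul (by positivity),
      ENNReal.ofReal_toReal hM.ne, ENNReal.ofReal_toReal hhigh_fin]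
    exact freqL1On_Ici_sq_le hg_one hG hδ.le hpδ hm hR hlow' hv (by positivity)
  refine (toReal_sq_le_of_le_add (freqL1_le_freqL1On v (max R 1) Y) hlow_sq hmid_sq hhigh_sq
    (by positivity) (by positivity) (by positivity)).trans ?_
  have hcross : ∀ {a₁ a₂ a₃ x₁ x₂ x₃ : ℝ}, 0 ≤ a₁ → 0 ≤ a₂ → 0 ≤ a₃ → 0 ≤ x₁ → 0 ≤ x₂ → 0 ≤ x₃ →
      3 * (a₁ * x₁ + a₂ * x₂ + a₃ * x₃) ≤ (3 * (a₁ + a₂ + a₃) + 1) * (x₁ + x₂ + x₃) := by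
    intros
    rw [← sub_nonneg]
    ring_nf
    positivity
  calc _ = 3 * (low.toReal * ‖toL2 v‖ ^ 2 + c * (g Y ^ 2 * Real.log Y * (dissip m v).toReal) +
        G ^ 2 * high.toReal * (Y ^ (-2 * δ) * (multGradNormSq m v).toReal)) := by ring
    _ ≤ _ := by apply hcross <;> positivity

end Frequency

section Osgood

lemma setLIntegral_Ioc_deriv_eq {f f' : ℝ → ℝ} {a b : ℝ} (hab : a ≤ b)
    (hf : ∀ t ∈ Icc a b, HasDerivAt f (f' t) t) (hf' : ∀ t ∈ Icc a b, 0 ≤ f' t) :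
    ∫⁻ t in Ioc a b, ENNReal.ofReal (f' t) = ENNReal.ofReal (f b - f a) := by
  have hcont : ContinuousOn f (Icc a b) := fun t ht => (hf t ht).continuousAt.continuousWithinAt
  have hderiv : ∀ t ∈ Ioo a b, HasDerivAt f (f' t) t := fun t ht => hf t (Ioo_subset_Icc_self ht)
  have hint : IntegrableOn f' (Ioc a b) := intervalIntegral.integrableOn_deriv_of_nonneg hcont
    hderiv fun t ht => hf' t (Ioo_subset_Icc_self ht)
  rw [← ofReal_integral_eq_lintegral_ofReal hint ((ae_restrict_iff' measurableSet_Ioc).2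
      (.of_forall fun t ht => hf' t (Ioc_subset_Icc_self ht))),
    ← intervalIntegral.integral_of_le hab,
    intervalIntegral.integral_eq_sub_of_hasDerivAt_of_le hab hcont hderiv
      ((intervalIntegrable_iff_integrableOn_Ioc_of_le hab).2 hint)]

lemma setLIntegral_Ioo_deriv_le {f f' : ℝ → ℝ} {a b C : ℝ} (hab : a < b)
    (hf : ∀ t ∈ Ioo a b, HasDerivAt f (f' t) t) (hf' : ∀ t ∈ Ioo a b, 0 ≤ f' t)
    (hC : ∀ t ∈ Ioo a b, ∀ r ∈ Ioo a b, f r - f t ≤ C) :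
    ∫⁻ t in Ioo a b, ENNReal.ofReal (f' t) ≤ ENNReal.ofReal C := by
  have hmeas : AEMeasurable (fun t => ENNReal.ofReal (f' t)) (volume.restrict (Ioo a b)) :=
    ((measurable_deriv f).aemeasurable.congr ((ae_restrict_iff' measurableSet_Ioo).2
      (.of_forall fun t ht => (hf t ht).deriv))).ennreal_ofReal
  have hlower : Tendsto (fun ε : ℝ => a + ε) (𝓝[>] 0) (𝓝 a) :=
    (Continuous.tendsto' (by fun_prop) _ _ (add_zero a)).mono_left nhdsWithin_le_nhds
  have hupper : Tendsto (fun ε : ℝ => b - ε) (𝓝[>] 0) (𝓝 b) :=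
    (Continuous.tendsto' (by fun_prop) _ _ (sub_zero b)).mono_left nhdsWithin_le_nhds
  refine le_of_tendsto ((aecover_Ioo_of_Ioc (μ := volume) hlower
    hupper).lintegral_tendsto_of_countably_generated hmeas) ?_
  filter_upwards [Ioo_mem_nhdsGT (half_pos (sub_pos.2 hab))] with ε hε
  have hle : a + ε ≤ b - ε := by linarith [hε.2]
  have hsub : Icc (a + ε) (b - ε) ⊆ Ioo a b :=
    Icc_subset_Ioo (lt_add_of_pos_right _ hε.1) (sub_lt_self _ hε.1)
  rw [Measure.restrict_restrict measurableSet_Ioc,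
    inter_eq_left.2 (Ioc_subset_Icc_self.trans hsub),
    setLIntegral_Ioc_deriv_eq hle (fun t ht => hf t (hsub ht)) fun t ht => hf' t (hsub ht)]
  exact ENNReal.ofReal_le_ofReal
    (hC _ (hsub (left_mem_Icc.2 hle)) _ (hsub (right_mem_Icc.2 hle)))

variable {φ : ℝ → ℝ} {e : ℝ}

lemma intervalIntegrable_of_antitoneOn_Ici (hφ : AntitoneOn φ (Ici e)) {a b : ℝ} (ha : e ≤ a)
    (hb : e ≤ b) : IntervalIntegrable φ volume a b :=
  AntitoneOn.intervalIntegrable (hφ.mono fun _ hx => (le_min ha hb).trans hx.1)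

lemma primitive_sub_le (hφ : AntitoneOn φ (Ici e)) {a b : ℝ} (ha : e ≤ a) (hb : e ≤ b) :
    (∫ τ in e..b, φ τ) - ∫ τ in e..a, φ τ ≤ φ a * (b - a) := by
  have hint := fun {x y : ℝ} => intervalIntegrable_of_antitoneOn_Ici hφ (a := x) (b := y)
  rw [intervalIntegral.integral_interval_sub_left (hint le_rfl hb) (hint le_rfl ha), mul_comm,
    ← smul_eq_mul, ← intervalIntegral.integral_const]
  rcases le_total a b with h | h
  · exact intervalIntegral.integral_mono_on h (hint ha hb) intervalIntegrable_const
      fun x hx => hφ ha (ha.trans hx.1) hx.1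
  · rw [intervalIntegral.integral_symm b a, intervalIntegral.integral_symm b a, neg_le_neg_iff]
    exact intervalIntegral.integral_mono_on h intervalIntegrable_const (hint hb ha)
      fun x hx => hφ (hb.trans hx.1) ha hx.2

lemma primitive_mono (hφ : AntitoneOn φ (Ici e)) (hφ_nonneg : ∀ τ ∈ Ici e, 0 ≤ φ τ) {a b : ℝ}
    (ha : e ≤ a) (hab : a ≤ b) : ∫ τ in e..a, φ τ ≤ ∫ τ in e..b, φ τ :=
  sub_nonpos.1 <| (primitive_sub_le hφ (ha.trans hab) ha).trans <|
    mul_nonpos_of_nonneg_of_nonpos (hφ_nonneg b (ha.trans hab)) (sub_nonpos.2 hab)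

lemma continuousOn_primitive (hφ : AntitoneOn φ (Ici e)) :
    ContinuousOn (fun y => ∫ τ in e..y, φ τ) (Ici e) := fun y hy => by
  have hlt : e ≤ y + 1 := le_add_of_le_of_nonneg hy zero_le_one
  refine (intervalIntegral.continuousOn_primitive_interval'
    (intervalIntegrable_of_antitoneOn_Ici hφ le_rfl hlt) left_mem_uIcc y
    (mem_uIcc_of_le hy (lt_add_one y).le)).mono_of_mem_nhdsWithin ?_
  rw [uIcc_of_le hlt]
  exact inter_mem self_mem_nhdsWithin (nhdsWithin_le_nhds (Iic_mem_nhds (lt_add_one y)))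

variable {T : ℝ} {Y Y' A A' : ℝ → ℝ}

/-- `φ` may jump, so `primitive_sub_le` stands in for the chain rule. -/
lemma primitive_comp_le_of_deriv_le (hφ : AntitoneOn φ (Ici e)) {a b : ℝ} (hab : a ≤ b)
    (hY_cont : ContinuousOn Y (Icc a b)) (hA_cont : ContinuousOn A (Icc a b))
    (hY : ∀ t ∈ Ico a b, HasDerivAt Y (Y' t) t) (hA : ∀ t ∈ Ico a b, HasDerivAt A (A' t) t)
    (hY_ge : ∀ t ∈ Icc a b, e ≤ Y t) (hle : ∀ t ∈ Ico a b, φ (Y t) * Y' t ≤ A' t) :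
    ∫ τ in e..Y b, φ τ ≤ (∫ τ in e..Y a, φ τ) + (A b - A a) := by
  refine image_le_of_liminf_slope_right_le_deriv_boundary
    ((continuousOn_primitive hφ).comp hY_cont hY_ge)
    (B := fun t => (∫ τ in e..Y a, φ τ) + (A t - A a)) (B' := A') (by simp) (by fun_prop)
    (fun t ht => (((hA t ht).sub_const _).const_add _).hasDerivWithinAt) (fun t ht r hr => ?_)
    ⟨hab, le_rfl⟩
  have hslope : Tendsto (fun z => φ (Y t) * slope Y t z) (𝓝[>] t) (𝓝 (φ (Y t) * Y' t)) :=
    ((hasDerivAt_iff_tendsto_slope.1 (hY t ht)).mono_left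
      (nhdsWithin_mono _ fun z hz => ne_of_gt hz)).const_mul _
  refine Eventually.frequently ?_
  filter_upwards [hslope.eventually_lt_const ((hle t ht).trans_lt hr), Ioo_mem_nhdsGT ht.2]
    with z hz hmem
  refine lt_of_le_of_lt ?_ hz
  rw [slope_def_field, slope_def_field, ← mul_div_assoc]
  exact div_le_div_of_nonneg_right (primitive_sub_le hφ (hY_ge t (Ico_subset_Icc_self ht))
    (hY_ge z ⟨ht.1.trans hmem.1.le, hmem.2.le⟩)) (sub_nonneg.2 hmem.1.le)

lemma primitive_comp_le (hφ : AntitoneOn φ (Ici e)) (hY_cont : ContinuousOn Y (Ico 0 T))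
    (hA_cont : ContinuousOn A (Ico 0 T)) (hY : ∀ t ∈ Ioo 0 T, HasDerivAt Y (Y' t) t)
    (hA : ∀ t ∈ Ioo 0 T, HasDerivAt A (A' t) t) (hY_ge : ∀ t ∈ Ico 0 T, e ≤ Y t)
    (hle : ∀ t ∈ Ioo 0 T, φ (Y t) * Y' t ≤ A' t) {t : ℝ} (ht : t ∈ Ico 0 T) :
    ∫ τ in e..Y t, φ τ ≤ (∫ τ in e..Y 0, φ τ) + (A t - A 0) := by
  obtain ⟨ht_nonneg, htT⟩ := ht
  rcases ht_nonneg.eq_or_lt with rfl | ht_pos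
  · simp
  have hT : 0 < T := ht_pos.trans htT
  have hmem : (0 : ℝ) ∈ Ico 0 T := left_mem_Ico.2 hT
  have hlim : Tendsto (fun a => (∫ τ in e..Y a, φ τ) + (A t - A a)) (𝓝[>] 0)
      (𝓝 ((∫ τ in e..Y 0, φ τ) + (A t - A 0))) := by
    rw [← nhdsWithin_Ioo_eq_nhdsGT hT]
    exact (((continuousOn_primitive hφ).comp hY_cont hY_ge 0 hmem).mono
      Ioo_subset_Ico_self).tendsto.add
        (tendsto_const_nhds.sub ((hA_cont 0 hmem).mono Ioo_subset_Ico_self).tendsto)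
  refine ge_of_tendsto hlim ?_
  filter_upwards [Ioo_mem_nhdsGT ht_pos] with a ha
  have hIcc : Icc a t ⊆ Ico 0 T := Icc_subset_Ico ha.1.le htT
  have hIco : Ico a t ⊆ Ioo 0 T := fun x hx => ⟨ha.1.trans_le hx.1, hx.2.trans htT⟩
  exact primitive_comp_le_of_deriv_le hφ ha.2.le (hY_cont.mono hIcc) (hA_cont.mono hIcc)
    (fun x hx => hY x (hIco hx)) (fun x hx => hA x (hIco hx)) (fun x hx => hY_ge x (hIcc hx))
    fun x hx => hle x (hIco hx)

lemma exists_forall_le_of_primitive_le (hφ : AntitoneOn φ (Ici e))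
    (hφ_nonneg : ∀ τ ∈ Ici e, 0 ≤ φ τ) (hdiv : ∫⁻ τ in Ioi e, ENNReal.ofReal (φ τ) = ⊤) (B : ℝ) :
    ∃ Z, e ≤ Z ∧ ∀ y, ∫ τ in e..y, φ τ ≤ B → y ≤ Z := by
  obtain ⟨Z, hZ, hBZ⟩ : ∃ Z, e ≤ Z ∧ B < ∫ τ in e..Z, φ τ := by
    by_contra! hbounded
    have hint : IntegrableOn φ (Ioi e) := by
      refine integrableOn_Ioi_of_intervalIntegral_norm_bounded (l := atTop) (b := fun x : ℝ => x)
        B e (fun x => ?_) tendsto_id ?_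
      · rcases le_total e x with h | h
        · exact (intervalIntegrable_of_antitoneOn_Ici hφ le_rfl h).1
        · simp [Ioc_eq_empty_of_le h]
      · filter_upwards [eventually_ge_atTop e] with x hx
        refine (intervalIntegral.integral_congr fun τ hτ => ?_).trans_le (hbounded x hx)
        rw [uIcc_of_le hx] at hτ
        exact Real.norm_of_nonneg (hφ_nonneg τ hτ.1)
    exact hint.lintegral_lt_top.ne hdiv
  refine ⟨Z, hZ, fun y hyB => ?_⟩
  by_contra! h
  exact (hBZ.trans_le (primitive_mono hφ hφ_nonneg hZ h.le)).not_ge hyB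

variable {g : ℝ → ℝ}

/-- The integrand of the growth condition on `g`. -/
noncomputable def osgoodDensity (g : ℝ → ℝ) (τ : ℝ) : ℝ := 1 / (g τ ^ 2 * Real.log τ * τ)

/-- The right-hand side, up to the dissipation rate, of the differential inequality for the `H¹`
energy `x`, in which the frequencies are split at the modulus `(e + x) ^ κ`. -/
noncomputable def osgoodModulus (g : ℝ → ℝ) (κ x : ℝ) : ℝ :=
  g ((Real.exp 1 + x) ^ κ) ^ 2 * Real.log ((Real.exp 1 + x) ^ κ) * (Real.exp 1 + x)

lemma osgoodDensity_nonneg {τ : ℝ} (hτ : τ ∈ Ici (Real.exp 1)) : 0 ≤ osgoodDensity g τ := by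
  have hone : 1 ≤ τ := (Real.one_le_exp zero_le_one).trans hτ
  have := Real.log_nonneg hone
  rw [osgoodDensity]
  positivity

lemma antitoneOn_osgoodDensity (hg_mono : MonotoneOn g (Ioi 0)) (hg_one : ∀ r, 0 < r → 1 ≤ g r) :
    AntitoneOn (osgoodDensity g) (Ici (Real.exp 1)) := fun x hx _ _ hxy => by
  have hx_pos : 0 < x := (Real.exp_pos 1).trans_le hx
  have hlog : 1 ≤ Real.log x := (Real.le_log_iff_exp_le hx_pos).2 hx
  have hg := hg_one x hx_pos
  have hg_le := hg_mono hx_pos (hx_pos.trans_le hxy) hxy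
  have hlog_le := Real.log_le_log hx_pos hxy
  have hlog_nonneg := zero_le_one.trans (hlog.trans hlog_le)
  rw [osgoodDensity, osgoodDensity]
  gcongr

lemma exp_one_le_rpow {κ x : ℝ} (hκ : 1 ≤ κ) (hx : 0 ≤ x) :
    Real.exp 1 + x ≤ (Real.exp 1 + x) ^ κ ∧ Real.exp 1 ≤ (Real.exp 1 + x) ^ κ ∧
      1 ≤ Real.log ((Real.exp 1 + x) ^ κ) := by
  have hone : 1 ≤ Real.exp 1 + x := by linarith [Real.one_le_exp zero_le_one]
  have hself := Real.self_le_rpow_of_one_le hone hκ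
  have hexp : Real.exp 1 ≤ (Real.exp 1 + x) ^ κ := (le_add_of_nonneg_right hx).trans hself
  exact ⟨hself, hexp, (Real.le_log_iff_exp_le ((Real.exp_pos 1).trans_le hexp)).2 hexp⟩

lemma osgoodModulus_le (hg_mono : MonotoneOn g (Ioi 0)) (hg_one : ∀ r, 0 < r → 1 ≤ g r)
    {κ x Z : ℝ} (hκ : 1 ≤ κ) (hx : 0 ≤ x) (hZ : (Real.exp 1 + x) ^ κ ≤ Z) :
    osgoodModulus g κ x ≤ g Z ^ 2 * Real.log Z * Z := by
  obtain ⟨hself, -, hlog⟩ := exp_one_le_rpow hκ hx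
  have hY : 0 < (Real.exp 1 + x) ^ κ := by positivity
  have hg := hg_one _ hY
  have hg_le := hg_mono hY (hY.trans_le hZ) hZ
  have hlog_le := Real.log_le_log hY hZ
  have hle := hself.trans hZ
  rw [osgoodModulus]
  have hlogZ : 0 ≤ Real.log Z := zero_le_one.trans (hlog.trans hlog_le)
  gcongr

lemma osgoodDensity_mul_osgoodModulus (hg_one : ∀ r, 0 < r → 1 ≤ g r) {κ x : ℝ} (hκ : 1 ≤ κ)
    (hx : 0 ≤ x) : osgoodDensity g ((Real.exp 1 + x) ^ κ) *
      (osgoodModulus g κ x * κ * (Real.exp 1 + x) ^ (κ - 1)) = κ := by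
  obtain ⟨-, -, hlog⟩ := exp_one_le_rpow hκ hx
  have hW : 0 < Real.exp 1 + x := by positivity
  have hg := hg_one _ (Real.rpow_pos_of_pos hW κ)
  have hlog_ne : Real.log ((Real.exp 1 + x) ^ κ) ≠ 0 := by positivity
  rw [osgoodDensity, osgoodModulus, Real.rpow_sub_one hW.ne']
  field_simp

lemma exists_rpow_le_of_deriv_le (hg_mono : MonotoneOn g (Ioi 0))
    (hg_one : ∀ r, 0 < r → 1 ≤ g r)
    (hg_div : ∫⁻ τ in Ioi (Real.exp 1), ENNReal.ofReal (osgoodDensity g τ) = ⊤)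
    {κ c : ℝ} (hκ : 1 ≤ κ) (hc : 0 ≤ c) (K B : ℝ) :
    ∃ Z, Real.exp 1 ≤ Z ∧ ∀ {T : ℝ} {X X' S S' : ℝ → ℝ}, ContinuousOn X (Ico 0 T) →
      ContinuousOn S (Ico 0 T) → (∀ t ∈ Ioo 0 T, HasDerivAt X (X' t) t) →
      (∀ t ∈ Ioo 0 T, HasDerivAt S (S' t) t) → (∀ t, 0 ≤ X t) → X 0 ≤ K →
      (∀ t ∈ Ico 0 T, S t - S 0 ≤ B) →
      (∀ t ∈ Ioo 0 T, X' t ≤ c * S' t * osgoodModulus g κ (X t)) →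
      ∀ t ∈ Ico 0 T, (Real.exp 1 + X t) ^ κ ≤ Z := by
  have hanti := antitoneOn_osgoodDensity hg_mono hg_one
  have hκ_pos : 0 < κ := one_pos.trans_le hκ
  obtain ⟨Z, hZ, hle_Z⟩ := exists_forall_le_of_primitive_le hanti
    (fun _ => osgoodDensity_nonneg) hg_div
    ((∫ τ in Real.exp 1..(Real.exp 1 + K) ^ κ, osgoodDensity g τ) + κ * c * B)
  refine ⟨Z, hZ, fun {T X X' S S'} hX_cont hS_cont hX hS hX_nonneg hX0 hS_le hX' t ht =>
    hle_Z _ ?_⟩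
  have hW_pos : ∀ t, 0 < Real.exp 1 + X t := fun t => add_pos_of_pos_of_nonneg (Real.exp_pos 1)
    (hX_nonneg t)
  have hosgood := primitive_comp_le hanti (Y := fun t => (Real.exp 1 + X t) ^ κ)
    (A := fun t => κ * c * S t)
    ((continuousOn_const.add hX_cont).rpow_const fun t _ => .inl (hW_pos t).ne')
    (continuousOn_const.mul hS_cont)
    (fun t ht => ((hX t ht).const_add _).rpow_const (.inl (hW_pos t).ne'))
    (fun t ht => (hS t ht).const_mul _) (fun t _ => (exp_one_le_rpow hκ (hX_nonneg t)).2.1)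
    (fun t ht => ?_) ht
  · have hinit : ∫ τ in Real.exp 1..(Real.exp 1 + X 0) ^ κ, osgoodDensity g τ ≤
        ∫ τ in Real.exp 1..(Real.exp 1 + K) ^ κ, osgoodDensity g τ :=
      primitive_mono hanti (fun _ => osgoodDensity_nonneg) (exp_one_le_rpow hκ (hX_nonneg 0)).2.1
        (Real.rpow_le_rpow (hW_pos 0).le (by linarith) hκ_pos.le)
    rw [← mul_sub] at hosgood
    exact hosgood.trans (add_le_add hinit
      (mul_le_mul_of_nonneg_left (hS_le t ht) (by positivity)))
  · have hdensity := osgoodDensity_nonneg (g := g) (exp_one_le_rpow hκ (hX_nonneg t)).2.1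
    have hpow := Real.rpow_nonneg (hW_pos t).le (κ - 1)
    calc osgoodDensity g ((Real.exp 1 + X t) ^ κ) * (X' t * κ * (Real.exp 1 + X t) ^ (κ - 1))
        ≤ osgoodDensity g ((Real.exp 1 + X t) ^ κ) *
            (c * S' t * osgoodModulus g κ (X t) * κ * (Real.exp 1 + X t) ^ (κ - 1)) := by
          gcongr
          exact hX' t ht
      _ = c * S' t * (osgoodDensity g ((Real.exp 1 + X t) ^ κ) *
            (osgoodModulus g κ (X t) * κ * (Real.exp 1 + X t) ^ (κ - 1))) := by ring
      _ = κ * c * S' t := by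
          rw [osgoodDensity_mul_osgoodModulus hg_one hκ (hX_nonneg t)]
          ring

lemma exists_forall_le_mul_rpow (hg_mono : MonotoneOn g (Ioi 0)) (hg_one : ∀ r, 0 < r → 1 ≤ g r)
    {p : ℝ} (hp : 0 ≤ p) (hgp : g =O[atTop] fun r : ℝ => r ^ p) :
    ∃ G, ∀ r, 1 ≤ r → g r ≤ G * r ^ p := by
  obtain ⟨c, hc⟩ := hgp.bound
  obtain ⟨r₁, hr₁⟩ := eventually_atTop.1 hc
  have hr_pos : 0 < max r₁ 1 := lt_max_of_lt_right one_pos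
  have hg := hg_one _ hr_pos
  refine ⟨max c (g (max r₁ 1)), fun r hr => ?_⟩
  have hpow : 1 ≤ r ^ p := Real.one_le_rpow hr hp
  rcases le_total (max r₁ 1) r with h | h
  · have hbound := hr₁ r ((le_max_left _ _).trans h)
    rw [Real.norm_of_nonneg (zero_le_one.trans hpow)] at hbound
    exact (le_abs_self _).trans (hbound.trans (by gcongr; exact le_max_left _ _))
  · calc g r ≤ g (max r₁ 1) := hg_mono (one_pos.trans_le hr) hr_pos h
      _ ≤ g (max r₁ 1) * r ^ p := le_mul_of_one_le_right (by linarith) hpow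
      _ ≤ _ := by gcongr; exact le_max_right _ _

/-- Young's inequality `6 n Λ W ≤ (ν / C) Λ² W + (9 n² C / ν) W` leaves half of the dissipation
`M` over. -/
lemma absorb_dissipation {ν n C K Λ H D M θ X W X' : ℝ} (hν : 0 < ν) (hn : 0 ≤ n) (hC : 0 < C)
    (hK : 0 ≤ K) (hH : 1 ≤ H) (hD : 0 ≤ D) (hM : 0 ≤ M) (hW : 0 ≤ W) (hΛ : 0 ≤ Λ) (hXW : X ≤ W)
    (hθ : θ * W ≤ 1) (hΛ_sq : Λ ^ 2 ≤ C * (K + H * D + θ * M))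
    (hX' : X' + 2 * ν * M ≤ 6 * (n * Λ) * X) :
    X' + ν * M ≤ (ν * (K + 1) + 9 * n ^ 2 * C / ν) * (1 + D) * (H * W) := by
  have hyoung : 6 * (n * Λ) ≤ ν / C * Λ ^ 2 + 9 * n ^ 2 * C / ν := by
    have hsq : ν / C * Λ ^ 2 + 9 * n ^ 2 * C / ν - 6 * (n * Λ) =
        ν / C * (Λ - 3 * n * C / ν) ^ 2 := by
      field_simp
      ring
    rw [← sub_nonneg, hsq]
    positivity
  have hK_le : K + H * D ≤ (K + 1) * (1 + D) * H := by
    nlinarith [mul_nonneg hK hD, mul_nonneg hK (sub_nonneg.2 hH),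
      mul_nonneg (mul_nonneg hK hD) (zero_le_one.trans hH)]
  have hDH : 1 ≤ (1 + D) * H := one_le_mul_of_one_le_of_one_le (by linarith) hH
  have hmain : 6 * (n * Λ) * X ≤
      (ν * (K + 1) + 9 * n ^ 2 * C / ν) * (1 + D) * (H * W) + ν * M :=
    calc 6 * (n * Λ) * X ≤ 6 * (n * Λ) * W := by gcongr
      _ ≤ (ν / C * (C * (K + H * D + θ * M)) + 9 * n ^ 2 * C / ν) * W := by
          gcongr
          exact hyoung.trans (by gcongr)
      _ = ν * ((K + H * D) * W) + 9 * n ^ 2 * C / ν * (1 * W) + ν * M * (θ * W) := by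
          field_simp
          ring
      _ ≤ ν * ((K + 1) * (1 + D) * H * W) + 9 * n ^ 2 * C / ν * ((1 + D) * H * W) +
          ν * M * 1 := by gcongr
      _ = _ := by ring
  linarith

end Osgood

section EnergyBound

variable {N : ℕ} {ν s : ℝ}

lemma sobolevNormSq_le_add {v w : Sp N → Sp N} (hv : IsL2 v) (hw : IsL2 w) :
    sobolevNormSq s v ≤ 2 * (sobolevNormSq s (v - w) + sobolevNormSq s w) := by
  have hmeas : AEMeasurable (fun ξ => ENNReal.ofReal (weight s ξ) * ‖hat w ξ‖ₑ ^ 2) volume :=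
    (continuous_weight s).measurable.ennreal_ofReal.aemeasurable.mul
      ((aestronglyMeasurable_hat w).enorm.pow_const 2)
  simp only [sobolevNormSq_eq]
  rw [← lintegral_add_right' _ hmeas, ← lintegral_const_mul' _ _ ENNReal.ofNat_ne_top]
  refine lintegral_mono_ae ?_
  filter_upwards [hat_sub hv hw] with ξ hξ
  rw [hξ, ← mul_add, mul_left_comm]
  gcongr
  have htriangle : ‖hat v ξ‖ₑ ≤ ‖hat v ξ - hat w ξ‖ₑ + ‖hat w ξ‖ₑ := by
    simpa only [sub_add_cancel] using enorm_add_le (hat v ξ - hat w ξ) (hat w ξ)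
  refine (pow_le_pow_left₀ zero_le htriangle 2).trans ?_
  have := ENNReal.rpow_add_le_mul_rpow_add_rpow ‖hat v ξ - hat w ξ‖ₑ ‖hat w ξ‖ₑ one_le_two
  norm_num at this
  exact this

lemma IsContinuousInSobolev.exists_bound {I : Set ℝ} (hI : IsCompact I) {v : ℝ → Sp N → Sp N}
    (hv : IsContinuousInSobolev s I v) :
    ∃ C : ℝ≥0∞, C < ⊤ ∧ ∀ t ∈ I, sobolevNormSq s (v t) ≤ C := by
  refine hI.induction_on (p := fun A => ∃ C : ℝ≥0∞, C < ⊤ ∧ ∀ t ∈ A, sobolevNormSq s (v t) ≤ C)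
    ⟨0, by simp, by simp⟩ (fun A A' hsub ⟨C, hC, h⟩ => ⟨C, hC, fun t ht => h t (hsub ht)⟩)
    (fun A A' ⟨C, hC, h⟩ ⟨C', hC', h'⟩ => ⟨max C C', max_lt hC hC', ?_⟩) fun t₀ ht₀ => ?_
  · rintro t (ht | ht)
    exacts [(h t ht).trans (le_max_left _ _), (h' t ht).trans (le_max_right _ _)]
  · refine ⟨_, inter_mem ((hv.continuous t₀ ht₀).eventually_le_const one_pos) self_mem_nhdsWithin,
      2 * (1 + sobolevNormSq s (v t₀)), ENNReal.mul_lt_top ENNReal.ofNat_lt_top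
        (ENNReal.add_lt_top.2 ⟨ENNReal.one_lt_top, hv.sobolev t₀ ht₀⟩), fun t ht => ?_⟩
    refine (sobolevNormSq_le_add (hv.isL2 t ht.2) (hv.isL2 t₀ ht₀)).trans ?_
    gcongr
    exact ht.1

lemma ofReal_kinetic_le (hs : 0 ≤ s) (u b : Sp N → Sp N) :
    ENNReal.ofReal (kinetic u b) ≤ sobolevNormSq s u + sobolevNormSq s b := by
  have hle : ∀ v : Sp N → Sp N, ENNReal.ofReal (‖toL2 v‖ ^ 2) ≤ sobolevNormSq s v := fun v => by
    rw [← enorm_sq_eq_ofReal, enorm_sq_toL2]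
    simpa only [one_mul] using lintegral_le_sobolevNormSq (f := fun _ => 1) fun ξ =>
      ENNReal.one_le_ofReal.2 (one_le_weight hs ξ)
  rw [kinetic, ENNReal.ofReal_add (sq_nonneg _) (sq_nonneg _)]
  exact add_le_add (hle u) (hle b)

namespace IsSolution

variable {m : Sp N → ℝ} {u b : ℝ → Sp N → Sp N} {I : Set ℝ} {t T : ℝ}

lemma gradNormSq_eq (h : IsSolution ν m s I u b) (hs : 2 + (N : ℝ) / 2 < s) (ht : t ∈ I) :
    gradNormSq (u t) + gradNormSq (b t) = ENNReal.ofReal (gradSq (u t) + gradSq (b t)) := by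
  rw [((h.u_sobolev.hasMoments hs ht).mono one_le_two).gradNormSq_eq,
    ((h.b_sobolev.hasMoments hs ht).mono one_le_two).gradNormSq_eq,
    ENNReal.ofReal_add (gradSq_nonneg _) (gradSq_nonneg _)]

lemma nonlinearGradPower_le (h : IsSolution ν m s I u b) (hs : 2 + (N : ℝ) / 2 < s) (ht : t ∈ I) :
    nonlinearGradPower (u t) (b t) ≤
      3 * (N * (freqL1 (u t)).toReal) * (gradSq (u t) + gradSq (b t)) :=
  have hu := h.u_sobolev.hasMoments hs ht
  (le_abs_self _).trans (hu.abs_nonlinearGradPower_le (h.b_sobolev.hasMoments hs ht)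
    (h.u_div t ht) (h.b_div t ht)
    ((hu.mono one_le_two).gradNorm_le (freqL1_lt_top hs (h.u_sobolev.sobolev t ht))))

lemma energyH1_le (hT : 0 < T) (hν : 0 < ν) (hs : 2 + (N : ℝ) / 2 < s) (hm : Measurable m)
    (hI : I =ᵐ[volume] Ioo 0 T) (hI' : interior I = Ioo 0 T) (h : IsSolution ν m s I u b)
    {G G' : ℝ → ℝ} {B C : ℝ} (hB : ∀ t ∈ I, gradSq (u t) + gradSq (b t) ≤ B)
    (hG : ∀ t ∈ Ioo 0 T, HasDerivAt G (G' t) t)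
    (hG' : ∀ t ∈ Ioo 0 T, 2 * nonlinearGradPower (u t) (b t) -
      ν * (multGradNormSq m (u t)).toReal ≤ G' t)
    (hC : ∀ t ∈ Ioo 0 T, ∀ r ∈ Ioo 0 T, G r - G t ≤ C) :
    energyH1 m I u b ≤ ENNReal.ofReal B + ENNReal.ofReal ((C + B) / ν) := by
  have hsub : Ioo 0 T ⊆ I := hI' ▸ interior_subset
  have hX : ∀ t, 0 ≤ gradSq (u t) + gradSq (b t) := fun t =>
    add_nonneg (gradSq_nonneg _) (gradSq_nonneg _)
  have hle : ∀ t ∈ Ioo 0 T, (multGradNormSq m (u t)).toReal ≤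
      (G' t - 2 * (nonlinearGradPower (u t) (b t) - ν * (multGradNormSq m (u t)).toReal)) / ν :=
    fun t ht => (le_div_iff₀' hν).2 (by linarith [hG' t ht])
  refine add_le_add (iSup₂_le fun t ht => ?_) ?_
  · rw [h.gradNormSq_eq hs ht]
    exact ENNReal.ofReal_le_ofReal (hB t ht)
  · rw [Measure.restrict_congr_set hI]
    refine (setLIntegral_mono' measurableSet_Ioo fun t ht => ?_).trans (setLIntegral_Ioo_deriv_le hT
      (fun t ht => ((hG t ht).sub (h.hasDerivAt_gradSq hs hm (hI' ▸ ht))).div_const ν)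
      (fun t ht => ENNReal.toReal_nonneg.trans (hle t ht)) fun t ht r hr => ?_)
    · exact (ENNReal.ofReal_toReal (h.multGradNormSq_lt_top hs hm (hI' ▸ ht)).ne).symm.trans_le
        (ENNReal.ofReal_le_ofReal (hle t ht))
    · rw [← sub_div]
      refine div_le_div_of_nonneg_right ?_ hν.le
      simp only [Pi.sub_apply]
      linarith [hC t ht r hr, hB t (hsub ht), hX r]

lemma exists_freqL1_le (hI : IsCompact I) (h : IsSolution ν m s I u b)
    (hs : 2 + (N : ℝ) / 2 < s) : ∃ Λ : ℝ, 0 ≤ Λ ∧ ∀ t ∈ I, (freqL1 (u t)).toReal ≤ Λ := by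
  obtain ⟨S, hS, hu⟩ := h.u_sobolev.exists_bound hI
  obtain ⟨C, hC, hle⟩ : ∃ C : ℝ≥0∞, C < ⊤ ∧ ∀ t ∈ I, freqL1 (u t) ^ 2 ≤ C :=
    ⟨_, ENNReal.mul_lt_top (by finiteness)
        (ENNReal.mul_lt_top (lintegral_pow_four_div_weight_lt_top hs) hS),
      fun t ht => (freqL1_sq_le s (u t)).trans (mul_le_mul' le_rfl (mul_le_mul' le_rfl (hu t ht)))⟩
  refine ⟨√C.toReal, Real.sqrt_nonneg _, fun t ht => Real.le_sqrt_of_sq_le ?_⟩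
  rw [← ENNReal.toReal_pow]
  exact ENNReal.toReal_mono hC.ne (hle t ht)

lemma energyH1_lt_top (hν : 0 < ν) (hs : 2 + (N : ℝ) / 2 < s) (hT : 0 < T) (hm : Measurable m)
    (h : IsSolution ν m s (Icc 0 T) u b) : energyH1 m (Icc 0 T) u b < ⊤ := by
  obtain ⟨B, hB⟩ := isCompact_Icc.exists_bound_of_continuousOn
    ((h.u_sobolev.continuousOn_gradSq hs).add (h.b_sobolev.continuousOn_gradSq hs))
  replace hB := fun t ht => (le_abs_self _).trans (hB t ht)
  obtain ⟨Λ, hΛ_nonneg, hΛ⟩ := h.exists_freqL1_le isCompact_Icc hs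
  have hX : ∀ t, 0 ≤ gradSq (u t) + gradSq (b t) := fun t =>
    add_nonneg (gradSq_nonneg _) (gradSq_nonneg _)
  have hB_nonneg : 0 ≤ B := (hX 0).trans (hB 0 (left_mem_Icc.2 hT.le))
  set c := 6 * (N * Λ) * B
  have hc : 0 ≤ c := by positivity
  refine (h.energyH1_le hT hν hs hm Ioo_ae_eq_Icc.symm interior_Icc (G := fun t => c * t) hB
    (fun t _ => (hasDerivAt_id t).const_mul c) (C := c * T) (fun t ht => ?_)
    fun t ht r hr => ?_).trans_lt (ENNReal.add_lt_top.2 ⟨ENNReal.ofReal_lt_top,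
      ENNReal.ofReal_lt_top⟩)
  · have htI := Ioo_subset_Icc_self ht
    have hpower : 6 * (N * (freqL1 (u t)).toReal) * (gradSq (u t) + gradSq (b t)) ≤ c := by
      simp only [c]
      gcongr
      exacts [hX t, hΛ t htI, hB t htI]
    linarith [h.nonlinearGradPower_le hs htI,
      mul_nonneg hν.le (ENNReal.toReal_nonneg (a := multGradNormSq m (u t)))]
  · linarith [mul_le_mul_of_nonneg_left hr.2.le hc, mul_nonneg hc ht.1.le]

lemma antitoneOn_kinetic (hν : 0 ≤ ν) (hs : 2 + (N : ℝ) / 2 < s)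
    (h : IsSolution ν m s (Ico 0 T) u b) :
    AntitoneOn (fun t => kinetic (u t) (b t)) (Ico 0 T) := by
  have hs0 : 0 ≤ s := (by positivity : (0 : ℝ) ≤ 2 + N / 2).trans hs.le
  refine antitoneOn_of_deriv_nonpos (convex_Ico 0 T) (h.continuousOn_kinetic hs0)
    (fun t ht => (h.hasDerivAt_kinetic hs ht).differentiableAt.differentiableWithinAt)
    fun t ht => ?_
  rw [(h.hasDerivAt_kinetic hs ht).deriv]
  linarith [mul_nonneg hν (ENNReal.toReal_nonneg (a := dissip m (u t)))]

end IsSolution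

/-- A rescaled time, which runs at the speed `1 + D` when `D` is the dissipation rate of the
kinetic energy. -/
noncomputable def dissipationClock (ν : ℝ) (u b : ℝ → Sp N → Sp N) (t : ℝ) : ℝ :=
  t - kinetic (u t) (b t) / (2 * ν)

namespace IsSolution

variable {m : Sp N → ℝ} {u b : ℝ → Sp N → Sp N} {I : Set ℝ} {t T K : ℝ}

lemma hasDerivAt_dissipationClock (hν : ν ≠ 0) (hs : 2 + (N : ℝ) / 2 < s)
    (h : IsSolution ν m s I u b) (ht : t ∈ interior I) :
    HasDerivAt (dissipationClock ν u b) (1 + (dissip m (u t)).toReal) t := by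
  refine ((hasDerivAt_id t).sub ((h.hasDerivAt_kinetic hs ht).div_const (2 * ν))).congr_deriv ?_
  field_simp
  ring

lemma dissipationClock_sub_le (hν : 0 < ν) (hs : 2 + (N : ℝ) / 2 < s)
    (h : IsSolution ν m s (Ico 0 T) u b) (hK : kinetic (u 0) (b 0) ≤ K) {r : ℝ}
    (ht : t ∈ Ico 0 T) (hr : r ∈ Ico 0 T) :
    dissipationClock ν u b r - dissipationClock ν u b t ≤ T + K / (2 * ν) := by
  have hkinetic : kinetic (u t) (b t) ≤ K := (h.antitoneOn_kinetic hν.le hs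
    (left_mem_Ico.2 (ht.1.trans_lt ht.2)) ht ht.1).trans hK
  have hdiv : kinetic (u t) (b t) / (2 * ν) ≤ K / (2 * ν) := by gcongr
  have hnonneg : 0 ≤ kinetic (u r) (b r) / (2 * ν) :=
    div_nonneg (kinetic_nonneg _ _) (by positivity)
  rw [dissipationClock, dissipationClock]
  linarith [hr.2, ht.1]

lemma exists_deriv_gradSq_le {α : ℝ} (hν : 0 < ν) (hα : 1 + (N : ℝ) / 2 ≤ α)
    (hs : 2 + (N : ℝ) / 2 < s) {g : ℝ → ℝ} (hg_mono : MonotoneOn g (Ioi 0))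
    (hg_one : ∀ r, 0 < r → 1 ≤ g r) {p G δ κ : ℝ} (hG : ∀ r, 1 ≤ r → g r ≤ G * r ^ p)
    (hδ : 0 < δ) (hpδ : 4 * δ = 2 * α - 2 * p - N) (hκ : 1 ≤ κ) (hκδ : 1 ≤ 2 * δ * κ)
    (R : ℝ) (hK : 0 ≤ K) :
    ∃ C : ℝ, 0 ≤ C ∧ ∀ m : Sp N → ℝ, Measurable m → LowerBoundFrom α g R m →
      ∀ (I : Set ℝ) (u b : ℝ → Sp N → Sp N), IsSolution ν m s I u b → ∀ t ∈ interior I,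
        kinetic (u t) (b t) ≤ K → 2 * nonlinearGradPower (u t) (b t) -
            ν * (multGradNormSq m (u t)).toReal ≤
          C * (1 + (dissip m (u t)).toReal) *
            osgoodModulus g κ (gradSq (u t) + gradSq (b t)) := by
  obtain ⟨C, hC, hfreq⟩ := exists_freqL1_sq_le hα hg_mono hg_one hG hδ hpδ R
  refine ⟨ν * (K + 1) + 9 * (N : ℝ) ^ 2 * C / ν, by positivity,
    fun m hm hlow I u b h t ht hkinetic => ?_⟩
  have htI := interior_subset ht
  have hX : 0 ≤ gradSq (u t) + gradSq (b t) := add_nonneg (gradSq_nonneg _) (gradSq_nonneg _)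
  set X := gradSq (u t) + gradSq (b t)
  obtain ⟨hWY, -, hlog⟩ := exp_one_le_rpow hκ hX
  have hW : 1 ≤ Real.exp 1 + X := le_add_of_le_of_nonneg (Real.one_le_exp zero_le_one) hX
  rw [osgoodModulus]
  set W := Real.exp 1 + X
  have hW_pos : 0 < W := one_pos.trans_le hW
  have hY : 1 ≤ W ^ κ := hW.trans hWY
  have hthreshold : (W ^ κ) ^ (-2 * δ) * W ≤ 1 := by
    rw [← Real.rpow_mul hW_pos.le, ← Real.rpow_add_one hW_pos.ne']
    exact Real.rpow_le_one_of_one_le_of_nonpos hW (by linarith)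
  have hu : ‖toL2 (u t)‖ ^ 2 ≤ K := (le_add_of_nonneg_right (sq_nonneg _)).trans hkinetic
  have hsplit := hfreq m hm hlow (u t) ((h.u_sobolev.hasMoments hs htI).mono one_le_two)
    (h.dissip_lt_top ht) (h.multGradNormSq_lt_top hs hm ht) _ hY
  have habsorb := absorb_dissipation (X' := 2 * (nonlinearGradPower (u t) (b t) -
      ν * (multGradNormSq m (u t)).toReal)) hν (Nat.cast_nonneg N) hC hK
    (one_le_mul_of_one_le_of_one_le (one_le_pow₀ (hg_one _ (one_pos.trans_le hY))) hlog)
    ENNReal.toReal_nonneg ENNReal.toReal_nonneg hW_pos.le ENNReal.toReal_nonneg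
    (le_add_of_nonneg_left (Real.exp_pos 1).le) hthreshold (hsplit.trans (by gcongr))
    (by linarith [h.nonlinearGradPower_le hs htI])
  linarith

lemma energyH1_le_of_rpow_le {g : ℝ → ℝ} (hg_mono : MonotoneOn g (Ioi 0))
    (hg_one : ∀ r, 0 < r → 1 ≤ g r) (hν : 0 < ν) (hs : 2 + (N : ℝ) / 2 < s) (hm : Measurable m)
    {κ c B Z : ℝ} (hκ : 1 ≤ κ) (hc : 0 ≤ c) (hT : 0 < T) (hB : T + K / (2 * ν) ≤ B)
    (h : IsSolution ν m s (Ico 0 T) u b) (hkinetic : kinetic (u 0) (b 0) ≤ K)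
    (hderiv : ∀ t ∈ Ioo 0 T, 2 * nonlinearGradPower (u t) (b t) -
      ν * (multGradNormSq m (u t)).toReal ≤
        c * (1 + (dissip m (u t)).toReal) * osgoodModulus g κ (gradSq (u t) + gradSq (b t)))
    (hZ : ∀ t ∈ Ico 0 T, (Real.exp 1 + (gradSq (u t) + gradSq (b t))) ^ κ ≤ Z) :
    energyH1 m (Ico 0 T) u b ≤
      ENNReal.ofReal Z + ENNReal.ofReal ((c * (g Z ^ 2 * Real.log Z * Z) * B + Z) / ν) := by
  have hX : ∀ t, 0 ≤ gradSq (u t) + gradSq (b t) := fun t =>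
    add_nonneg (gradSq_nonneg _) (gradSq_nonneg _)
  have hexp_Z : Real.exp 1 ≤ Z := (exp_one_le_rpow hκ (hX 0)).2.1.trans (hZ 0 (left_mem_Ico.2 hT))
  have hZ_pos : 0 < Z := (Real.exp_pos 1).trans_le hexp_Z
  have hlogZ : 0 ≤ Real.log Z := Real.log_nonneg ((Real.one_le_exp zero_le_one).trans hexp_Z)
  refine h.energyH1_le hT hν hs hm Ioo_ae_eq_Ico.symm interior_Ico
    (G := fun t => c * (g Z ^ 2 * Real.log Z * Z) * dissipationClock ν u b t) (fun t ht => ?_)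
    (fun t ht => (h.hasDerivAt_dissipationClock hν.ne' hs (by rwa [interior_Ico])).const_mul _)
    (fun t ht => (hderiv t ht).trans ?_) fun t ht r hr => ?_
  · exact (le_add_of_nonneg_left (Real.exp_pos 1).le).trans
      ((exp_one_le_rpow hκ (hX t)).1.trans (hZ t ht))
  · calc _ ≤ c * (1 + (dissip m (u t)).toReal) * (g Z ^ 2 * Real.log Z * Z) := by
          gcongr
          exact osgoodModulus_le hg_mono hg_one hκ (hX t) (hZ t (Ioo_subset_Ico_self ht))
      _ = _ := mul_right_comm _ _ _
  · rw [← mul_sub]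
    exact mul_le_mul_of_nonneg_left ((h.dissipationClock_sub_le hν hs hkinetic
      (Ioo_subset_Ico_self ht) (Ioo_subset_Ico_self hr)).trans hB) (by positivity)

lemma exists_energyH1_le {g : ℝ → ℝ} (hg_mono : MonotoneOn g (Ioi 0))
    (hg_one : ∀ r, 0 < r → 1 ≤ g r)
    (hg_div : ∫⁻ τ in Ioi (Real.exp 1), ENNReal.ofReal (osgoodDensity g τ) = ⊤)
    (hν : 0 < ν) (hs : 2 + (N : ℝ) / 2 < s) {κ c : ℝ} (hκ : 1 ≤ κ) (hc : 0 ≤ c) (T K : ℝ) :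
    ∃ C : ℝ≥0, ∀ m : Sp N → ℝ, Measurable m → ∀ T', 0 < T' → T' ≤ T → ∀ u b : ℝ → Sp N → Sp N,
      IsSolution ν m s (Ico 0 T') u b →
      kinetic (u 0) (b 0) ≤ K → gradSq (u 0) + gradSq (b 0) ≤ K →
      (∀ t ∈ Ioo 0 T', 2 * nonlinearGradPower (u t) (b t) -
          ν * (multGradNormSq m (u t)).toReal ≤
        c * (1 + (dissip m (u t)).toReal) * osgoodModulus g κ (gradSq (u t) + gradSq (b t))) →
      energyH1 m (Ico 0 T') u b ≤ C := by
  obtain ⟨Z, -, hosgood⟩ :=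
    exists_rpow_le_of_deriv_le hg_mono hg_one hg_div hκ hc K (T + K / (2 * ν))
  refine ⟨Z.toNNReal + ((c * (g Z ^ 2 * Real.log Z * Z) * (T + K / (2 * ν)) + Z) / ν).toNNReal,
    fun m hm T' hT' hTT u b h hkinetic hgrad hderiv => ?_⟩
  have hs0 : 0 ≤ s := (by positivity : (0 : ℝ) ≤ 2 + N / 2).trans hs.le
  have hB : T' + K / (2 * ν) ≤ T + K / (2 * ν) := add_le_add_left hTT _
  rw [ENNReal.coe_add]
  refine h.energyH1_le_of_rpow_le hg_mono hg_one hν hs hm hκ hc hT' hB hkinetic hderiv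
    (hosgood (X := fun t => gradSq (u t) + gradSq (b t))
      (S := dissipationClock ν u b) (S' := fun t => 1 + (dissip m (u t)).toReal)
      ((h.u_sobolev.continuousOn_gradSq hs).add (h.b_sobolev.continuousOn_gradSq hs))
      (continuousOn_id.sub ((h.continuousOn_kinetic hs0).div_const _))
      (fun t ht => h.hasDerivAt_gradSq hs hm (by rwa [interior_Ico]))
      (fun t ht => h.hasDerivAt_dissipationClock hν.ne' hs (by rwa [interior_Ico]))
      (fun t => add_nonneg (gradSq_nonneg _) (gradSq_nonneg _)) hgrad
      (fun t ht => (h.dissipationClock_sub_le hν hs hkinetic (left_mem_Ico.2 hT') ht).trans hB)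
      fun t ht => ?_)
  linarith [hderiv t ht, mul_nonneg hν.le (ENNReal.toReal_nonneg (a := multGradNormSq m (u t)))]

lemma exists_apriori_bound {α : ℝ} (hν : 0 < ν) (hα : 1 + (N : ℝ) / 2 ≤ α) {g : ℝ → ℝ}
    (hg_mono : MonotoneOn g (Ioi 0)) (hg_one : ∀ r, 0 < r → 1 ≤ g r)
    (hg_div : ∫⁻ τ in Ioi (Real.exp 1), ENNReal.ofReal (osgoodDensity g τ) = ⊤)
    (hs : 2 + (N : ℝ) / 2 < s) (T : ℝ) {p : ℝ} (hp : 0 ≤ p) (hpα : p < α - (N : ℝ) / 2)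
    (hgp : g =O[atTop] fun r : ℝ => r ^ p) (R : ℝ) (K : ℝ≥0) :
    ∃ C : ℝ≥0, ∀ m : Sp N → ℝ, Measurable m → LowerBoundFrom α g R m → ∀ T', 0 < T' → T' ≤ T →
      ∀ u b : ℝ → Sp N → Sp N, IsSolution ν m s (Ico 0 T') u b →
        sobolevNormSq s (u 0) + sobolevNormSq s (b 0) ≤ K → energyH1 m (Ico 0 T') u b ≤ C := by
  have hs1 : 1 ≤ s := by linarith [Nat.cast_nonneg (α := ℝ) N]
  obtain ⟨G, hG⟩ := exists_forall_le_mul_rpow hg_mono hg_one hp hgp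
  set δ := (2 * α - 2 * p - N) / 4 with hδ_def
  have hδ : 0 < δ := by linarith
  set κ := max 1 (1 / (2 * δ))
  have hκ : 1 ≤ κ := le_max_left _ _
  have hκδ : 1 ≤ 2 * δ * κ := (div_le_iff₀' (by positivity)).1 (le_max_right _ _)
  obtain ⟨c, hc, hderiv⟩ := exists_deriv_gradSq_le (N := N) hν hα hs hg_mono hg_one hG hδ
    (by linarith) hκ hκδ R K.2
  obtain ⟨C, hC⟩ := exists_energyH1_le (N := N) hg_mono hg_one hg_div hν hs hκ hc T K
  refine ⟨C, fun m hm hlow T' hT' hTT u b h hK => ?_⟩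
  have hmem : (0 : ℝ) ∈ Ico 0 T' := left_mem_Ico.2 hT'
  have hkinetic : kinetic (u 0) (b 0) ≤ K :=
    ENNReal.ofReal_le_coe.1 ((ofReal_kinetic_le (zero_le_one.trans hs1) _ _).trans hK)
  have hgrad : gradSq (u 0) + gradSq (b 0) ≤ K := by
    rw [← ENNReal.ofReal_le_coe, ENNReal.ofReal_add (gradSq_nonneg _) (gradSq_nonneg _)]
    exact (add_le_add
      (((h.u_sobolev.hasMoments hs hmem).mono one_le_two).gradSq_le_sobolev hs1)
      (((h.b_sobolev.hasMoments hs hmem).mono one_le_two).gradSq_le_sobolev hs1)).trans hK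
  exact hC m hm T' hT' hTT u b h hkinetic hgrad fun t ht =>
    hderiv m hm hlow _ u b h t (by rwa [interior_Ico]) ((h.antitoneOn_kinetic hν.le hs hmem
      (Ioo_subset_Ico_self ht) ht.1.le).trans hkinetic)

end IsSolution

end EnergyBound

end MHD

theorem proposition3p1_general (N : ℕ) (ν : ℝ) (hν : 0 < ν) (α : ℝ)
    (hα : 1 + (N : ℝ) / 2 ≤ α) (g : ℝ → ℝ) (hg_mono : MonotoneOn g (Ioi 0))
    (hg_one : ∀ r, 0 < r → 1 ≤ g r)
    (hg_div : ∫⁻ τ in Ioi (Real.exp 1), ENNReal.ofReal (1 / (g τ ^ 2 * Real.log τ * τ)) = ⊤)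
    (s : ℝ) (hs : 2 + (N : ℝ) / 2 < s) (T : ℝ) (hT : 0 < T) :
    (∀ m : MHD.Sp N → ℝ, Measurable m →
      ∀ u b : ℝ → MHD.Sp N → MHD.Sp N, MHD.IsSolution ν m s (Icc 0 T) u b →
        MHD.energyH1 m (Icc 0 T) u b < ⊤) ∧
    ((∃ p : ℝ, p < α - (N : ℝ) / 2 ∧ g =O[atTop] fun r : ℝ => r ^ p) →
      ∀ (R : ℝ) (K : ℝ≥0), ∃ C : ℝ≥0,
        ∀ m : MHD.Sp N → ℝ, Measurable m → MHD.LowerBoundFrom α g R m →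
          ∀ T', 0 < T' → T' ≤ T →
            ∀ u b : ℝ → MHD.Sp N → MHD.Sp N, MHD.IsSolution ν m s (Ico 0 T') u b →
              MHD.sobolevNormSq s (u 0) + MHD.sobolevNormSq s (b 0) ≤ K →
                MHD.energyH1 m (Ico 0 T') u b ≤ C) := by
  refine ⟨fun m hm u b h => h.energyH1_lt_top hν hs hT hm, ?_⟩
  rintro ⟨p, hp, hgp⟩ R K
  have hp_le : (fun r : ℝ => r ^ p) =O[atTop] fun r : ℝ => r ^ max p 0 :=
    IsBigO.of_norm_eventuallyLE <| by
      filter_upwards [eventually_ge_atTop 1] with r hr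
      rw [Real.norm_of_nonneg (Real.rpow_nonneg (zero_le_one.trans hr) p)]
      exact Real.rpow_le_rpow_of_exponent_le hr (le_max_left p 0)
  exact MHD.IsSolution.exists_apriori_bound hν hα hg_mono hg_one hg_div hs T (le_max_right p 0)
    (max_lt hp (by linarith)) (hgp.trans hp_le) R K

theorem proposition3p1 (N : ℕ) (hN : 2 ≤ N) (ν : ℝ) (hν : 0 < ν) (α : ℝ)
    (hα : 1 + (N : ℝ) / 2 ≤ α) (g : ℝ → ℝ) (hg_mono : MonotoneOn g (Ioi 0))
    (hg_one : ∀ r, 0 < r → 1 ≤ g r)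
    (hg_div : ∫⁻ τ in Ioi (Real.exp 1), ENNReal.ofReal (1 / (g τ ^ 2 * Real.log τ * τ)) = ⊤)
    (s : ℝ) (hs : 3 + (N : ℝ) ≤ s) (T : ℝ) (hT : 0 < T) :
    -- finiteness for every solution on the closed interval
    (∀ m : MHD.Sp N → ℝ, Measurable m → (∃ R, MHD.LowerBoundFrom α g R m) →
      ∀ u b : ℝ → MHD.Sp N → MHD.Sp N, MHD.IsSolution ν m s (Icc 0 T) u b →
        MHD.energyH1 m (Icc 0 T) u b < ⊤) ∧
    -- the a priori bound, for solutions that need not extend to the end of their interval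
    ((∃ p : ℝ, p < α - (N : ℝ) / 2 ∧ g =O[atTop] fun r : ℝ => r ^ p) →
      ∀ (R : ℝ) (K : ℝ≥0), 0 < R → ∃ C : ℝ≥0,
        ∀ m : MHD.Sp N → ℝ, Measurable m → MHD.LowerBoundFrom α g R m →
          ∀ T', 0 < T' → T' ≤ T →
            ∀ u b : ℝ → MHD.Sp N → MHD.Sp N, MHD.IsSolution ν m s (Ico 0 T') u b →
              MHD.sobolevNormSq s (u 0) + MHD.sobolevNormSq s (b 0) ≤ K →
                MHD.energyH1 m (Ico 0 T') u b ≤ C) := by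
  obtain ⟨hfinite, hbound⟩ := proposition3p1_general N ν hν α hα g hg_mono hg_one hg_div s
    (by linarith [Nat.cast_nonneg (α := ℝ) N]) T hT
  exact ⟨fun m hm _ => hfinite m hm, fun hgp R K _ => hbound hgp R K⟩
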